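/- Let $S(z)=\frac{z^3}{3}-z$ on $\mathbb C$, with critical points $p_\pm=\pm1$ and critical values $S(p_\pm)=\mp\frac23$. For a phase $\theta\in\mathbb R$ put $F_\theta=\operatorname{Re}(e^{-i\theta}S)$ and let $\mathcal J_p^\theta$ (the Lefschetz thimble) be the stable manifold of the critical point $p$ for the negative gradient flow $\dot z=-\overline{e^{-i\theta}S'(z)}$; for $0<|\theta|<\frac\pi2$ it is a smooth curve, oriented at $p_-$ by the tangent vector $-ie^{i\theta/2}$ and at $p_+$ by $-e^{i\theta/2}$. Put $$c_m=\frac{(6m)!}{576^m(2m)!(3m)!},\qquad \widetilde\phi_+=\sum_{m\ge0}c_m\hbar^m,\qquad \widetilde\phi_-=\sum_{m\ge0}(-1)^mc_m\hbar^m,$$ $$\widetilde I_+=-\sqrt{\pi\hbar}\,e^{2/(3\hbar)}\,\widetilde\phi_+(\hbar),\qquad \widetilde I_-=-i\sqrt{\pi\hbar}\,e^{-2/(3\hbar)}\,\widetilde\phi_-(\hbar).$$ Conventions. The Borel transform of $\hbar^{\alpha}\sum_m a_m\hbar^m$ is $\sum_m a_m\xi^{m+\alpha-1}/\Gamma(m+\alpha)$;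 for the series $\widetilde\phi_\pm$ it is the ordinary one, $\widehat\phi_\pm(\xi)=\sum_m a_m\xi^m/m!$, and for $\widetilde I_\pm$ it is taken with $\alpha=\frac12$. For $\omega\ne0$, $\Delta^+_\omega$ takes a series with Borel transform $B$ to the series whose Borel transform is $\xi\mapsto(\operatorname{cont}_{\gamma^+_\omega}B-\operatorname{cont}_{\gamma^-_\omega}B)(\xi+\omega)$; here $\gamma^+_\omega$ goes from a point near $0$ on the ray $\omega\mathbb R_{>0}$ to a point of the ray just behind $\omega$, passing slightly to the right of the segment in between, and $\gamma^-_\omega$ is $\gamma^+_\omega$ followed by a small clockwise loop around $\omega$. Moreover $\dot\Delta^+_\omega=e^{-\omega/\hbar}\Delta^+_\omega$, where $\Delta^+_\omega$ commutes with multiplication by $e^{-A/\hbar}$, and $\mathfrak S^+=\mathrm{Id}+\sum_{\omega>0}\dot\Delta^+_\omega$ is the Stokes automorphism along the positive real ray. Then: 1. (Saddle series.) For $0<|\theta|<\frac\pi2$ the thimbles $\mathcal J_\pm^\theta:=\mathcal J^\theta_{p_\pm}$ admit smooth regular injective oriented parametrizations; the integral $I_{\mathcal J_\pm^\theta}(\hbar)=\int_{\mathcal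 J_\pm^\theta}e^{-S(z)/\hbar}dz$ converges absolutely for $|\arg\hbar-\theta|<\frac\pi2$, and $I_{\mathcal J_\pm^\theta}(\hbar)\sim\widetilde I_\pm(\hbar)$ as $\hbar\to0$ in every sector $|\arg\hbar-\theta|\le\eta$, $\eta<\frac\pi2$. 2. (Borel transforms.) For $|\xi|<\frac43$, $\widehat\phi_\pm(\xi)={}_2F_1\!\left(\frac16,\frac56;1;\pm\frac{3\xi}4\right)$. The function $\widehat\phi_+$ continues holomorphically to $\mathbb C\setminus[\frac43,\infty)$ and $\widehat\phi_-$ to $\mathbb C\setminus(-\infty,-\frac43]$, and for functions $H_\pm$ holomorphic near $\pm\frac43$ $$\widehat\phi_\pm(\xi)=H_\pm(\xi)-\frac{i}{2\pi i}\log\!\left(\xi\mp\tfrac43\right)\widehat\phi_\mp\!\left(\xi\mp\tfrac43\right)\qquad\text{near }\xi=\pm\tfrac43$$ (off the cut). 3. (Alien operators.) $\Delta^+_{4/3}\widetilde\phi_+=-i\widetilde\phi_-$, $\Delta^+_{-4/3}\widetilde\phi_-=-i\widetilde\phi_+$, $\Delta^+_{-4/3}\widetilde\phi_+=0$, $\Delta^+_{4/3}\widetilde\phi_-=0$;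 and $$\dot\Delta^+_{4/3}\widetilde I_+=-\widetilde I_-,\qquad \dot\Delta^+_{-4/3}\widetilde I_-=\widetilde I_+,\qquad \dot\Delta^+_{-4/3}\widetilde I_+=0,\qquad \dot\Delta^+_{4/3}\widetilde I_-=0.$$ 4. (Stokes automorphism.) $\displaystyle\mathfrak S^+(\widetilde I_-,\widetilde I_+)=(\widetilde I_-,\widetilde I_+)\begin{pmatrix}1&-1\\0&1\end{pmatrix}.$ 5. (Thimble jump.) Let $0<\varepsilon<\frac\pi4$, and let $<$ and $>$ denote the phases $-\varepsilon$ and $\varepsilon$. For $|\arg\hbar|<\frac\pi2-\varepsilon$ the row vectors $\mathbf I^{\lessgtr}=(I_{\mathcal J_-^{\lessgtr}},I_{\mathcal J_+^{\lessgtr}})$ satisfy $$\mathbf I^{<}=\mathbf I^{>}\begin{pmatrix}1&-1\\0&1\end{pmatrix},\qquad \mathbf I^{>}=\mathbf I^{<}\begin{pmatrix}1&1\\0&1\end{pmatrix}.$$ For every $R\in\mathbb R$ the four thimbles define classes in $H_1\bigl(\mathbb C,\{z: F_\varphi(z)\ge R\text{ for all }|\varphi|\le\varepsilon\};\mathbb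 Z\bigr)$ (the class of any sufficiently long truncation), and $$\bigl([\mathcal J_-^>]\ \ [\mathcal J_+^>]\bigr)=\bigl([\mathcal J_-^<]\ \ [\mathcal J_+^<]\bigr)\begin{pmatrix}1&1\\0&1\end{pmatrix}.$$ 6. (Connecting trajectory.) At $\theta=0$ the complete trajectories of the flow from $p_-$ (as $s\to-\infty$) to $p_+$ (as $s\to+\infty$) are exactly $z(s)=\tanh(s-s_0)$, $s_0\in\mathbb R$. So up to translation of time there is exactly one, and this number is the off-diagonal entry $1$ of the jump matrix. -/

import Mathlib

noncomputable section

/-! ### Exponential integrals in one complex variable: flow, thimbles, trajectories -/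

/-- `F_θ = Re (e^{-iθ} S)`. -/
def rotatedRe (S : ℂ → ℂ) (θ : ℝ) (z : ℂ) : ℝ :=
  (Complex.exp (-(θ : ℂ) * Complex.I) * S z).re

/-- The negative gradient vector field of `F_θ = Re (e^{-iθ} S)` for the flat metric on `ℂ`
(with `S` holomorphic): `z ↦ - conj (e^{-iθ} S'(z))`. -/
def negGradient (S : ℂ → ℂ) (θ : ℝ) (z : ℂ) : ℂ :=
  -(starRingEnd ℂ) (Complex.exp (-(θ : ℂ) * Complex.I) * deriv S z)

/-- The stable manifold of `p`: the points whose forward trajectory exists for all positive times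
and tends to `p`. As a set this is the Lefschetz thimble `𝒥_p^θ`. -/
def stableManifold (S : ℂ → ℂ) (θ : ℝ) (p : ℂ) : Set ℂ :=
  {z₀ | ∃ z : ℝ → ℂ, z 0 = z₀ ∧
    (∀ s ∈ Set.Ici (0 : ℝ), HasDerivWithinAt z (negGradient S θ (z s)) (Set.Ici 0) s) ∧
    Filter.Tendsto z Filter.atTop (nhds p)}

/-- `γ` is a smooth regular injective parametrization of the Lefschetz thimble `𝒥_p^θ`, passing
through `p` at time `0` in the direction of the (tangent) vector `v`; the vector `v` fixes the
orientation of the thimble. -/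
structure IsOrientedThimble (S : ℂ → ℂ) (θ : ℝ) (p v : ℂ) (γ : C(ℝ, ℂ)) : Prop where
  contDiff : ContDiff ℝ (⊤ : ℕ∞) γ
  injective : Function.Injective γ
  deriv_ne_zero : ∀ t, deriv γ t ≠ 0
  range_eq : Set.range γ = stableManifold S θ p
  base : γ 0 = p
  orientation : ∃ c : ℝ, 0 < c ∧ deriv γ 0 = c * v

/-- The integrand of `∫_γ e^{-S(z)/ħ} dz`, pulled back to the parameter line. -/
def expIntegrand (S : ℂ → ℂ) (γ : C(ℝ, ℂ)) (h : ℂ) (t : ℝ) : ℂ :=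
  Complex.exp (-(S (γ t)) / h) * deriv γ t

/-- The exponential integral `I_γ(ħ) = ∫_γ e^{-S(z)/ħ} dz`. -/
def expIntegral (S : ℂ → ℂ) (γ : C(ℝ, ℂ)) (h : ℂ) : ℂ :=
  ∫ t : ℝ, expIntegrand S γ h t

/-- Connecting trajectories from `q` to `p` at phase `θ`: complete trajectories of the negative
gradient flow of `F_θ` with backward limit `q` and forward limit `p`. -/
def ConnectingTrajectory (S : ℂ → ℂ) (θ : ℝ) (q p : ℂ) : Type :=
  {z : ℝ → ℂ // (∀ s, HasDerivAt z (negGradient S θ (z s)) s) ∧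
    Filter.Tendsto z Filter.atBot (nhds q) ∧ Filter.Tendsto z Filter.atTop (nhds p)}

/-- Two connecting trajectories are identified if they differ by a translation of time. -/
def trajectorySetoid (S : ℂ → ℂ) (θ : ℝ) (q p : ℂ) :
    Setoid (ConnectingTrajectory S θ q p) where
  r z w := ∃ s₀ : ℝ, ∀ s, w.1 s = z.1 (s - s₀)
  iseqv :=
    { refl := fun z => ⟨0, fun s => by simp⟩
      symm := fun {z w} ⟨s₀, h⟩ => ⟨-s₀, fun s => by simp [h]⟩
      trans := fun {z w u} ⟨s₀, h⟩ ⟨s₁, h'⟩ => ⟨s₁ + s₀, fun s => by rw [h', h, sub_sub]⟩ }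

/-- The number of connecting trajectories from `q` to `p`, up to translation of time
(it is `0` if there are infinitely many). -/
def numConnectingTrajectories (S : ℂ → ℂ) (θ : ℝ) (q p : ℂ) : ℕ :=
  Nat.card (Quotient (trajectorySetoid S θ q p))

/-! ### Relative singular homology with integral coefficients -/

/-- Singular `n`-chains of `X`. -/
abbrev SingChain (X : Type*) [TopologicalSpace X] (n : ℕ) : Type _ :=
  C(stdSimplex ℝ (Fin (n + 1)), X) →₀ ℤ

/-- The `i`-th face of a singular simplex. -/
def singFace {X : Type*} [TopologicalSpace X] {n : ℕ} (i : Fin (n + 2))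
    (σ : C(stdSimplex ℝ (Fin (n + 2)), X)) : C(stdSimplex ℝ (Fin (n + 1)), X) :=
  σ.comp ⟨stdSimplex.map i.succAbove, stdSimplex.continuous_map _⟩

/-- The singular boundary operator. -/
def singBoundary (X : Type*) [TopologicalSpace X] (n : ℕ) :
    SingChain X (n + 1) →ₗ[ℤ] SingChain X n :=
  Finsupp.linearCombination ℤ fun σ =>
    ∑ i : Fin (n + 2), (-1 : ℤ) ^ (i : ℕ) • Finsupp.single (singFace i σ) (1 : ℤ)

/-- The chains all of whose simplices lie in `A`. -/
def chainsIn {X : Type*} [TopologicalSpace X] (A : Set X) (n : ℕ) :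
    Submodule ℤ (SingChain X n) :=
  Finsupp.supported ℤ ℤ {σ | Set.range σ ⊆ A}

/-- Relative cycles of degree `n + 1` of the pair `(X, A)`. -/
def relCycles {X : Type*} [TopologicalSpace X] (A : Set X) (n : ℕ) :
    Submodule ℤ (SingChain X (n + 1)) :=
  (chainsIn A n).comap (singBoundary X n)

/-- Relative boundaries of degree `n + 1` of the pair `(X, A)`. -/
def relBoundaries {X : Type*} [TopologicalSpace X] (A : Set X) (n : ℕ) :
    Submodule ℤ (SingChain X (n + 1)) :=
  LinearMap.range (singBoundary X (n + 1)) ⊔ chainsIn A (n + 1)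

/-- The relative homology group `H_{n+1}(X, A; ℤ)`. -/
abbrev RelHomology {X : Type*} [TopologicalSpace X] (A : Set X) (n : ℕ) : Type _ :=
  relCycles A n ⧸ (relBoundaries A n).submoduleOf (relCycles A n)

/-- The curve `γ|_{[-T, T]}`, run from `γ (-T)` to `γ T`, as a singular `1`-chain. -/
def truncatedChain {X : Type*} [TopologicalSpace X] (γ : C(ℝ, X)) (T : ℝ) : SingChain X 1 :=
  Finsupp.single
    (γ.comp ⟨fun x : stdSimplex ℝ (Fin 2) => T * (x.1 1 - x.1 0),
      continuous_const.mul (((continuous_apply 1).comp continuous_subtype_val).sub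
        ((continuous_apply 0).comp continuous_subtype_val))⟩) 1

/-- The class `x ∈ H₁(X, A; ℤ)` is the class of the infinite curve `γ` (whose ends lie in `A`):
all sufficiently long truncations of `γ` are relative cycles of class `x`. -/
def RepresentsClass {X : Type*} [TopologicalSpace X] {A : Set X} (γ : C(ℝ, X))
    (x : RelHomology A 0) : Prop :=
  ∃ T₀ : ℝ, ∀ T, T₀ ≤ T → ∃ hT : truncatedChain γ T ∈ relCycles A 0,
    x = Submodule.Quotient.mk ⟨truncatedChain γ T, hT⟩

/-- The part common to the positive ends `{F_φ ≥ R}` for all the phases `|φ| ≤ ε`. For small `ε`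
and large `R` the pair `(ℂ, ·)` computes the group `H₁(X, X_{+∞}^φ; ℤ)`, compatibly for all these
phases, so that thimbles of different phases `φ` can be compared in it. -/
def commonPositiveEnd (S : ℂ → ℂ) (ε R : ℝ) : Set ℂ :=
  {z | ∀ φ : ℝ, |φ| ≤ ε → R ≤ rotatedRe S φ z}

/-! ### Borel transform, alien operators, Stokes automorphism -/

/-- `∑ a_m ξ^m / Γ(m + α)`: the Borel transform of `ħ^α ∑ a_m ħ^m` is `ξ^{α-1}` times this
series. -/
def borelSum (α : ℝ) (a : PowerSeries ℂ) (ξ : ℂ) : ℂ :=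
  ∑' m : ℕ, PowerSeries.coeff m a * ξ ^ m / (Real.Gamma (m + α) : ℂ)

/-- The series in `borelSum α a` has a positive radius of convergence. -/
def BorelConvergent (α : ℝ) (a : PowerSeries ℂ) : Prop :=
  ∃ r : ℝ, 0 < r ∧ ∀ ξ : ℂ, ‖ξ‖ < r →
    Summable fun m : ℕ => PowerSeries.coeff m a * ξ ^ m / (Real.Gamma (m + α) : ℂ)

/-- The Borel transform `∑ a_m ξ^{m+α-1} / Γ(m+α)` of `ħ^α ∑ a_m ħ^m` near `0`, with the branch of
`ξ^{α-1}` that is holomorphic around the open ray from `0` through `ω`. For `α = 1` this is the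
ordinary Borel transform `∑ a_m ξ^m / m!` of `∑ a_m ħ^m`. -/
def borelGerm (α : ℝ) (ω : ℂ) (a : PowerSeries ℂ) (ξ : ℂ) : ℂ :=
  ω ^ ((α : ℂ) - 1) * (ξ / ω) ^ ((α : ℂ) - 1) * borelSum α a ξ

/-- The ordinary Borel transform is the case `α = 1`. -/
theorem borelGerm_one (ω : ℂ) (a : PowerSeries ℂ) (ξ : ℂ) :
    borelGerm 1 ω a ξ = ∑' m : ℕ, PowerSeries.coeff m a * ξ ^ m / (m.factorial : ℂ) := by
  simp [borelGerm, borelSum, Real.Gamma_nat_eq_factorial]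

/-- The germ of `g` at `γ 1` is the analytic continuation of the germ of `f` at `γ 0` along the
path `γ : [0, 1] → ℂ`. -/
def ContinuesAlong (γ : ℝ → ℂ) (f g : ℂ → ℂ) : Prop :=
  ∃ F : ℝ → ℂ → ℂ,
    (∀ s ∈ Set.Icc (0 : ℝ) 1, AnalyticAt ℂ (F s) (γ s)) ∧
    (∀ s ∈ Set.Icc (0 : ℝ) 1,
      ∀ᶠ u in nhdsWithin s (Set.Icc 0 1), F u =ᶠ[nhds (γ u)] F s) ∧
    F 0 =ᶠ[nhds (γ 0)] f ∧ F 1 =ᶠ[nhds (γ 1)] g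

/-- The path `γ_ω^+`: from the point `ωη` near `0` to the point `ω(1+η)` behind `ω`, passing just
to the right of the points of the ray in between (for small `η > 0`). -/
def rightPath (ω : ℂ) (η : ℝ) (s : ℝ) : ℂ :=
  ω * (η + s - Complex.I * η * Real.sin (Real.pi * s))

/-- The clockwise loop around `ω` based at the point `ω(1+η)`. The path `γ_ω^-` is `γ_ω^+` followed
by this loop. -/
def clockwiseLoop (ω : ℂ) (η : ℝ) (s : ℝ) : ℂ :=
  ω * (1 + η * Complex.exp (-(2 * Real.pi * s : ℝ) * Complex.I))

/-- The relation `Δ_ω^+ (ħ^α a) = ħ^α b` for `ω ≠ 0`: with `B` the Borel transform of `ħ^α a`,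
the variation `cont_{γ_ω^+} B - cont_{γ_ω^-} B`, a germ at a point behind `ω` and close to it,
is the Borel transform of `ħ^α b` evaluated at `ξ - ω`. By uniqueness of analytic continuation
there is at most one such `b`. -/
def IsAlienPlus (α : ℝ) (ω : ℂ) (a b : PowerSeries ℂ) : Prop :=
  BorelConvergent α a ∧ BorelConvergent α b ∧
  ∀ᶠ η : ℝ in nhdsWithin 0 (Set.Ioi 0), ∃ fp fm : ℂ → ℂ,
    ContinuesAlong (rightPath ω η) (borelGerm α ω a) fp ∧
    ContinuesAlong (clockwiseLoop ω η) fp fm ∧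
    (fun ξ => fp ξ - fm ξ) =ᶠ[nhds (ω * (1 + η))] fun ξ => borelGerm α ω b (ξ - ω)

/-- Formal objects: finite sums `∑_A e^{-A/ħ} ħ^{1/2} ψ_A(ħ)` with `A ∈ ℂ`, `ψ_A ∈ ℂ[[ħ]]`,
represented by `A ↦ ψ_A`. -/
abbrev FormalObject : Type := ℂ →₀ PowerSeries ℂ

/-- The relation `Δ̇_ω^+ Ψ = Φ` for the pointed alien operator `Δ̇_ω^+ = e^{-ω/ħ} Δ_ω^+`, where
`Δ_ω^+` acts on the factors `ħ^{1/2} ψ_A(ħ)`. -/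
def IsPointedAlienPlus (ω : ℂ) (Ψ Φ : FormalObject) : Prop :=
  ∀ A : ℂ, IsAlienPlus (1 / 2) ω (Ψ A) (Φ (A + ω))

/-- The open ray `e^{iθ} ℝ_{>0}`. -/
def borelRay (θ : ℝ) : Set ℂ :=
  {ω | ∃ t : ℝ, 0 < t ∧ ω = t * Complex.exp (θ * Complex.I)}

/-- The relation `𝔖^+ Ψ = Φ` for the Stokes automorphism `𝔖^+ = Id + ∑_{ω ∈ d} Δ̇_ω^+` along the
ray `d`; all the `Δ̇_ω^+ Ψ`, `ω ∈ d`, have to exist, and each exponential `e^{-A/ħ}` has to occur in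
only finitely many of them. -/
def IsStokesPlus (d : Set ℂ) (Ψ Φ : FormalObject) : Prop :=
  ∃ D : ℂ → FormalObject, (∀ ω ∈ d, IsPointedAlienPlus ω Ψ (D ω)) ∧
    ∀ A : ℂ, {ω ∈ d | D ω A ≠ 0}.Finite ∧ Φ A = Ψ A + ∑ᶠ ω ∈ d, D ω A

/-- `f(ħ) ∼ e^{-A/ħ} ħ^{1/2} ψ(ħ)` as `ħ → 0` in the sector `s` (principal branch of `ħ^{1/2}`). -/
def HasSaddleExpansion (f : ℂ → ℂ) (A : ℂ) (ψ : PowerSeries ℂ) (s : Set ℂ) : Prop :=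
  ∀ N : ℕ, (fun h : ℂ => Complex.exp (A / h) * f h / h ^ (1 / 2 : ℂ) -
      ∑ m ∈ Finset.range N, PowerSeries.coeff m ψ * h ^ m)
    =O[nhdsWithin 0 s] fun h : ℂ => h ^ N

/-! ### The Airy model. The index `0 : Fin 2` stands for `-`, the index `1` for `+`. -/

/-- The Airy action `S(z) = z³/3 - z`. -/
def airyS (z : ℂ) : ℂ := z ^ 3 / 3 - z

/-- The critical points `(p_-, p_+) = (-1, 1)`. -/
def airyCrit : Fin 2 → ℂ := ![-1, 1]

/-- The tangent vectors that orient the thimbles at phase `θ`: at `p_-` downwards, at `p_+` to the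
left, rotated by `θ/2`; they correspond to the substitutions `z = -1 - i √ħ t` and
`z = 1 - √ħ t`. -/
def airyOrientation (θ : ℝ) : Fin 2 → ℂ :=
  ![-Complex.I * Complex.exp (θ / 2 * Complex.I), -Complex.exp (θ / 2 * Complex.I)]

/-- `c_m = (6m)! / (576^m (2m)! (3m)!)`. -/
def airyCoeff (m : ℕ) : ℂ :=
  ((6 * m).factorial : ℂ) / (576 ^ m * ((2 * m).factorial : ℂ) * ((3 * m).factorial : ℂ))

/-- The reduced saddle series `φ_+ = ∑ c_m ħ^m`. -/
def airyPhiPlus : PowerSeries ℂ := PowerSeries.mk airyCoeff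

/-- The reduced saddle series `φ_- = ∑ (-1)^m c_m ħ^m`. -/
def airyPhiMinus : PowerSeries ℂ := PowerSeries.mk fun m => (-1) ^ m * airyCoeff m

/-- The saddle series without `e^{-S(p)/ħ} ħ^{1/2}`: `(-i √π φ_-, -√π φ_+)`. -/
def airyPsi : Fin 2 → PowerSeries ℂ :=
  ![(-Complex.I * (Real.sqrt Real.pi : ℂ)) • airyPhiMinus,
    (-(Real.sqrt Real.pi : ℂ)) • airyPhiPlus]

/-- The full saddle series `I_∓ = e^{-S(p_∓)/ħ} ħ^{1/2} ψ_∓`, that is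
`I_- = -i √(πħ) e^{-2/(3ħ)} φ_-` and `I_+ = -√(πħ) e^{2/(3ħ)} φ_+`. -/
def airyI (j : Fin 2) : FormalObject := Finsupp.single (airyS (airyCrit j)) (airyPsi j)

/-- The closed cut `[4/3, ∞)`. -/
def airyCutPlus : Set ℂ := {ξ | ξ.im = 0 ∧ 4 / 3 ≤ ξ.re}

/-- The closed cut `(-∞, -4/3]`. -/
def airyCutMinus : Set ℂ := {ξ | ξ.im = 0 ∧ ξ.re ≤ -(4 / 3)}

/-- The matrix of the Stokes automorphism `𝔖^+`. -/
def airyStokesMatrix : Matrix (Fin 2) (Fin 2) ℤ := !![1, -1; 0, 1]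

/-- The matrix of the thimble jump. -/
def airyJumpMatrix : Matrix (Fin 2) (Fin 2) ℤ := !![1, 1; 0, 1]

end

open Complex Filter Topology Set

noncomputable section

/-! ### Power series with polynomially bounded coefficients -/

/-! Everything rests on the identity S(2 cos φ) = (2/3) cos 3φ. The cubic equation S(z) = v is
solved by trigonometry, so the thimbles, the saddle series and the Borel transforms all become
explicit in terms of the arcsine.

Borel side. One has c_m = m! (3/4)^m a_m with a_m the coefficients of ₂F₁(1/6, 5/6; 1; x), and
division by Γ(m + 1/2) in place of m! changes the lower parameter from 1 to 1/2. For the parameter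
1/2 the function is elementary: with x = w² it is cos((2/3) arcsin w) / cos(arcsin w)
(`hgHalf_asn_aux`). Near x = 1 the complementary angle splits it into a holomorphic term and a term
with a factor 1/√(1 - x), up to an elementary power (`halfRight_near_one`); a loop around 1 changes
the sign of the second term, which gives the alien operators for α = 1/2. The parameter 1 is
recovered by averaging over x sin² t (`oneCut`), which yields the continuation to the cut plane.
Since F(1 - x) solves the same hypergeometric equation, the Wronskian times x(1 - x) is constant;
its value -1/(2π) comes from Γ(1/6) Γ(5/6) = 2π and Abel's limit theorem (`wronskian_eq`).
Integrating the quotient of the two solutions gives the logarithm (`oneCut_log`), and its increment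
along the loop gives the alien operators for α = 1. The Stokes automorphism needs the vanishing at
every other point of the positive ray as well.

Thimbles. Along a trajectory e^{-iθ} S is real up to a constant and decreases, so a thimble is a
curve with S = S(p) + e^{iθ} t². The explicit branch `sheet` gives such a curve, and a connectedness
argument on the three roots of the cubic shows that it is the whole stable manifold
(`IsNormalCurve.range_eq`). Any other oriented parametrization is an increasing change of parameter,
so all integrals may be computed on the explicit curve. There the integrand is a Gaussian times a
derivative, only the even part of the derivative contributes, and that even part is again the
elementary function of the Borel side; its Taylor coefficients, integrated against the Gaussian,
give the saddle series (`exists_saddle_bound`).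

Jump. At infinity a thimble is 2 cosh((Y + iκ)/3) with Re Y → ∞ and κ one of 0, 2π, -2π, and there S
= (2/3) cosh Y. These are three sectors in which e^{-S/ħ} decays. Integrals and relative homology
classes depend only on the sectors of the two ends. The ends of the thimble through -1 do not change
with the sign of θ, while one end of the thimble through 1 moves from the sector 2π to the sector
-2π (`hasEnd_minus`, `hasEnd_plus`). The difference is exactly the thimble through -1. At θ = 0
conservation of Im S forces a connecting trajectory onto the real axis, where the equation is x' = 1
- x². -/

/-- The sequence `a` grows at most polynomially. -/
def PolyBounded (a : ℕ → ℂ) : Prop := ∃ (C : ℝ) (k : ℕ), ∀ n : ℕ, ‖a n‖ ≤ C * ((n : ℝ) + 1) ^ k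

/-- The sum of the power series with coefficients `a`. -/
def psum (a : ℕ → ℂ) (x : ℂ) : ℂ := ∑' n : ℕ, a n * x ^ n

/-- The coefficients of the derived power series. -/
def dcoef (a : ℕ → ℂ) (n : ℕ) : ℂ := (n + 1) * a (n + 1)

theorem summable_polyBound (C : ℝ) (k : ℕ) {r : ℝ} (hr0 : 0 ≤ r) (hr : r < 1) :
    Summable fun n : ℕ => C * ((n : ℝ) + 1) ^ k * r ^ n := by
  have h : Summable fun n : ℕ => (n : ℝ) ^ k * r ^ n :=
    summable_pow_mul_geometric_of_norm_lt_one k (by rwa [Real.norm_of_nonneg hr0])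
  -- The index shift below divides by r, so r = 0 is treated apart.
  rcases hr0.eq_or_lt with rfl | hr0
  · exact summable_of_ne_finset_zero (s := {0}) fun n hn => by
      have : n ≠ 0 := by simpa using hn
      simp [this]
  have h' := ((summable_nat_add_iff 1).2 h).mul_left (C * r⁻¹)
  refine h'.congr fun n => ?_
  push_cast
  field_simp
  ring

theorem PolyBounded.summable_norm {a : ℕ → ℂ} (ha : PolyBounded a) {x : ℂ} (hx : ‖x‖ < 1) :
    Summable fun n : ℕ => ‖a n * x ^ n‖ := by
  obtain ⟨C, k, h⟩ := ha
  refine Summable.of_nonneg_of_le (fun _ => norm_nonneg _) (fun n => ?_)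
    (summable_polyBound C k (norm_nonneg x) hx)
  rw [norm_mul, norm_pow]
  exact mul_le_mul_of_nonneg_right (h n) (by positivity)

theorem PolyBounded.hasSum {a : ℕ → ℂ} (ha : PolyBounded a) {x : ℂ} (hx : ‖x‖ < 1) :
    HasSum (fun n : ℕ => a n * x ^ n) (psum a x) :=
  (ha.summable_norm hx).of_norm.hasSum

theorem PolyBounded.mul_nat {a : ℕ → ℂ} (ha : PolyBounded a) :
    PolyBounded fun n => n * a n := by
  obtain ⟨C, k, h⟩ := ha
  refine ⟨C, k + 1, fun n => ?_⟩
  rw [norm_mul, Complex.norm_natCast, pow_succ, mul_comm, ← mul_assoc]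
  have := (norm_nonneg _).trans (h n)
  exact mul_le_mul (h n) (by linarith) (by positivity) this

theorem PolyBounded.dcoef {a : ℕ → ℂ} (ha : PolyBounded a) : PolyBounded (dcoef a) := by
  obtain ⟨C, k, h⟩ := ha.mul_nat
  refine ⟨C * 2 ^ k, k, fun n => ?_⟩
  have h1 := h (n + 1)
  have hC : 0 ≤ C := by simpa using (norm_nonneg _).trans (h 0)
  have : ((((n + 1 : ℕ) : ℝ)) + 1) ^ k ≤ 2 ^ k * ((n : ℝ) + 1) ^ k := by
    rw [← mul_pow]
    refine pow_le_pow_left₀ (by positivity) ?_ k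
    push_cast
    linarith [(Nat.cast_nonneg n : (0 : ℝ) ≤ n)]
  unfold _root_.dcoef
  push_cast at h1 this
  exact h1.trans ((mul_le_mul_of_nonneg_left this hC).trans_eq (by ring))

/-- Termwise differentiation on a disc of radius r with ‖x‖ < r < 1, where the derived series is
dominated by a convergent real series. -/
theorem psum_hasDerivAt {a : ℕ → ℂ} (ha : PolyBounded a) {x : ℂ} (hx : ‖x‖ < 1) :
    HasDerivAt (psum a) (psum (dcoef a) x) x := by
  obtain ⟨r, hxr, hr⟩ := exists_between hx
  have hr0 : 0 < r := (norm_nonneg x).trans_lt hxr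
  obtain ⟨C, k, h⟩ := ha.dcoef
  have hC : 0 ≤ C := by simpa using (norm_nonneg _).trans (h 0)
  have key : HasDerivAt (fun z => ∑' n : ℕ, a n * z ^ n)
      (∑' n : ℕ, a n * (n * x ^ (n - 1))) x := by
    refine hasDerivAt_tsum_of_isPreconnected
      -- The constant term has derivative 0; the term of index m + 1 is bounded through the
      -- coefficient `dcoef a m` and ‖y‖ ≤ r.
      (u := fun n : ℕ => Nat.casesOn n 0 fun m : ℕ => C * ((m : ℝ) + 1) ^ k * r ^ m)
      (t := Metric.ball (0 : ℂ) r) (y₀ := 0)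
      ?_ Metric.isOpen_ball
      (convex_ball _ _).isPreconnected (fun n y _ => (hasDerivAt_pow n y).const_mul (a n))
      ?_ (by simpa using hr0) ?_ (by simpa using hxr)
    · exact (summable_nat_add_iff 1).1 (summable_polyBound C k hr0.le hr)
    · rintro (_ | n) y hy
      · simp
      · have hy' : ‖y‖ ≤ r := by simpa using (mem_ball_zero_iff.1 hy).le
        have := h n
        simp only [Nat.cast_add, Nat.cast_one, Nat.add_sub_cancel]
        rw [← mul_assoc, norm_mul, norm_pow, mul_comm (a _)]
        exact mul_le_mul this (pow_le_pow_left₀ (norm_nonneg y) hy' n) (by positivity)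
          (by positivity)
    · exact (ha.summable_norm (x := 0) (by simp)).of_norm
  have hs : Summable fun n : ℕ => a n * (n * x ^ (n - 1)) := by
    refine (summable_nat_add_iff 1).1 ((ha.dcoef.hasSum hx).summable.congr fun n => ?_)
    simp [dcoef]; ring
  refine key.congr_deriv ?_
  rw [hs.tsum_eq_zero_add, psum]
  simp only [CharP.cast_eq_zero, zero_mul, mul_zero, zero_add, dcoef]
  exact tsum_congr fun n => by push_cast; ring

theorem mul_psum_dcoef {a : ℕ → ℂ} (ha : PolyBounded a) {x : ℂ} (hx : ‖x‖ < 1) :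
    x * psum (dcoef a) x = psum (fun n => n * a n) x := by
  rw [psum, ← tsum_mul_left]
  conv_rhs => rw [psum, (ha.mul_nat.hasSum hx).summable.tsum_eq_zero_add]
  simp only [CharP.cast_eq_zero, zero_mul, zero_add, dcoef]
  exact tsum_congr fun n => by push_cast; ring

theorem psum_zero_right (a : ℕ → ℂ) : psum a 0 = a 0 := by
  rw [psum, tsum_eq_single 0 fun n hn => by simp [hn]]
  simp

theorem psum_differentiableOn {a : ℕ → ℂ} (ha : PolyBounded a) :
    DifferentiableOn ℂ (psum a) (Metric.ball 0 1) := fun _ hx =>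
  (psum_hasDerivAt ha (mem_ball_zero_iff.1 hx)).differentiableAt.differentiableWithinAt

/-! ### The hypergeometric series `₂F₁(1/6, 5/6; c; x)` -/

/-- The coefficients of `₂F₁(1/6, 5/6; c; x)`. -/
def hgCoef (c : ℝ) : ℕ → ℝ
  | 0 => 1
  | n + 1 => hgCoef c n * ((n + 1 / 6) * (n + 5 / 6) / ((n + 1) * (n + c)))

theorem hgCoef_pos {c : ℝ} (hc : 1 / 2 ≤ c) (n : ℕ) : 0 < hgCoef c n := by
  induction n with
  | zero => simp [hgCoef]
  | succ n ih => rw [hgCoef]; have : 0 < (n : ℝ) + c := by positivity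
                 positivity

/-- Each ratio of consecutive coefficients is at most 1, because n² + n + 5/36 ≤ (n + 1)(n + 1/2).
This is what restricts c to c ≥ 1/2. -/
theorem hgCoef_le_one {c : ℝ} (hc : 1 / 2 ≤ c) (n : ℕ) : hgCoef c n ≤ 1 := by
  induction n with
  | zero => simp [hgCoef]
  | succ n ih =>
    rw [hgCoef]
    have h : 0 < (n : ℝ) + c := by positivity
    have h0 : (0 : ℝ) ≤ n := Nat.cast_nonneg n
    refine mul_le_one₀ ih (by positivity) ?_
    rw [div_le_one (by positivity)]
    nlinarith

/-- The hypergeometric coefficients as complex numbers. -/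
def hgC (c : ℝ) (n : ℕ) : ℂ := (hgCoef c n : ℂ)

theorem hgC_polyBounded {c : ℝ} (hc : 1 / 2 ≤ c) : PolyBounded (hgC c) :=
  ⟨1, 0, fun n => by
    rw [hgC, Complex.norm_real, Real.norm_of_nonneg (hgCoef_pos hc n).le]
    simpa using hgCoef_le_one hc n⟩

theorem hgC_succ {c : ℝ} (hc : 1 / 2 ≤ c) (n : ℕ) :
    ((n : ℂ) + 1) * (n + c) * hgC c (n + 1) = (n + 1 / 6) * (n + 5 / 6) * hgC c n := by
  have h : 0 < (n : ℝ) + c := by positivity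
  have : ((n : ℝ) + 1) * (n + c) * hgCoef c (n + 1) = (n + 1 / 6) * (n + 5 / 6) * hgCoef c n := by
    rw [hgCoef]; field_simp
  unfold hgC
  have h2 := congrArg (Complex.ofReal) this
  push_cast at h2
  exact h2

/-- The hypergeometric differential equation. -/
theorem hg_ode {c : ℝ} (hc : 1 / 2 ≤ c) {x : ℂ} (hx : ‖x‖ < 1) :
    x * (1 - x) * psum (dcoef (dcoef (hgC c))) x + (c - 2 * x) * psum (dcoef (hgC c)) x
      - 5 / 36 * psum (hgC c) x = 0 := by
  set a := hgC c with ha_def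
  have ha : PolyBounded a := hgC_polyBounded hc
  have e1 := mul_psum_dcoef ha hx
  have e2 := mul_psum_dcoef ha.dcoef hx
  -- The coefficients of x² F'' are n (n - 1) a_n. They are reached by applying `mul_psum_dcoef` to
  -- the sequence (n - 1) a_n, whose derived series is x F''.
  have hb : PolyBounded fun n => ((n : ℂ) - 1) * a n := by
    obtain ⟨C, k, h⟩ := ha.mul_nat
    obtain ⟨C', k', h'⟩ := ha
    refine ⟨|C| + |C'|, max k k', fun n => ?_⟩
    have hn : (1 : ℝ) ≤ (n : ℝ) + 1 := by linarith [(Nat.cast_nonneg n : (0 : ℝ) ≤ n)]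
    calc ‖((n : ℂ) - 1) * a n‖ = ‖n * a n - a n‖ := by rw [sub_mul, one_mul]
      _ ≤ ‖n * a n‖ + ‖a n‖ := norm_sub_le _ _
      _ ≤ C * ((n : ℝ) + 1) ^ k + C' * ((n : ℝ) + 1) ^ k' := add_le_add (h n) (h' n)
      _ ≤ |C| * ((n : ℝ) + 1) ^ (max k k') + |C'| * ((n : ℝ) + 1) ^ (max k k') := by
        gcongr
        · exact le_abs_self C
        · exact le_max_left _ _
        · exact le_abs_self C'
        · exact le_max_right _ _
      _ = _ := by ring
  have e3 := mul_psum_dcoef hb hx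
  have e4 : psum (dcoef fun n => ((n : ℂ) - 1) * a n) x = psum (fun n => n * dcoef a n) x := by
    congr 1; ext n; simp [dcoef]; ring
  rw [e4, ← e2] at e3
  have s1 := ha.hasSum hx
  have s2 := ha.dcoef.hasSum hx
  have s3 := ha.mul_nat.hasSum hx
  have s4 := ha.dcoef.mul_nat.hasSum hx
  have s5 := hb.mul_nat.hasSum hx
  have key := (((s4.sub s5).add (s2.mul_left (c : ℂ))).sub (s3.mul_left 2)).sub
    (s1.mul_left (5 / 36 : ℂ))
  have hz : ∀ n : ℕ, (n * dcoef a n * x ^ n - n * ((n - 1) * a n) * x ^ n + c * (dcoef a n * x ^ n)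
      - 2 * (n * a n * x ^ n) - 5 / 36 * (a n * x ^ n)) = 0 := fun n => by
    have := hgC_succ hc n
    rw [← ha_def] at this
    simp only [dcoef]
    linear_combination (x ^ n) * this
  have := (funext hz ▸ key : HasSum (fun _ : ℕ => (0 : ℂ)) _).unique hasSum_zero
  rw [← e1, ← e2, ← e3] at this
  linear_combination this

/-! ### The complex arcsine -/

/-- The principal square root. -/
def csq (z : ℂ) : ℂ := exp (log z / 2)

theorem csq_sq {z : ℂ} (hz : z ≠ 0) : csq z ^ 2 = z := by
  rw [csq, ← exp_nat_mul]
  convert exp_log hz using 2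
  push_cast; ring

theorem csq_ne_zero (z : ℂ) : csq z ≠ 0 := exp_ne_zero _

theorem csq_one : csq 1 = 1 := by simp [csq]

theorem csq_re_pos {z : ℂ} (hz : z ∈ slitPlane) : 0 < (csq z).re := by
  have h1 := mem_slitPlane_iff_arg.1 hz
  rw [csq, exp_re]
  refine mul_pos (Real.exp_pos _) (Real.cos_pos_of_mem_Ioo ⟨?_, ?_⟩)
  · have : (log z / 2).im = z.arg / 2 := by simp [log_im]
    rw [this]; linarith [neg_pi_lt_arg z]
  · have : (log z / 2).im = z.arg / 2 := by simp [log_im]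
    rw [this]
    have := lt_of_le_of_ne (arg_le_pi z) h1.1
    linarith

theorem csq_hasDerivAt {z : ℂ} (hz : z ∈ slitPlane) : HasDerivAt csq (1 / (2 * csq z)) z := by
  have h := ((hasDerivAt_log hz).div_const 2).cexp
  refine h.congr_deriv ?_
  have h0 := slitPlane_ne_zero hz
  have h2 := csq_sq h0
  have h3 := csq_ne_zero z
  change csq z * _ = _
  field_simp
  linear_combination h2

/-- The angle with sine `w` and cosine `r`. -/
def angle (w r : ℂ) : ℂ := -I * log (I * w + r)

theorem angle_mul {w r : ℂ} (h : r ^ 2 = 1 - w ^ 2) : (I * w + r) * (r - I * w) = 1 := by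
  linear_combination h - w ^ 2 * I_sq

theorem exp_I_angle {w r : ℂ} (h : r ^ 2 = 1 - w ^ 2) : exp (angle w r * I) = I * w + r := by
  have h0 : I * w + r ≠ 0 := left_ne_zero_of_mul_eq_one (angle_mul h)
  rw [angle, show -I * log (I * w + r) * I = log (I * w + r) by
    linear_combination -(log (I * w + r)) * I_sq, exp_log h0]

theorem exp_neg_I_angle {w r : ℂ} (h : r ^ 2 = 1 - w ^ 2) :
    exp (-angle w r * I) = r - I * w := by
  rw [neg_mul, exp_neg, exp_I_angle h]
  exact inv_eq_of_mul_eq_one_right (angle_mul h)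

theorem sin_angle {w r : ℂ} (h : r ^ 2 = 1 - w ^ 2) : sin (angle w r) = w := by
  rw [Complex.sin, exp_I_angle h, exp_neg_I_angle h]
  linear_combination -w * I_sq

/-- The sine f and the cosine g are left as independent functions because two choices occur: the
cosine as a root of 1 - w², and the sine as a root of x. The hypothesis on g g' is the derivative of
g² = 1 - f². -/
theorem angle_hasDerivAt {f g : ℂ → ℂ} {f' g' x : ℂ} (hf : HasDerivAt f f' x)
    (hg : HasDerivAt g g' x) (hg0 : g x ≠ 0)
    (h' : g x * g' = -(f x * f')) (hs : I * f x + g x ∈ slitPlane) :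
    HasDerivAt (fun y => angle (f y) (g y)) (f' / g x) x := by
  have h0 : I * f x + g x ≠ 0 := slitPlane_ne_zero hs
  refine ((((hf.const_mul I).add hg).clog hs).const_mul (-I)).congr_deriv ?_
  change -I * ((I * f' + g') / (I * f x + g x)) = f' / g x
  rw [← mul_div_assoc, div_eq_div_iff h0 hg0]
  linear_combination (-I) * h' - f' * (g x) * I_sq

/-- The plane cut along `(-∞, -1]` and `[1, ∞)`. -/
def asnDom : Set ℂ := {w | 1 - w ^ 2 ∈ slitPlane}

/-- The arcsine on the plane cut along `(-∞, -1]` and `[1, ∞)`. -/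
def asn (w : ℂ) : ℂ := angle w (csq (1 - w ^ 2))

theorem isOpen_asnDom : IsOpen asnDom :=
  isOpen_slitPlane.preimage (by fun_prop : Continuous fun w : ℂ => 1 - w ^ 2)

theorem ball_subset_asnDom : Metric.ball (0 : ℂ) 1 ⊆ asnDom := fun w hw => by
  have h : ‖w‖ < 1 := mem_ball_zero_iff.1 hw
  refine Or.inl ?_
  have h1 : (w ^ 2).re ≤ ‖w ^ 2‖ := re_le_norm _
  have h2 : ‖w ^ 2‖ < 1 := by rw [norm_pow]; nlinarith [norm_nonneg w]
  simp only [sub_re, one_re]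
  linarith

theorem csq_one_sub_sq {w : ℂ} (hw : w ∈ asnDom) : csq (1 - w ^ 2) ^ 2 = 1 - w ^ 2 :=
  csq_sq (slitPlane_ne_zero hw)

theorem sin_asn {w : ℂ} (hw : w ∈ asnDom) : sin (asn w) = w := sin_angle (csq_one_sub_sq hw)

/-- The numbers q = iw + r and r - iw are inverse to each other, so Re q + Re q⁻¹ = 2 Re r > 0, and
Re q⁻¹ has the sign of Re q. -/
theorem angle_re_pos {w r : ℂ} (h : r ^ 2 = 1 - w ^ 2) (hr : 0 < r.re) :
    0 < (I * w + r).re := by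
  set q := I * w + r with hq
  have hm := angle_mul h
  have h0 : q ≠ 0 := left_ne_zero_of_mul_eq_one hm
  have hinv : r - I * w = q⁻¹ := eq_inv_of_mul_eq_one_right hm
  have hsum : (q + q⁻¹).re = 2 * r.re := by rw [← hinv, hq]; simp; ring
  rw [add_re, inv_re] at hsum
  have hn : 0 < normSq q := normSq_pos.2 h0
  by_contra hcon
  have : q.re / normSq q ≤ 0 := div_nonpos_of_nonpos_of_nonneg (not_lt.1 hcon) hn.le
  linarith [not_lt.1 hcon]

theorem angle_re (w r : ℂ) : (angle w r).re = (I * w + r).arg := by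
  simp [angle, log_im]

theorem abs_angle_re_lt {w r : ℂ} (h : r ^ 2 = 1 - w ^ 2) (hr : 0 < r.re) :
    |(angle w r).re| < Real.pi / 2 := by
  rw [angle_re, abs_arg_lt_pi_div_two_iff]
  exact Or.inl (angle_re_pos h hr)

theorem abs_asn_re_lt {w : ℂ} (hw : w ∈ asnDom) : |(asn w).re| < Real.pi / 2 :=
  abs_angle_re_lt (csq_one_sub_sq hw) (csq_re_pos hw)

theorem angle_neg {w r : ℂ} (h : r ^ 2 = 1 - w ^ 2) (hr : 0 < r.re) :
    angle (-w) r = -angle w r := by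
  have hm := angle_mul h
  have hinv : I * (-w) + r = (I * w + r)⁻¹ :=
    eq_inv_of_mul_eq_one_right (by linear_combination hm)
  have hpos := angle_re_pos h hr
  rw [angle, angle, hinv, log_inv]
  · ring
  · intro harg
    have := abs_arg_lt_pi_div_two_iff.2 (Or.inl hpos : 0 < (I * w + r).re ∨ _)
    rw [harg, abs_of_pos Real.pi_pos] at this
    linarith [Real.pi_pos]

theorem asn_neg {w : ℂ} (hw : w ∈ asnDom) : asn (-w) = -asn w := by
  rw [asn, asn, neg_sq, angle_neg (csq_one_sub_sq hw) (csq_re_pos hw)]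

theorem asn_zero : asn 0 = 0 := by simp [asn, angle, csq_one]

theorem csq_one_sub_sq_hasDerivAt {w : ℂ} (hw : w ∈ asnDom) :
    HasDerivAt (fun w => csq (1 - w ^ 2)) (-w / csq (1 - w ^ 2)) w := by
  have h1 : HasDerivAt (fun w : ℂ => 1 - w ^ 2) (-(2 * w)) w := by
    simpa using (hasDerivAt_pow 2 w).const_sub 1
  refine ((csq_hasDerivAt hw).comp w h1).congr_deriv ?_
  have := csq_ne_zero (1 - w ^ 2)
  field_simp

theorem asn_hasDerivAt {w : ℂ} (hw : w ∈ asnDom) :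
    HasDerivAt asn (1 / csq (1 - w ^ 2)) w := by
  have h0 := csq_ne_zero (1 - w ^ 2)
  refine angle_hasDerivAt (hasDerivAt_id w) (csq_one_sub_sq_hasDerivAt hw) h0 ?_
    (Or.inl (angle_re_pos (csq_one_sub_sq hw) (csq_re_pos hw)))
  field_simp

/-! ### The hypergeometric series with lower parameter `1/2` is elementary -/

theorem half_le_half : (1 / 2 : ℝ) ≤ 1 / 2 := le_rfl

theorem half_le_one : (1 / 2 : ℝ) ≤ 1 := by norm_num

/-- The function `₂F₁(1/6, 5/6; 1/2; x)` on the unit disc. -/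
def hgHalf : ℂ → ℂ := psum (hgC (1 / 2))

/-- The derivative of `hgHalf`. -/
def hgHalf' : ℂ → ℂ := psum (dcoef (hgC (1 / 2)))

theorem hgHalf_hasDerivAt {x : ℂ} (hx : ‖x‖ < 1) : HasDerivAt hgHalf (hgHalf' x) x :=
  psum_hasDerivAt (hgC_polyBounded half_le_half) hx

/-- Put u = (2/3) arcsin w, r = √(1 - w²) and T = r F(w²). The hypergeometric equation with c = 1/2
says that T, as a function of u, satisfies T'' = -T; with T = 1 and T' = 0 at u = 0 this leaves T =
cos u. The second identity is the formula for the derivative. -/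
theorem hgHalf_asn_aux {w : ℂ} (hw : ‖w‖ < 1) :
    cos (2 / 3 * asn w) = csq (1 - w ^ 2) * hgHalf (w ^ 2) ∧
    sin (2 / 3 * asn w) =
      3 / 2 * w * (hgHalf (w ^ 2) - 2 * (1 - w ^ 2) * hgHalf' (w ^ 2)) := by
  set F := hgHalf with hF
  set F' := hgHalf' with hF'
  set F'' := psum (dcoef (dcoef (hgC (1 / 2)))) with hF''
  let T : ℂ → ℂ := fun w => csq (1 - w ^ 2) * F (w ^ 2)
  let N : ℂ → ℂ := fun w => -w * F (w ^ 2) + 2 * w * (1 - w ^ 2) * F' (w ^ 2)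
  -- With N = r dT/dw, the pair (T, 3N/2) is the solution and its derivative in u. A and B are this
  -- pair turned back by the angle u, hence constant.
  let A : ℂ → ℂ := fun w => T w * cos (2 / 3 * asn w) - 3 / 2 * N w * sin (2 / 3 * asn w)
  let B : ℂ → ℂ := fun w => T w * sin (2 / 3 * asn w) + 3 / 2 * N w * cos (2 / 3 * asn w)
  have hd : ∀ w ∈ Metric.ball (0 : ℂ) 1, HasDerivAt A 0 w ∧ HasDerivAt B 0 w := by
    intro w hw
    have hw1 : ‖w‖ < 1 := mem_ball_zero_iff.1 hw
    have hx : ‖w ^ 2‖ < 1 := by rw [norm_pow]; nlinarith [norm_nonneg w]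
    have hD := ball_subset_asnDom hw
    have hr := csq_one_sub_sq_hasDerivAt hD
    have hU := (asn_hasDerivAt hD).const_mul (2 / 3 : ℂ)
    have h2 : HasDerivAt (fun w : ℂ => w ^ 2) (2 * w) w := by simpa using hasDerivAt_pow 2 w
    have hFd : HasDerivAt (fun w => F (w ^ 2)) (F' (w ^ 2) * (2 * w)) w :=
      (hgHalf_hasDerivAt hx).comp w h2
    have hFd' : HasDerivAt (fun w => F' (w ^ 2)) (F'' (w ^ 2) * (2 * w)) w :=
      (psum_hasDerivAt (hgC_polyBounded half_le_half).dcoef hx).comp w h2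
    have hT := hr.mul hFd
    have hN := ((hasDerivAt_id w).neg.mul hFd).add
      ((((hasDerivAt_id w).const_mul (2 : ℂ)).mul (h2.const_sub 1)).mul hFd')
    have hode := hg_ode half_le_half hx
    have h0 := csq_ne_zero (1 - w ^ 2)
    have hsq := csq_one_sub_sq hD
    have hT' : HasDerivAt T (N w / csq (1 - w ^ 2)) w := by
      refine hT.congr_deriv ?_
      simp only [N]
      field_simp
      linear_combination (2 * w * F' (w ^ 2)) * hsq
    have hN' : HasDerivAt N (-(4 / 9) * F (w ^ 2)) w := by
      refine hN.congr_deriv ?_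
      simp only [id, Pi.mul_apply, Pi.neg_apply]
      push_cast at hode
      simp only [hF, hF', hF'', hgHalf, hgHalf']
      linear_combination 4 * hode
    refine ⟨((hT'.mul hU.ccos).sub ((hN'.const_mul (3 / 2 : ℂ)).mul hU.csin)).congr_deriv ?_,
      ((hT'.mul hU.csin).add ((hN'.const_mul (3 / 2 : ℂ)).mul hU.ccos)).congr_deriv ?_⟩
    · simp only [T]
      field_simp
      ring
    · simp only [T]
      field_simp
      ring
  have hconst : ∀ f : ℂ → ℂ, (∀ w ∈ Metric.ball (0 : ℂ) 1, HasDerivAt f 0 w) → f w = f 0 := by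
    intro f hf
    refine Metric.isOpen_ball.is_const_of_deriv_eq_zero (convex_ball (0 : ℂ) 1).isPreconnected
      (fun z hz => (hf z hz).differentiableAt.differentiableWithinAt)
      (fun z hz => (hf z hz).deriv) (mem_ball_zero_iff.2 hw) (Metric.mem_ball_self one_pos)
  have hF0 : F 0 = 1 := by simp [hF, hgHalf, psum_zero_right, hgC, hgCoef]
  have hA : A w = 1 := by
    rw [hconst A fun z hz => (hd z hz).1]
    simp [A, T, N, asn_zero, csq_one, hF0]
  have hB : B w = 0 := by
    rw [hconst B fun z hz => (hd z hz).2]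
    simp [B, T, N, asn_zero]
  have hcs := Complex.sin_sq_add_cos_sq (2 / 3 * asn w)
  simp only [A, T, N] at hA
  simp only [B, T, N] at hB
  constructor
  · linear_combination (-cos (2 / 3 * asn w)) * hA - (sin (2 / 3 * asn w)) * hB
      + (csq (1 - w ^ 2) * F (w ^ 2)) * hcs
  · linear_combination (-sin (2 / 3 * asn w)) * hA + cos (2 / 3 * asn w) * hB
      - (3 / 2 * (-w * F (w ^ 2) + 2 * w * (1 - w ^ 2) * F' (w ^ 2))) * hcs

/-! ### The coefficients `c_m` and the Borel transforms of the saddle series -/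

/-- Of the six new factors of (6m + 6)!, all but 6m + 1 and 6m + 5 cancel up to constants against
those of (2m + 2)! and (3m + 3)!, and (6m + 1)(6m + 5) = 36 (m + 1/6)(m + 5/6). -/
theorem airyCoeff_eq (m : ℕ) :
    airyCoeff m = (m.factorial : ℂ) * hgC 1 m * (3 / 4) ^ m := by
  induction m with
  | zero => simp [airyCoeff, hgC, hgCoef]
  | succ m ih =>
    have h := hgC_succ half_le_one m
    have hm : (m : ℂ) + 1 ≠ 0 := Nat.cast_add_one_ne_zero m
    have hs : hgC 1 (m + 1) = (m + 1 / 6) * (m + 5 / 6) * hgC 1 m / ((m + 1) * (m + 1)) := by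
      rw [eq_div_iff (by positivity), ← h]; push_cast; ring
    have hr : airyCoeff (m + 1) = airyCoeff m * ((m + 1 / 6) * (m + 5 / 6) / (m + 1) * (3 / 4)) := by
      have e6 : (6 * (m + 1)).factorial = (6 * m + 6) * (6 * m + 5) * (6 * m + 4) * (6 * m + 3) *
          (6 * m + 2) * (6 * m + 1) * (6 * m).factorial := by
        rw [show 6 * (m + 1) = 6 * m + 5 + 1 by ring]
        simp only [Nat.factorial_succ]; ring
      have e2 : (2 * (m + 1)).factorial = (2 * m + 2) * (2 * m + 1) * (2 * m).factorial := by
        rw [show 2 * (m + 1) = 2 * m + 1 + 1 by ring]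
        simp only [Nat.factorial_succ]; ring
      have e3 : (3 * (m + 1)).factorial =
          (3 * m + 3) * (3 * m + 2) * (3 * m + 1) * (3 * m).factorial := by
        rw [show 3 * (m + 1) = 3 * m + 2 + 1 by ring]
        simp only [Nat.factorial_succ]; ring
      have f2 : ((2 * m).factorial : ℂ) ≠ 0 := Nat.cast_ne_zero.2 (Nat.factorial_ne_zero _)
      have f3 : ((3 * m).factorial : ℂ) ≠ 0 := Nat.cast_ne_zero.2 (Nat.factorial_ne_zero _)
      have g1 : (2 * m + 1 : ℂ) ≠ 0 := by exact_mod_cast (by omega : 2 * m + 1 ≠ 0)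
      have g2 : (3 * m + 1 : ℂ) ≠ 0 := by exact_mod_cast (by omega : 3 * m + 1 ≠ 0)
      have g3 : (3 * m + 2 : ℂ) ≠ 0 := by exact_mod_cast (by omega : 3 * m + 2 ≠ 0)
      rw [airyCoeff, airyCoeff, e6, e2, e3]
      push_cast
      rw [show (2 * m + 2 : ℂ) = 2 * (m + 1) by ring, show (3 * m + 3 : ℂ) = 3 * (m + 1) by ring,
        show (6 * m + 6 : ℂ) = 6 * (m + 1) by ring, show (6 * m + 4 : ℂ) = 2 * (3 * m + 2) by ring,
        show (6 * m + 3 : ℂ) = 3 * (2 * m + 1) by ring,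
        show (6 * m + 2 : ℂ) = 2 * (3 * m + 1) by ring, pow_succ]
      -- The factors to be cancelled become atoms with known nonvanishing.
      generalize (2 * m + 1 : ℂ) = A at *
      generalize (3 * m + 1 : ℂ) = B at *
      generalize (3 * m + 2 : ℂ) = D at *
      field_simp
      ring
    rw [hr, ih, hs, Nat.factorial_succ, pow_succ]
    push_cast
    field_simp

/-- Since Γ(m + 1/2) = √π (1/2)_m, passing from m! to Γ(m + 1/2) in the Borel transform moves the
lower parameter from 1 to 1/2. -/
theorem hgCoef_half_mul_Gamma (m : ℕ) :
    hgCoef (1 / 2) m * Real.Gamma (m + 1 / 2) =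
      Real.sqrt Real.pi * (m.factorial * hgCoef 1 m) := by
  induction m with
  | zero => simp only [hgCoef, CharP.cast_eq_zero, zero_add, Real.Gamma_one_half_eq]; simp
  | succ m ih =>
    have h1 : (m : ℝ) + 1 / 2 ≠ 0 := by positivity
    have h2 : ((m + 1 : ℕ) : ℝ) + 1 / 2 = (m + 1 / 2) + 1 := by push_cast; ring
    rw [h2, Real.Gamma_add_one h1, hgCoef, hgCoef, Nat.factorial_succ]
    push_cast
    generalize Real.Gamma (m + 1 / 2) = g at *
    field_simp
    linear_combination ih

theorem sqrt_pi_ne_zero : (Real.sqrt Real.pi : ℂ) ≠ 0 := by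
  exact_mod_cast (Real.sqrt_pos.2 Real.pi_pos).ne'

theorem airyCoeff_div_factorial (m : ℕ) :
    airyCoeff m / (m.factorial : ℂ) = hgC 1 m * (3 / 4) ^ m := by
  have : (m.factorial : ℂ) ≠ 0 := Nat.cast_ne_zero.2 (Nat.factorial_ne_zero _)
  rw [airyCoeff_eq]
  field_simp

theorem airyCoeff_eq_half (m : ℕ) : (Real.sqrt Real.pi : ℂ) * airyCoeff m =
    hgC (1 / 2) m * (Real.Gamma (m + 1 / 2) : ℂ) * (3 / 4) ^ m := by
  have h := congrArg Complex.ofReal (hgCoef_half_mul_Gamma m)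
  push_cast at h
  rw [airyCoeff_eq]
  unfold hgC
  linear_combination (-(3 / 4 : ℂ) ^ m) * h

theorem airyCoeff_div_Gamma (m : ℕ) :
    airyCoeff m / (Real.Gamma (m + 1 / 2) : ℂ) =
      (Real.sqrt Real.pi : ℂ)⁻¹ * (hgC (1 / 2) m * (3 / 4) ^ m) := by
  have h1 : (Real.Gamma (m + 1 / 2) : ℂ) ≠ 0 := by
    exact_mod_cast (Real.Gamma_pos_of_pos (by positivity : (0 : ℝ) < m + 1 / 2)).ne'
  have h2 := sqrt_pi_ne_zero
  have h := airyCoeff_eq_half m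
  generalize (Real.Gamma (m + 1 / 2) : ℂ) = g at *
  field_simp
  linear_combination h

theorem coeff_airyPhiPlus (m : ℕ) : PowerSeries.coeff m airyPhiPlus = airyCoeff m := by
  simp [airyPhiPlus]

theorem coeff_airyPhiMinus (m : ℕ) :
    PowerSeries.coeff m airyPhiMinus = (-1) ^ m * airyCoeff m := by
  simp [airyPhiMinus]

/-- The sign `±1` of `φ_±`. -/
def phiSeries (e : ℂ) : PowerSeries ℂ := PowerSeries.mk fun m => e ^ m * airyCoeff m

theorem airyPhiPlus_eq : airyPhiPlus = phiSeries 1 := by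
  ext m; simp [airyPhiPlus, phiSeries]

theorem airyPhiMinus_eq : airyPhiMinus = phiSeries (-1) := rfl

theorem phiSeries_term_one (e ξ : ℂ) (m : ℕ) :
    PowerSeries.coeff m (phiSeries e) * ξ ^ m / (Real.Gamma (m + 1) : ℂ) =
      hgC 1 m * (e * (3 * ξ / 4)) ^ m := by
  have h := airyCoeff_div_factorial m
  rw [Real.Gamma_nat_eq_factorial, phiSeries, PowerSeries.coeff_mk, ofReal_natCast]
  rw [show e ^ m * airyCoeff m * ξ ^ m / (m.factorial : ℂ) =
    (airyCoeff m / (m.factorial : ℂ)) * (e ^ m * ξ ^ m) by ring, h]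
  rw [show e * (3 * ξ / 4) = (3 / 4) * (e * ξ) by ring, mul_pow, mul_pow]
  ring

theorem phiSeries_term_half (e ξ : ℂ) (m : ℕ) :
    PowerSeries.coeff m (phiSeries e) * ξ ^ m / (Real.Gamma (m + (1 / 2 : ℝ)) : ℂ) =
      (Real.sqrt Real.pi : ℂ)⁻¹ * (hgC (1 / 2) m * (e * (3 * ξ / 4)) ^ m) := by
  have h := airyCoeff_div_Gamma m
  rw [phiSeries, PowerSeries.coeff_mk]
  rw [show e ^ m * airyCoeff m * ξ ^ m / (Real.Gamma (m + (1 / 2 : ℝ)) : ℂ) =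
    (airyCoeff m / (Real.Gamma (m + (1 / 2 : ℝ)) : ℂ)) * (e ^ m * ξ ^ m) by ring, h]
  rw [show e * (3 * ξ / 4) = (3 / 4) * (e * ξ) by ring, mul_pow, mul_pow]
  ring

/-- The function `₂F₁(1/6, 5/6; 1; x)` on the unit disc. -/
def hgOne : ℂ → ℂ := psum (hgC 1)

theorem borelSum_one_phiSeries (e ξ : ℂ) :
    borelSum 1 (phiSeries e) ξ = hgOne (e * (3 * ξ / 4)) :=
  tsum_congr fun m => phiSeries_term_one e ξ m

theorem borelSum_half_phiSeries (e ξ : ℂ) :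
    borelSum (1 / 2) (phiSeries e) ξ = (Real.sqrt Real.pi : ℂ)⁻¹ * hgHalf (e * (3 * ξ / 4)) := by
  rw [hgHalf, psum, ← tsum_mul_left]
  exact tsum_congr fun m => phiSeries_term_half e ξ m

theorem norm_phi_arg_lt {e ξ : ℂ} (he : ‖e‖ = 1) (hξ : ‖ξ‖ < 4 / 3) : ‖e * (3 * ξ / 4)‖ < 1 := by
  rw [norm_mul, he, one_mul, norm_div, norm_mul]
  simp only [Complex.norm_ofNat]
  linarith

theorem borelConvergent_one_phiSeries {e : ℂ} (he : ‖e‖ = 1) :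
    BorelConvergent 1 (phiSeries e) :=
  ⟨4 / 3, by norm_num, fun ξ hξ =>
    ((hgC_polyBounded half_le_one).hasSum (norm_phi_arg_lt he hξ)).summable.congr fun m =>
      (phiSeries_term_one e ξ m).symm⟩

theorem borelConvergent_half_phiSeries {e : ℂ} (he : ‖e‖ = 1) :
    BorelConvergent (1 / 2) (phiSeries e) :=
  ⟨4 / 3, by norm_num, fun ξ hξ =>
    (((hgC_polyBounded half_le_half).hasSum (norm_phi_arg_lt he hξ)).summable.mul_left
      (Real.sqrt Real.pi : ℂ)⁻¹).congr fun m => (phiSeries_term_half e ξ m).symm⟩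

theorem ordinaryHypergeometric_eq_hgOne (x : ℂ) :
    ordinaryHypergeometric (1 / 6 : ℂ) (5 / 6 : ℂ) (1 : ℂ) x = hgOne x := by
  rw [ordinaryHypergeometric_eq_tsum, hgOne, psum]
  refine tsum_congr fun n => ?_
  rw [smul_eq_mul]
  congr 1
  have hpoch (s : ℂ) (n : ℕ) : (ascPochhammer ℂ (n + 1)).eval s =
      (ascPochhammer ℂ n).eval s * (s + n) := by
    rw [ascPochhammer_succ_right]; simp
  induction n with
  | zero => simp [hgC, hgCoef]
  | succ n ih =>
    have h := hgC_succ half_le_one n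
    have hn : (n : ℂ) + 1 ≠ 0 := Nat.cast_add_one_ne_zero n
    have hs : hgC 1 (n + 1) = (n + 1 / 6) * (n + 5 / 6) * hgC 1 n / ((n + 1) * (n + 1)) := by
      rw [eq_div_iff (by positivity), ← h]; push_cast; ring
    rw [hs, ← ih, hpoch, hpoch, hpoch, Nat.factorial_succ]
    push_cast
    have h1 : (1 : ℂ) + n ≠ 0 := by rwa [add_comm]
    rw [mul_inv, mul_inv, add_comm (1 : ℂ) n, add_comm (1 / 6 : ℂ) n, add_comm (5 / 6 : ℂ) n,
      div_eq_mul_inv _ (((n : ℂ) + 1) * (n + 1)), mul_inv]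
    ring

theorem airyBorel_hasSum (ξ : ℂ) (hξ : ‖ξ‖ < 4 / 3) :
    HasSum (fun m : ℕ => PowerSeries.coeff m airyPhiPlus * ξ ^ m / (m.factorial : ℂ))
        (ordinaryHypergeometric (1 / 6 : ℂ) (5 / 6 : ℂ) (1 : ℂ) (3 * ξ / 4)) ∧
      HasSum (fun m : ℕ => PowerSeries.coeff m airyPhiMinus * ξ ^ m / (m.factorial : ℂ))
        (ordinaryHypergeometric (1 / 6 : ℂ) (5 / 6 : ℂ) (1 : ℂ) (-(3 * ξ / 4))) := by
  have key (e : ℂ) (he : ‖e‖ = 1) :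
      HasSum (fun m : ℕ => PowerSeries.coeff m (phiSeries e) * ξ ^ m / (m.factorial : ℂ))
        (hgOne (e * (3 * ξ / 4))) := by
    have h := (hgC_polyBounded half_le_one).hasSum (norm_phi_arg_lt he hξ)
    have hf : (fun m : ℕ => PowerSeries.coeff m (phiSeries e) * ξ ^ m / (m.factorial : ℂ)) =
        fun m => hgC 1 m * (e * (3 * ξ / 4)) ^ m := funext fun m => by
      rw [← phiSeries_term_one, Real.Gamma_nat_eq_factorial, ofReal_natCast]
    rw [hf]
    exact h
  rw [airyPhiPlus_eq, airyPhiMinus_eq, ordinaryHypergeometric_eq_hgOne,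
    ordinaryHypergeometric_eq_hgOne]
  constructor
  · simpa using key 1 (by simp)
  · simpa using key (-1) (by simp)

/-! ### Continuation of the hypergeometric functions to the cut plane -/

/-- The plane cut along `[1, ∞)`. -/
def cutDom : Set ℂ := {x | 1 - x ∈ slitPlane}

theorem isOpen_cutDom : IsOpen cutDom :=
  isOpen_slitPlane.preimage (by fun_prop : Continuous fun x : ℂ => 1 - x)

theorem mem_cutDom {x : ℂ} : x ∈ cutDom ↔ x.re < 1 ∨ x.im ≠ 0 := by
  simp [cutDom, mem_slitPlane_iff]

/-- The cut plane is star-shaped about 0; this keeps the points x sin² t of the averaging integral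
inside it. -/
theorem real_mul_mem_cutDom {x : ℂ} (hx : x ∈ cutDom) {t : ℝ} (h0 : 0 ≤ t) (h1 : t ≤ 1) :
    x * t ∈ cutDom := by
  rw [mem_cutDom] at hx ⊢
  simp only [re_mul_ofReal, im_mul_ofReal]
  rcases h0.eq_or_lt with rfl | h0
  · simp
  rcases hx with hx | hx
  · left
    by_cases h : x.re ≤ 0
    · nlinarith
    · nlinarith
  · right; exact mul_ne_zero hx h0.ne'

/-- The even function `cos (2/3 arcsin w) / cos (arcsin w)`. -/
def evenPart (w : ℂ) : ℂ := cos (2 / 3 * asn w) / csq (1 - w ^ 2)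

theorem evenPart_neg {w : ℂ} (hw : w ∈ asnDom) : evenPart (-w) = evenPart w := by
  rw [evenPart, evenPart, asn_neg hw, neg_sq, mul_neg, Complex.cos_neg]

theorem evenPart_differentiableAt {w : ℂ} (hw : w ∈ asnDom) : DifferentiableAt ℂ evenPart w :=
  (((asn_hasDerivAt hw).const_mul (2 / 3 : ℂ)).ccos.div (csq_one_sub_sq_hasDerivAt hw)
    (csq_ne_zero _)).differentiableAt

theorem evenPart_eq {w : ℂ} (hw : ‖w‖ < 1) : evenPart w = hgHalf (w ^ 2) := by
  rw [evenPart, (hgHalf_asn_aux hw).1, mul_div_cancel_left₀ _ (csq_ne_zero _)]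

/-- The continuation of `₂F₁(1/6, 5/6; 1/2; x)` to the plane cut along `[1, ∞)`. -/
def halfCut (x : ℂ) : ℂ := if x = 0 then 1 else evenPart (csq x)

theorem evenPart_zero : evenPart 0 = 1 := by
  simp [evenPart, asn_zero, csq_one]

theorem halfCut_sq {w : ℂ} (hw : w ∈ asnDom) : halfCut (w ^ 2) = evenPart w := by
  -- `csq 0` is 1 and not 0, so the origin is an exceptional case in the definition of `halfCut`.
  by_cases h : w = 0
  · simp [h, halfCut, evenPart_zero]
  have h2 : w ^ 2 ≠ 0 := pow_ne_zero 2 h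
  rw [halfCut, if_neg h2]
  rcases sq_eq_sq_iff_eq_or_eq_neg.1 (csq_sq h2) with h3 | h3
  · rw [h3]
  · rw [h3, evenPart_neg hw]

theorem halfCut_eq_hgHalf {x : ℂ} (hx : ‖x‖ < 1) : halfCut x = hgHalf x := by
  by_cases h : x = 0
  · simp [h, halfCut, hgHalf, psum_zero_right, hgC, hgCoef]
  have h2 := csq_sq h
  have hn : ‖csq x‖ < 1 := by
    have : ‖csq x‖ ^ 2 < 1 := by rwa [← norm_pow, h2]
    nlinarith [norm_nonneg (csq x)]
  rw [halfCut, if_neg h, evenPart_eq hn, h2]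

/-- As `evenPart` is even, any local holomorphic square root computes the function. The root `csq`
serves off the negative axis and i `csq (-y)` on it; near 0, where no root exists, the power series
takes over. -/
theorem halfCut_differentiableOn : DifferentiableOn ℂ halfCut cutDom := by
  intro x hx
  refine DifferentiableAt.differentiableWithinAt ?_
  have key (f : ℂ → ℂ) (hf : DifferentiableAt ℂ f x) (hsq : ∀ᶠ y in 𝓝 x, f y ^ 2 = y) :
      DifferentiableAt ℂ halfCut x := by
    have hw : f x ∈ asnDom := by
      change 1 - f x ^ 2 ∈ slitPlane
      rw [hsq.self_of_nhds]; exact hx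
    have h2 : ∀ᶠ y in 𝓝 x, halfCut y = evenPart (f y) := by
      filter_upwards [hsq, hf.continuousAt.eventually (isOpen_asnDom.mem_nhds hw)] with y h1 h2
      conv_lhs => rw [← h1]
      exact halfCut_sq h2
    exact ((evenPart_differentiableAt hw).comp x hf).congr_of_eventuallyEq h2
  by_cases h : ‖x‖ < 1
  · refine (hgHalf_hasDerivAt h).differentiableAt.congr_of_eventuallyEq ?_
    filter_upwards [Metric.isOpen_ball.mem_nhds (mem_ball_zero_iff.2 h)] with y hy
    exact halfCut_eq_hgHalf (mem_ball_zero_iff.1 hy)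
  have h0 : x ≠ 0 := by rintro rfl; simp at h
  rcases mem_slitPlane_or_neg_mem_slitPlane h0 with hs | hs
  · refine key csq (csq_hasDerivAt hs).differentiableAt ?_
    filter_upwards [isOpen_slitPlane.mem_nhds hs] with y hy using csq_sq (slitPlane_ne_zero hy)
  · refine key (fun y => I * csq (-y)) ?_ ?_
    · have h1 : DifferentiableAt ℂ csq (-x) := (csq_hasDerivAt hs).differentiableAt
      exact (h1.comp x differentiableAt_id.neg).const_mul I
    · filter_upwards [continuousAt_neg.eventually (isOpen_slitPlane.mem_nhds hs)] with y hy
      rw [mul_pow, csq_sq (slitPlane_ne_zero hy), I_sq]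
      ring

/-- The continuation of `₂F₁(1/6, 5/6; 1; x)` to the plane cut along `[1, ∞)`. -/
def oneCut (x : ℂ) : ℂ :=
  (Real.pi : ℂ)⁻¹ * ∫ t in (0 : ℝ)..Real.pi, halfCut (x * ((Real.sin t ^ 2 : ℝ) : ℂ))

theorem sin_sq_mem (t : ℝ) : 0 ≤ Real.sin t ^ 2 ∧ Real.sin t ^ 2 ≤ 1 :=
  ⟨sq_nonneg _, Real.sin_sq_le_one t⟩

theorem continuous_halfCut_sin {f : ℂ → ℂ} (hf : ContinuousOn f cutDom) {x : ℂ}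
    (hx : x ∈ cutDom) : Continuous fun t : ℝ => f (x * ((Real.sin t ^ 2 : ℝ) : ℂ)) :=
  hf.comp_continuous (by fun_prop) fun t =>
    real_mul_mem_cutDom hx (sin_sq_mem t).1 (sin_sq_mem t).2

theorem oneCut_differentiableOn : DifferentiableOn ℂ oneCut cutDom := by
  intro x hx
  refine DifferentiableAt.differentiableWithinAt (DifferentiableAt.const_mul ?_ _)
  have hK := halfCut_differentiableOn
  have hK' : ContinuousOn (deriv halfCut) cutDom := (hK.deriv isOpen_cutDom).continuousOn
  obtain ⟨r, hr, hball⟩ := Metric.nhds_basis_closedBall.mem_iff.1 (isOpen_cutDom.mem_nhds hx)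
  -- All products y s with y in the closed ball and 0 ≤ s ≤ 1 form a compact subset of the cut
  -- plane, so one constant bounds the derivative of the integrand for all parameters.
  have hcomp : IsCompact ((fun p : ℂ × ℝ => p.1 * (p.2 : ℂ)) '' (Metric.closedBall x r ×ˢ Icc 0 1)) :=
    ((isCompact_closedBall x r).prod isCompact_Icc).image (by fun_prop)
  have hsub : ((fun p : ℂ × ℝ => p.1 * (p.2 : ℂ)) '' (Metric.closedBall x r ×ˢ Icc 0 1)) ⊆
      cutDom := by
    rintro _ ⟨p, hp, rfl⟩
    exact real_mul_mem_cutDom (hball hp.1) hp.2.1 hp.2.2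
  obtain ⟨C, hC⟩ := hcomp.exists_bound_of_continuousOn (hK'.mono hsub)
  have hmem : ∀ y ∈ Metric.closedBall x r, ∀ t : ℝ, ‖deriv halfCut (y * ((Real.sin t ^ 2 : ℝ) : ℂ))‖ ≤ C :=
    fun y hy t => hC _ ⟨(y, Real.sin t ^ 2), ⟨hy, (sin_sq_mem t).1, (sin_sq_mem t).2⟩, rfl⟩
  have hC0 : 0 ≤ C := (norm_nonneg _).trans (hmem x (Metric.mem_closedBall_self hr.le) 0)
  refine (intervalIntegral.hasDerivAt_integral_of_dominated_loc_of_deriv_le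
    (F' := fun y t => deriv halfCut (y * ((Real.sin t ^ 2 : ℝ) : ℂ)) * ((Real.sin t ^ 2 : ℝ) : ℂ))
    (bound := fun _ => C) (Metric.closedBall_mem_nhds x hr) ?_ ?_ ?_ ?_ ?_ ?_).2.differentiableAt
  · filter_upwards [isOpen_cutDom.mem_nhds hx] with y hy
    exact (continuous_halfCut_sin hK.continuousOn hy).aestronglyMeasurable
  · exact (continuous_halfCut_sin hK.continuousOn hx).intervalIntegrable _ _
  · exact ((continuous_halfCut_sin hK' hx).mul (by fun_prop)).aestronglyMeasurable
  · refine Eventually.of_forall fun t _ y hy => ?_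
    rw [norm_mul, Complex.norm_real, Real.norm_of_nonneg (sin_sq_mem t).1]
    exact (mul_le_of_le_one_right (norm_nonneg _) (sin_sq_mem t).2).trans (hmem y hy t)
  · exact intervalIntegrable_const
  · refine Eventually.of_forall fun t _ y hy => ?_
    have hmem := real_mul_mem_cutDom (hball hy) (sin_sq_mem t).1 (sin_sq_mem t).2
    have h1 := (hK.differentiableAt (isOpen_cutDom.mem_nhds hmem)).hasDerivAt
    exact h1.comp y (by simpa using (hasDerivAt_id y).mul_const ((Real.sin t ^ 2 : ℝ) : ℂ))

/-- By Wallis, the mean of sin^{2n} over [0, π] is (1/2)_n / n!. Averaging therefore turns the lower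
parameter 1/2 into 1, term by term. -/
theorem hgCoef_half_mul_integral (n : ℕ) :
    hgCoef (1 / 2) n * ∫ t in (0 : ℝ)..Real.pi, Real.sin t ^ (2 * n) = Real.pi * hgCoef 1 n := by
  rw [integral_sin_pow_even]
  induction n with
  | zero => simp [hgCoef]
  | succ n ih =>
    rw [Finset.prod_range_succ, hgCoef, hgCoef]
    have h : 0 < (n : ℝ) + 1 / 2 := by positivity
    generalize (∏ i ∈ Finset.range n, (2 * (i : ℝ) + 1) / (2 * i + 2)) = p at *
    rw [show 2 * (n : ℝ) + 1 = 2 * (n + 1 / 2) by ring, show 2 * (n : ℝ) + 2 = 2 * (n + 1) by ring]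
    generalize (n : ℝ) + 1 / 2 = g at *
    have ih' : hgCoef (1 / 2) n * p = hgCoef 1 n :=
      mul_left_cancel₀ Real.pi_ne_zero (by linear_combination ih)
    field_simp
    linear_combination ih'

theorem oneCut_eq_hgOne {x : ℂ} (hx : ‖x‖ < 1) : oneCut x = hgOne x := by
  have hpi : (Real.pi : ℂ) ≠ 0 := ofReal_ne_zero.2 Real.pi_ne_zero
  have h : HasSum (fun n : ℕ => ∫ t in (0 : ℝ)..Real.pi,
      hgC (1 / 2) n * (x * ((Real.sin t ^ 2 : ℝ) : ℂ)) ^ n)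
      (∫ t in (0 : ℝ)..Real.pi, halfCut (x * ((Real.sin t ^ 2 : ℝ) : ℂ))) := by
    refine intervalIntegral.hasSum_integral_of_dominated_convergence (fun n _ => ‖x‖ ^ n)
      (fun n => Continuous.aestronglyMeasurable (by fun_prop)) ?_ ?_ ?_ ?_
    · refine fun n => Eventually.of_forall fun t _ => ?_
      rw [norm_mul, norm_pow, norm_mul, Complex.norm_real, Real.norm_of_nonneg (sin_sq_mem t).1,
        hgC, Complex.norm_real, Real.norm_of_nonneg (hgCoef_pos half_le_half n).le]
      exact (mul_le_of_le_one_left (by positivity) (hgCoef_le_one half_le_half n)).trans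
        (pow_le_pow_left₀ (by positivity)
          (mul_le_of_le_one_right (norm_nonneg _) (sin_sq_mem t).2) n)
    · exact Eventually.of_forall fun t _ => summable_geometric_of_lt_one (norm_nonneg _) hx
    · exact intervalIntegrable_const
    · refine Eventually.of_forall fun t _ => ?_
      have hn : ‖x * ((Real.sin t ^ 2 : ℝ) : ℂ)‖ < 1 := by
        rw [norm_mul, Complex.norm_real, Real.norm_of_nonneg (sin_sq_mem t).1]
        exact (mul_le_of_le_one_right (norm_nonneg _) (sin_sq_mem t).2).trans_lt hx
      rw [halfCut_eq_hgHalf hn]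
      exact (hgC_polyBounded half_le_half).hasSum hn
  have h2 := (h.mul_left (Real.pi : ℂ)⁻¹).tsum_eq
  rw [oneCut, ← h2, hgOne, psum]
  refine tsum_congr fun n => ?_
  have h3 : ∀ t : ℝ, hgC (1 / 2) n * (x * ((Real.sin t ^ 2 : ℝ) : ℂ)) ^ n =
      (hgC (1 / 2) n * x ^ n) * ((Real.sin t ^ (2 * n) : ℝ) : ℂ) := fun t => by
    rw [mul_pow, pow_mul]; push_cast; ring
  simp_rw [h3]
  rw [intervalIntegral.integral_const_mul, intervalIntegral.integral_ofReal]
  have h4 := congrArg Complex.ofReal (hgCoef_half_mul_integral n)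
  rw [ofReal_mul, ofReal_mul] at h4
  unfold hgC
  field_simp
  linear_combination (x ^ n) * h4

/-! ### The logarithmic singularity at `1` -/

theorem hgCoef_one_add_one (n : ℕ) : ((n : ℝ) + 1) ^ 2 * hgCoef 1 (n + 1) =
    (n + 1 / 6) * (n + 5 / 6) * hgCoef 1 n := by
  rw [hgCoef]; field_simp

/-- The products in the coefficient are those of Euler's sequences for Γ(1/6) and Γ(5/6), and the
reflection formula gives Γ(1/6) Γ(5/6) = π / sin(π/6) = 2π. -/
theorem hgCoef_one_limit :
    Tendsto (fun n : ℕ => ((n : ℝ) + 1) * hgCoef 1 (n + 1)) atTop (𝓝 (1 / (2 * Real.pi))) := by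
  have hprod (n : ℕ) : (∏ j ∈ Finset.range (n + 1), ((1 / 6 : ℝ) + j)) *
      (∏ j ∈ Finset.range (n + 1), ((5 / 6 : ℝ) + j)) =
        ((n + 1 : ℕ).factorial : ℝ) ^ 2 * hgCoef 1 (n + 1) := by
    rw [← Finset.prod_mul_distrib]
    induction n with
    | zero => simp [hgCoef]
    | succ n ih =>
      rw [Finset.prod_range_succ, ih, Nat.factorial_succ (n + 1)]
      have := hgCoef_one_add_one (n + 1)
      push_cast at this ⊢
      linear_combination (-((n + 1).factorial : ℝ) ^ 2) * this
  have h := (Real.GammaSeq_tendsto_Gamma (1 / 6)).mul (Real.GammaSeq_tendsto_Gamma (5 / 6))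
  have hG : Real.Gamma (1 / 6) * Real.Gamma (5 / 6) = 2 * Real.pi := by
    have := Real.Gamma_mul_Gamma_one_sub (1 / 6)
    rw [show (1 : ℝ) - 1 / 6 = 5 / 6 by norm_num,
      show Real.pi * (1 / 6) = Real.pi / 6 by ring, Real.sin_pi_div_six] at this
    rw [this]; ring
  rw [hG] at h
  have h2 := (h.inv₀ (by positivity)).mul (tendsto_natCast_div_add_atTop (1 : ℝ))
  have hlim : (2 * Real.pi)⁻¹ * 1 = 1 / (2 * Real.pi) := by ring
  rw [hlim] at h2
  refine h2.congr' ?_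
  filter_upwards [eventually_gt_atTop 0] with n hn
  have hn' : (0 : ℝ) < n := Nat.cast_pos.2 hn
  have e : Real.GammaSeq (1 / 6) n * Real.GammaSeq (5 / 6) n =
      n * (n.factorial : ℝ) ^ 2 / (((n + 1 : ℕ).factorial : ℝ) ^ 2 * hgCoef 1 (n + 1)) := by
    rw [Real.GammaSeq, Real.GammaSeq, div_mul_div_comm, hprod]
    congr 1
    have : (n : ℝ) ^ (1 / 6 : ℝ) * (n : ℝ) ^ (5 / 6 : ℝ) = n := by
      rw [← Real.rpow_add hn']; norm_num
    linear_combination ((n.factorial : ℝ) ^ 2) * this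
  have hpos := hgCoef_pos half_le_one (n + 1)
  have hf : (n.factorial : ℝ) ≠ 0 := Nat.cast_ne_zero.2 (Nat.factorial_ne_zero _)
  rw [e, Nat.factorial_succ]
  push_cast
  field_simp

/-- Multiplication by 1 - x replaces the coefficients by their successive differences, whose partial
sums are the c_n themselves; Abel's limit theorem then applies. -/
theorem tendsto_one_sub_mul_psum {c : ℕ → ℂ} (hc : PolyBounded c) {l : ℂ}
    (hl : Tendsto c atTop (𝓝 l)) :
    Tendsto (fun x : ℝ => (1 - (x : ℂ)) * psum c x) (𝓝[<] 1) (𝓝 l) := by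
  let d : ℕ → ℂ := fun n => Nat.casesOn n (c 0) fun m => c (m + 1) - c m
  have hsum (n : ℕ) : ∑ i ∈ Finset.range (n + 1), d i = c n := by
    induction n with
    | zero => simp [d]
    | succ n ih => rw [Finset.sum_range_succ, ih]; simp [d]
  have h1 : Tendsto (fun n => ∑ i ∈ Finset.range n, d i) atTop (𝓝 l) := by
    rw [← tendsto_add_atTop_iff_nat 1]
    simpa only [hsum] using hl
  have h2 := Complex.tendsto_tsum_powerSeries_nhdsWithin_lt h1
  rw [tendsto_map'_iff] at h2
  refine h2.congr' ?_
  have hmem : ∀ᶠ x : ℝ in 𝓝[<] 1, 0 < x :=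
    nhdsWithin_le_nhds (eventually_gt_nhds one_pos)
  filter_upwards [hmem, self_mem_nhdsWithin] with x h0 h1
  have hx : ‖(x : ℂ)‖ < 1 := by rwa [Complex.norm_real, Real.norm_of_nonneg h0.le]
  have s1 := hc.hasSum hx
  have s2 := s1.mul_left (x : ℂ)
  -- The terms of x ∑ c_n xⁿ, moved up by one index.
  let e : ℕ → ℂ := fun m => Nat.casesOn m 0 fun k => c k * (x : ℂ) ^ (k + 1)
  have s3 : HasSum (fun n : ℕ => e (n + 1)) ((x : ℂ) * psum c x) := by
    have he : (fun n : ℕ => e (n + 1)) = fun n => (x : ℂ) * (c n * (x : ℂ) ^ n) :=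
      funext fun n => by simp only [e, pow_succ]; ring
    rw [he]; exact s2
  have s4 := (hasSum_nat_add_iff 1).1 s3
  have s5 := s1.sub s4
  have hfun : (fun n : ℕ => d n * (x : ℂ) ^ n) = fun n => c n * (x : ℂ) ^ n - e n := by
    funext n
    rcases n with _ | n
    · simp [d, e]
    · simp only [d, e]; ring
  simp only [Function.comp]
  rw [hfun, s5.tsum_eq]
  simp [e]
  ring

/-! ### The Wronskian of the solutions based at 0 and at 1 -/

/-- The derivative of `hgOne`. -/
def hgOne' : ℂ → ℂ := psum (dcoef (hgC 1))

theorem hgOne_hasDerivAt {x : ℂ} (hx : ‖x‖ < 1) : HasDerivAt hgOne (hgOne' x) x :=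
  psum_hasDerivAt (hgC_polyBounded half_le_one) hx

theorem hgOne'_hasDerivAt {x : ℂ} (hx : ‖x‖ < 1) :
    HasDerivAt hgOne' (psum (dcoef (dcoef (hgC 1))) x) x :=
  psum_hasDerivAt (hgC_polyBounded half_le_one).dcoef hx

theorem hgOne_zero : hgOne 0 = 1 := by simp [hgOne, psum_zero_right, hgC, hgCoef]

theorem tendsto_one_sub_mul_hgOne' :
    Tendsto (fun x : ℝ => (1 - (x : ℂ)) * hgOne' x) (𝓝[<] 1) (𝓝 (1 / (2 * Real.pi))) := by
  refine tendsto_one_sub_mul_psum (hgC_polyBounded half_le_one).dcoef ?_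
  have h := (continuous_ofReal.tendsto _).comp hgCoef_one_limit
  push_cast at h
  refine h.congr fun n => ?_
  simp [dcoef, hgC]

theorem tendsto_one_sub_mul_hgOne :
    Tendsto (fun x : ℝ => (1 - (x : ℂ)) * hgOne x) (𝓝[<] 1) (𝓝 0) := by
  refine tendsto_one_sub_mul_psum (hgC_polyBounded half_le_one) ?_
  rw [← tendsto_add_atTop_iff_nat 1]
  have h := hgCoef_one_limit.mul tendsto_one_div_add_atTop_nhds_zero_nat
  rw [mul_zero] at h
  have h2 := (continuous_ofReal.tendsto _).comp h
  rw [ofReal_zero] at h2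
  refine h2.congr fun n => ?_
  simp only [hgC, Function.comp]
  congr 1
  field_simp

/-- `x (1 - x)` times the Wronskian of `oneCut x` and `hgOne (1 - x)`. -/
def wronskian (x : ℂ) : ℂ :=
  x * (1 - x) * (-(oneCut x * hgOne' (1 - x)) - deriv oneCut x * hgOne (1 - x))

theorem mem_ball_one_iff_norm {x : ℂ} {r : ℝ} : x ∈ Metric.ball (1 : ℂ) r ↔ ‖1 - x‖ < r := by
  rw [Metric.mem_ball, dist_comm, dist_eq_norm]

theorem reflect_hasDerivAt {f : ℂ → ℂ} {f' x : ℂ} (hf : HasDerivAt f f' (1 - x)) :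
    HasDerivAt (fun y => f (1 - y)) (-f') x :=
  (hf.comp x ((hasDerivAt_id x).const_sub 1)).congr_deriv (by ring)

theorem oneCut_eventuallyEq {x : ℂ} (hx : ‖x‖ < 1) : oneCut =ᶠ[𝓝 x] hgOne := by
  filter_upwards [Metric.isOpen_ball.mem_nhds (mem_ball_zero_iff.2 hx)] with y hy
  exact oneCut_eq_hgOne (mem_ball_zero_iff.1 hy)

theorem deriv_oneCut {x : ℂ} (hx : ‖x‖ < 1) : deriv oneCut x = hgOne' x := by
  rw [(oneCut_eventuallyEq hx).deriv_eq, (hgOne_hasDerivAt hx).deriv]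

/-- The centre lies on the real axis to the left of 1, and the slit [1, ∞) points straight away from
it. The connectedness of the slit disc follows. -/
theorem starConvex_ball_inter_cutDom {r : ℝ} (h0 : 0 < r) :
    StarConvex ℝ (1 - (r / 2 : ℂ)) (Metric.ball (1 : ℂ) r ∩ cutDom) := by
  have hc : (1 - (r / 2 : ℂ)) ∈ Metric.ball (1 : ℂ) r := by
    rw [mem_ball_one_iff_norm]
    have : (1 : ℂ) - (1 - r / 2) = ((r / 2 : ℝ) : ℂ) := by push_cast; ring
    rw [this, Complex.norm_real, Real.norm_of_nonneg (by positivity)]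
    linarith
  refine StarConvex.inter ((convex_ball _ _).starConvex hc) ?_
  intro x hx a b ha hb hab
  rw [mem_cutDom] at hx ⊢
  simp only [real_smul, add_re, mul_re, ofReal_re, ofReal_im, sub_re, one_re, zero_mul, sub_zero,
    add_im, mul_im, sub_im, one_im, add_zero]
  have e1 : ((r : ℂ) / 2).re = r / 2 := by simp
  have e2 : ((r : ℂ) / 2).im = 0 := by simp
  rw [e1, e2]
  rcases hb.eq_or_lt with rfl | hb
  · left
    have : a = 1 := by linarith
    subst this; linarith
  · rcases hx with hx | hx
    · left; nlinarith
    · right; simpa using ⟨hb.ne', hx⟩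

theorem half_mem_ball_inter_cutDom {r : ℝ} (h0 : 0 < r) :
    (1 - (r / 2 : ℂ)) ∈ Metric.ball (1 : ℂ) r ∩ cutDom := by
  constructor
  · rw [mem_ball_one_iff_norm]
    have : (1 : ℂ) - (1 - r / 2) = ((r / 2 : ℝ) : ℂ) := by push_cast; ring
    rw [this, Complex.norm_real, Real.norm_of_nonneg (by positivity)]
    linarith
  · rw [mem_cutDom]; left; simpa using h0

theorem isPreconnected_ball_inter_cutDom {r : ℝ} (h0 : 0 < r) :
    IsPreconnected (Metric.ball (1 : ℂ) r ∩ cutDom) :=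
  (StarConvex.isPathConnected (starConvex_ball_inter_cutDom h0)
    (half_mem_ball_inter_cutDom h0)).isConnected.isPreconnected

/-- On the disc |y - 1/2| < 1/2 both solutions are power series and the differential equation makes
the derivative vanish. The identity theorem carries the constancy to the slit disc around 1. -/
theorem wronskian_const {x : ℂ} (hx : x ∈ Metric.ball (1 : ℂ) 1 ∩ cutDom) :
    wronskian x = wronskian (1 / 2) := by
  have hopen : IsOpen (Metric.ball (1 : ℂ) 1 ∩ cutDom) := Metric.isOpen_ball.inter isOpen_cutDom
  have hW : DifferentiableOn ℂ wronskian (Metric.ball (1 : ℂ) 1 ∩ cutDom) := by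
    intro y hy
    have hy1 := mem_ball_one_iff_norm.1 hy.1
    have d1 := oneCut_differentiableOn.differentiableAt (isOpen_cutDom.mem_nhds hy.2)
    have d2 := (oneCut_differentiableOn.deriv isOpen_cutDom).differentiableAt
      (isOpen_cutDom.mem_nhds hy.2)
    have d3 := (reflect_hasDerivAt (hgOne_hasDerivAt hy1)).differentiableAt
    have d4 := (reflect_hasDerivAt (hgOne'_hasDerivAt hy1)).differentiableAt
    exact ((differentiableAt_id.mul (differentiableAt_id.const_sub 1)).mul
      (((d1.mul d4).neg).sub (d2.mul d3))).differentiableWithinAt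
  have hhalf : (1 / 2 : ℂ) ∈ Metric.ball (1 : ℂ) 1 ∩ cutDom := by
    have := half_mem_ball_inter_cutDom one_pos
    norm_num at this ⊢
    exact this
  have hloc : wronskian =ᶠ[𝓝 (1 / 2)] fun _ => wronskian (1 / 2) := by
    have hB : ∀ y ∈ Metric.ball (1 / 2 : ℂ) (1 / 2), ‖y‖ < 1 ∧ ‖1 - y‖ < 1 := by
      intro y hy
      rw [Metric.mem_ball, dist_eq_norm] at hy
      have hn : ‖(1 / 2 : ℂ)‖ = 1 / 2 := by simp
      constructor
      · calc ‖y‖ = ‖(y - 1 / 2) + 1 / 2‖ := by ring_nf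
          _ ≤ ‖y - 1 / 2‖ + ‖(1 / 2 : ℂ)‖ := norm_add_le _ _
          _ < 1 := by rw [hn]; linarith
      · calc ‖1 - y‖ = ‖1 / 2 - (y - 1 / 2)‖ := by ring_nf
          _ ≤ ‖(1 / 2 : ℂ)‖ + ‖y - 1 / 2‖ := norm_sub_le _ _
          _ < 1 := by rw [hn]; linarith
    have hd : ∀ y ∈ Metric.ball (1 / 2 : ℂ) (1 / 2), HasDerivAt wronskian 0 y := by
      intro y hy
      obtain ⟨h1, h2⟩ := hB y hy
      have hA : wronskian =ᶠ[𝓝 y] fun y => y * (1 - y) *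
          (-(hgOne y * hgOne' (1 - y)) - hgOne' y * hgOne (1 - y)) := by
        filter_upwards [Metric.isOpen_ball.mem_nhds (mem_ball_zero_iff.2 h1)] with z hz
        rw [wronskian, oneCut_eq_hgOne (mem_ball_zero_iff.1 hz),
          deriv_oneCut (mem_ball_zero_iff.1 hz)]
      refine HasDerivAt.congr_of_eventuallyEq ?_ hA
      refine (((hasDerivAt_id y).mul ((hasDerivAt_id y).const_sub 1)).mul
        ((((hgOne_hasDerivAt h1).mul (reflect_hasDerivAt (hgOne'_hasDerivAt h2))).neg).sub
          ((hgOne'_hasDerivAt h1).mul (reflect_hasDerivAt (hgOne_hasDerivAt h2))))).congr_deriv ?_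
      -- For c = 1 the equation is invariant under y ↦ 1 - y, so it is used at y and at 1 - y.
      have o1 := hg_ode half_le_one h1
      have o2 := hg_ode half_le_one h2
      simp only [id, Pi.mul_apply, Pi.neg_apply, Pi.sub_apply]
      push_cast at o1 o2
      simp only [hgOne, hgOne']
      linear_combination psum (hgC 1) y * o2 - psum (hgC 1) (1 - y) * o1
    filter_upwards [Metric.ball_mem_nhds (1 / 2 : ℂ) (by norm_num : (0 : ℝ) < 1 / 2)] with y hy
    exact Metric.isOpen_ball.is_const_of_deriv_eq_zero (convex_ball _ _).isPreconnected
      (fun z hz => (hd z hz).differentiableAt.differentiableWithinAt)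
      (fun z hz => (hd z hz).deriv) hy (Metric.mem_ball_self (by norm_num))
  exact (hW.analyticOnNhd hopen).eqOn_of_preconnected_of_eventuallyEq
    analyticOnNhd_const (isPreconnected_ball_inter_cutDom one_pos) hhalf hloc hx

/-- The constant is read off as x → 1 along the reals: (1 - x) F tends to 0, (1 - x) F' tends to
1/(2π), and the solution based at 1 tends to 1. -/
theorem wronskian_eq {x : ℂ} (hx : x ∈ Metric.ball (1 : ℂ) 1 ∩ cutDom) :
    wronskian x = -(1 / (2 * Real.pi)) := by
  rw [wronskian_const hx]
  have hmem : ∀ᶠ x : ℝ in 𝓝[<] 1, 0 < x :=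
    nhdsWithin_le_nhds (eventually_gt_nhds one_pos)
  have h1 : Tendsto (fun x : ℝ => wronskian x) (𝓝[<] 1) (𝓝 (wronskian (1 / 2))) := by
    refine tendsto_const_nhds.congr' ?_
    filter_upwards [hmem, self_mem_nhdsWithin] with x h0 h1
    refine (wronskian_const ⟨?_, mem_cutDom.2 (Or.inl (by simpa using h1))⟩).symm
    rw [mem_ball_one_iff_norm, ← ofReal_one, ← ofReal_sub, Complex.norm_real, Real.norm_eq_abs, abs_lt]
    have h1' : x < 1 := h1
    constructor <;> linarith
  have hx1 : Tendsto (fun x : ℝ => (x : ℂ)) (𝓝[<] 1) (𝓝 1) := by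
    have := (continuous_ofReal.tendsto (1 : ℝ)).mono_left (nhdsWithin_le_nhds (s := Iio (1 : ℝ)))
    simpa using this
  have hx0 : Tendsto (fun x : ℝ => 1 - (x : ℂ)) (𝓝[<] 1) (𝓝 0) := by
    simpa using hx1.const_sub 1
  have c1 : Tendsto (fun x : ℝ => hgOne' (1 - (x : ℂ))) (𝓝[<] 1) (𝓝 (hgOne' 0)) :=
    ((hgOne'_hasDerivAt (x := 0) (by simp)).continuousAt.tendsto).comp hx0
  have c2 : Tendsto (fun x : ℝ => hgOne (1 - (x : ℂ))) (𝓝[<] 1) (𝓝 (hgOne 0)) :=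
    ((hgOne_hasDerivAt (x := 0) (by simp)).continuousAt.tendsto).comp hx0
  have h2 := hx1.mul (((tendsto_one_sub_mul_hgOne.mul c1).neg).sub
    (tendsto_one_sub_mul_hgOne'.mul c2))
  rw [hgOne_zero] at h2
  have h3 : Tendsto (fun x : ℝ => wronskian x) (𝓝[<] 1) (𝓝 (-(1 / (2 * Real.pi)))) := by
    convert h2.congr' ?_ using 2
    · ring
    · filter_upwards [hmem, self_mem_nhdsWithin] with x h0 h1
      have hx : ‖(x : ℂ)‖ < 1 := by rwa [Complex.norm_real, Real.norm_of_nonneg h0.le]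
      rw [wronskian, oneCut_eq_hgOne hx, deriv_oneCut hx]
      ring
  exact tendsto_nhds_unique h1 h3

/-- Near `1` the continuation of `₂F₁(1/6, 5/6; 1; x)` has a logarithmic singularity. -/
theorem oneCut_log : ∃ (r : ℝ) (H : ℂ → ℂ), 0 < r ∧ r ≤ 1 ∧
    DifferentiableOn ℂ H (Metric.ball 1 r) ∧
    ∀ x ∈ Metric.ball (1 : ℂ) r ∩ cutDom,
      oneCut x = H x - 1 / (2 * Real.pi) * log (1 - x) * hgOne (1 - x) := by
  have hu1 : DifferentiableOn ℂ (fun x => hgOne (1 - x)) (Metric.ball 1 1) := fun y hy =>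
    (reflect_hasDerivAt
      (hgOne_hasDerivAt (mem_ball_one_iff_norm.1 hy))).differentiableAt.differentiableWithinAt
  have hne : ∀ᶠ x in 𝓝 (1 : ℂ), x * hgOne (1 - x) ^ 2 ≠ 0 := by
    have hcont : ContinuousAt (fun x : ℂ => x * hgOne (1 - x) ^ 2) 1 :=
      continuousAt_id.mul (((hu1.differentiableAt (Metric.ball_mem_nhds 1 one_pos)).continuousAt).pow 2)
    refine hcont.eventually_ne ?_
    simp [hgOne_zero]
  obtain ⟨r0, hr0, hb0⟩ := Metric.eventually_nhds_iff_ball.1 hne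
  set r := min r0 1 with hr_def
  have hr : 0 < r := lt_min hr0 one_pos
  have hr1 : r ≤ 1 := min_le_right _ _
  have hsub : Metric.ball (1 : ℂ) r ⊆ Metric.ball 1 1 := Metric.ball_subset_ball hr1
  have hb : ∀ x ∈ Metric.ball (1 : ℂ) r, x * hgOne (1 - x) ^ 2 ≠ 0 := fun x hx =>
    hb0 x (Metric.ball_subset_ball (min_le_left _ _) hx)
  -- With v(x) = `hgOne (1 - x)` and c the Wronskian constant, (F/v)' = c q(x)/(x - 1) and q(1) = 1.
  -- The pole integrates to c log(1 - x); the rest is the divided difference `dslope q 1`, which is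
  -- holomorphic on the disc and has a primitive P.
  set q : ℂ → ℂ := fun x => (x * hgOne (1 - x) ^ 2)⁻¹ with hq
  have hqd : DifferentiableOn ℂ q (Metric.ball 1 r) := fun x hx =>
    ((differentiableWithinAt_id.mul (((hu1.mono hsub) x hx).pow 2)).inv (hb x hx))
  have hds : DifferentiableOn ℂ (dslope q 1) (Metric.ball 1 r) :=
    (Complex.differentiableOn_dslope (Metric.ball_mem_nhds 1 hr)).2 hqd
  obtain ⟨P, hP⟩ := hds.isExactOn_ball
  set c : ℂ := -(1 / (2 * Real.pi)) with hc
  set Q : ℂ → ℂ := fun x => oneCut x / hgOne (1 - x) - c * log (1 - x) - c * P x with hQ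
  have hQd : ∀ x ∈ Metric.ball (1 : ℂ) r ∩ cutDom, HasDerivAt Q 0 x := by
    intro x hx
    have hbx := hb x hx.1
    have hx0 : x ≠ 0 := left_ne_zero_of_mul hbx
    have hu0 : hgOne (1 - x) ≠ 0 := fun h => by simp [h] at hbx
    have hx1 : 1 - x ≠ 0 := slitPlane_ne_zero hx.2
    have d1 := (oneCut_differentiableOn.differentiableAt (isOpen_cutDom.mem_nhds hx.2)).hasDerivAt
    have d2 := reflect_hasDerivAt (hgOne_hasDerivAt (mem_ball_one_iff_norm.1 (hsub hx.1)))
    have d3 := reflect_hasDerivAt (hasDerivAt_log hx.2)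
    have hW := wronskian_eq ⟨hsub hx.1, hx.2⟩
    rw [← hc, wronskian] at hW
    refine (((d1.div d2 hu0).sub (d3.const_mul c)).sub ((hP x hx.1).const_mul c)).congr_deriv ?_
    have hx1' : x - 1 ≠ 0 := fun h => hx1 (by linear_combination -h)
    have hdsl : dslope q 1 x = (q x - q 1) / (x - 1) := by
      rw [dslope_of_ne _ (sub_ne_zero.1 hx1'), slope_def_field]
    have hq1 : q 1 = 1 := by simp [hq, hgOne_zero]
    have hqx : q x = 1 / (x * hgOne (1 - x) ^ 2) := by simp only [hq, one_div]
    rw [hdsl, hq1, hqx, show x - 1 = -(1 - x) by ring]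
    field_simp
    linear_combination -hW
  set k := Q (1 - (r / 2 : ℂ)) with hk
  have hconst : ∀ x ∈ Metric.ball (1 : ℂ) r ∩ cutDom, Q x = k := fun x hx =>
    (Metric.isOpen_ball.inter isOpen_cutDom).is_const_of_deriv_eq_zero
      (isPreconnected_ball_inter_cutDom hr)
      (fun z hz => (hQd z hz).differentiableAt.differentiableWithinAt)
      (fun z hz => (hQd z hz).deriv) hx (half_mem_ball_inter_cutDom hr)
  refine ⟨r, fun x => (c * P x + k) * hgOne (1 - x), hr, hr1, ?_, ?_⟩
  · have hPd : DifferentiableOn ℂ P (Metric.ball 1 r) := fun x hx =>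
      (hP x hx).differentiableAt.differentiableWithinAt
    exact ((hPd.const_mul c).add_const k).mul (hu1.mono hsub)
  · intro x hx
    have hbx := hb x hx.1
    have hu0 : hgOne (1 - x) ≠ 0 := fun h => by simp [h] at hbx
    have h := hconst x hx
    simp only [hQ] at h
    rw [sub_sub, sub_eq_iff_eq_add, div_eq_iff hu0] at h
    rw [h]
    simp only [hc]
    ring

/-! ### The logarithmic singularities of the Borel transforms -/

theorem cutDom_of_not_mem_airyCutPlus {ξ : ℂ} (h : ξ ∉ airyCutPlus) : 3 * ξ / 4 ∈ cutDom := by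
  rw [mem_cutDom]
  by_contra hcon
  push Not at hcon
  have e1 : (3 * ξ / 4).re = 3 * ξ.re / 4 := by simp
  have e2 : (3 * ξ / 4).im = 3 * ξ.im / 4 := by simp
  rw [e1, e2] at hcon
  exact h ⟨by linarith [hcon.2], by linarith [hcon.1]⟩

theorem cutDom_of_not_mem_airyCutMinus {ξ : ℂ} (h : ξ ∉ airyCutMinus) :
    -(3 * ξ / 4) ∈ cutDom := by
  have : -ξ ∉ airyCutPlus := fun h' => h ⟨by simpa using h'.1, by
    have := h'.2
    rw [neg_re] at this
    linarith⟩
  have := cutDom_of_not_mem_airyCutPlus this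
  rwa [show 3 * -ξ / 4 = -(3 * ξ / 4) by ring] at this

/-- The function log(4/3 - ξ) + πi is a branch of log(ξ - 4/3) that is holomorphic off the cut [4/3,
∞). The change of scale ξ = 4x/3 and the shift by πi only add constants to the logarithm, and H
absorbs them. -/
theorem airyPhiPlus_log :
    ∃ G H : ℂ → ℂ, ∃ r : ℝ, 0 < r ∧ r ≤ 4 / 3 ∧
      DifferentiableOn ℂ G airyCutPlusᶜ ∧
      (∀ ξ : ℂ, ‖ξ‖ < 4 / 3 → G ξ = borelSum 1 airyPhiPlus ξ) ∧
      DifferentiableOn ℂ H (Metric.ball (4 / 3) r) ∧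
      ∀ ξ ∈ Metric.ball (4 / 3 : ℂ) r \ airyCutPlus,
        G ξ = H ξ - Complex.I / (2 * Real.pi * Complex.I) *
          (Complex.log (4 / 3 - ξ) + Real.pi * Complex.I) *
            borelSum 1 airyPhiMinus (ξ - 4 / 3) := by
  obtain ⟨r, H, hr, hr1, hH, hlog⟩ := oneCut_log
  have hmap : ∀ ξ ∈ Metric.ball (4 / 3 : ℂ) (4 / 3 * r), 3 * ξ / 4 ∈ Metric.ball (1 : ℂ) r := by
    intro ξ hξ
    rw [Metric.mem_ball, dist_eq_norm] at hξ ⊢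
    rw [show 3 * ξ / 4 - 1 = (3 / 4) * (ξ - 4 / 3) by ring, norm_mul]
    have : ‖(3 / 4 : ℂ)‖ = 3 / 4 := by simp
    rw [this]; linarith
  refine ⟨fun ξ => oneCut (3 * ξ / 4), fun ξ => H (3 * ξ / 4) +
    1 / (2 * Real.pi) * (Real.pi * I - log (3 / 4 : ℝ)) * hgOne (1 - 3 * ξ / 4), 4 / 3 * r,
    by positivity, by linarith, ?_, ?_, ?_, ?_⟩
  · exact oneCut_differentiableOn.comp (by fun_prop) fun ξ hξ => cutDom_of_not_mem_airyCutPlus hξ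
  · intro ξ hξ
    have h := norm_phi_arg_lt (e := 1) (by simp) hξ
    rw [one_mul] at h
    rw [airyPhiPlus_eq, borelSum_one_phiSeries, one_mul, ← oneCut_eq_hgOne h]
  · refine (hH.comp (by fun_prop) hmap).add (DifferentiableOn.const_mul ?_ _)
    intro ξ hξ
    have h1 := mem_ball_one_iff_norm.1 (Metric.ball_subset_ball hr1 (hmap ξ hξ))
    exact ((hgOne_hasDerivAt h1).differentiableAt.comp ξ
      (by fun_prop : DifferentiableAt ℂ (fun ξ : ℂ => 1 - 3 * ξ / 4) ξ)).differentiableWithinAt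
  · rintro ξ ⟨hξ, hcut⟩
    have hc := cutDom_of_not_mem_airyCutPlus hcut
    have hne : 4 / 3 - ξ ≠ 0 := fun h0 => slitPlane_ne_zero hc (by linear_combination (3 / 4) * h0)
    change oneCut (3 * ξ / 4) = _
    rw [hlog _ ⟨hmap ξ hξ, hc⟩, airyPhiMinus_eq, borelSum_one_phiSeries,
      show -1 * (3 * (ξ - 4 / 3) / 4) = 1 - 3 * ξ / 4 by ring]
    have hl : log (1 - 3 * ξ / 4) = log (3 / 4 : ℝ) + log (4 / 3 - ξ) := by
      rw [show 1 - 3 * ξ / 4 = ((3 / 4 : ℝ) : ℂ) * (4 / 3 - ξ) by push_cast; ring,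
        log_ofReal_mul (by norm_num) hne, ofReal_log (by norm_num)]
    rw [hl]
    have hpi : (Real.pi : ℂ) ≠ 0 := ofReal_ne_zero.2 Real.pi_ne_zero
    field_simp
    ring

theorem airyPhiMinus_log :
    ∃ G H : ℂ → ℂ, ∃ r : ℝ, 0 < r ∧ r ≤ 4 / 3 ∧
      DifferentiableOn ℂ G airyCutMinusᶜ ∧
      (∀ ξ : ℂ, ‖ξ‖ < 4 / 3 → G ξ = borelSum 1 airyPhiMinus ξ) ∧
      DifferentiableOn ℂ H (Metric.ball (-(4 / 3)) r) ∧
      ∀ ξ ∈ Metric.ball (-(4 / 3) : ℂ) r \ airyCutMinus,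
        G ξ = H ξ - Complex.I / (2 * Real.pi * Complex.I) *
          Complex.log (ξ + 4 / 3) * borelSum 1 airyPhiPlus (ξ + 4 / 3) := by
  obtain ⟨r, H, hr, hr1, hH, hlog⟩ := oneCut_log
  have hmap : ∀ ξ ∈ Metric.ball (-(4 / 3) : ℂ) (4 / 3 * r),
      -(3 * ξ / 4) ∈ Metric.ball (1 : ℂ) r := by
    intro ξ hξ
    rw [Metric.mem_ball, dist_eq_norm] at hξ ⊢
    rw [show -(3 * ξ / 4) - 1 = -((3 / 4) * (ξ - -(4 / 3))) by ring, norm_neg, norm_mul]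
    have : ‖(3 / 4 : ℂ)‖ = 3 / 4 := by simp
    rw [this]; linarith
  refine ⟨fun ξ => oneCut (-(3 * ξ / 4)), fun ξ => H (-(3 * ξ / 4)) -
    1 / (2 * Real.pi) * log (3 / 4 : ℝ) * hgOne (1 - -(3 * ξ / 4)), 4 / 3 * r,
    by positivity, by linarith, ?_, ?_, ?_, ?_⟩
  · exact oneCut_differentiableOn.comp (by fun_prop) fun ξ hξ => cutDom_of_not_mem_airyCutMinus hξ
  · intro ξ hξ
    have h := norm_phi_arg_lt (e := -1) (by simp) hξ
    rw [airyPhiMinus_eq, borelSum_one_phiSeries, ← oneCut_eq_hgOne h, neg_one_mul]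
  · refine (hH.comp (by fun_prop) hmap).sub (DifferentiableOn.const_mul ?_ _)
    intro ξ hξ
    have h1 := mem_ball_one_iff_norm.1 (Metric.ball_subset_ball hr1 (hmap ξ hξ))
    exact ((hgOne_hasDerivAt h1).differentiableAt.comp ξ
      (by fun_prop : DifferentiableAt ℂ (fun ξ : ℂ => 1 - -(3 * ξ / 4)) ξ)).differentiableWithinAt
  · rintro ξ ⟨hξ, hcut⟩
    have hc := cutDom_of_not_mem_airyCutMinus hcut
    have hne : ξ + 4 / 3 ≠ 0 := fun h0 => slitPlane_ne_zero hc (by linear_combination (3 / 4) * h0)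
    change oneCut (-(3 * ξ / 4)) = _
    rw [hlog _ ⟨hmap ξ hξ, hc⟩, airyPhiPlus_eq, borelSum_one_phiSeries,
      show 1 * (3 * (ξ + 4 / 3) / 4) = 1 - -(3 * ξ / 4) by ring]
    have hl : log (1 - -(3 * ξ / 4)) = log (3 / 4 : ℝ) + log (ξ + 4 / 3) := by
      rw [show 1 - -(3 * ξ / 4) = ((3 / 4 : ℝ) : ℂ) * (ξ + 4 / 3) by push_cast; ring,
        log_ofReal_mul (by norm_num) hne, ofReal_log (by norm_num)]
    rw [hl]
    have hpi : (Real.pi : ℂ) ≠ 0 := ofReal_ne_zero.2 Real.pi_ne_zero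
    field_simp
    ring

/-! ### Analytic continuation along paths -/

theorem continuesAlong_of_analyticAt {γ : ℝ → ℂ} {f g h : ℂ → ℂ}
    (hF : ∀ s ∈ Icc (0 : ℝ) 1, AnalyticAt ℂ h (γ s))
    (h0 : h =ᶠ[𝓝 (γ 0)] f) (h1 : h =ᶠ[𝓝 (γ 1)] g) : ContinuesAlong γ f g :=
  ⟨fun _ => h, hF, fun _ _ => Eventually.of_forall fun _ => EventuallyEq.rfl, h0, h1⟩

/-- A family of germs that is constant on each side of s₀ is a continuation as soon as the two
functions agree near γ(s₀). -/
theorem continuesAlong_glue {γ : ℝ → ℂ} (hγ : Continuous γ) {f g : ℂ → ℂ} {s₀ : ℝ}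
    (h0 : 0 ≤ s₀) (h1 : s₀ < 1)
    (hf : ∀ s ∈ Icc (0 : ℝ) s₀, AnalyticAt ℂ f (γ s))
    (hg : ∀ s ∈ Icc s₀ 1, AnalyticAt ℂ g (γ s))
    (hfg : f =ᶠ[𝓝 (γ s₀)] g) : ContinuesAlong γ f g := by
  refine ⟨fun s => if s ≤ s₀ then f else g, ?_, ?_, ?_, ?_⟩
  · intro s hs
    by_cases h : s ≤ s₀
    · simpa only [if_pos h] using hf s ⟨hs.1, h⟩
    · simpa only [if_neg h] using hg s ⟨(not_le.1 h).le, hs.2⟩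
  · intro s _
    refine nhdsWithin_le_nhds ?_
    rcases lt_trichotomy s s₀ with h | rfl | h
    · filter_upwards [eventually_lt_nhds h] with u hu
      rw [if_pos hu.le, if_pos h.le]
    -- Continuity of γ keeps γ(u), for u near the switching time, in the region where the two
    -- functions coincide.
    · filter_upwards [hγ.continuousAt.eventually hfg.eventually_nhds] with u hu
      rw [if_pos le_rfl]
      by_cases h : u ≤ s
      · rw [if_pos h]
      · rw [if_neg h]
        exact hu.mono fun z hz => hz.symm
    · filter_upwards [eventually_gt_nhds h] with u hu
      rw [if_neg (not_le.2 hu), if_neg (not_le.2 h)]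
  · simp only [if_pos h0]; exact EventuallyEq.rfl
  · simp only [if_neg (not_le.2 h1)]; exact EventuallyEq.rfl

theorem ContinuesAlong.scale {γ : ℝ → ℂ} {f g : ℂ → ℂ} (h : ContinuesAlong γ f g) {ω : ℂ}
    (hω : ω ≠ 0) : ContinuesAlong (fun s => ω * γ s) (fun ξ => f (ξ / ω)) fun ξ => g (ξ / ω) := by
  obtain ⟨F, h1, h2, h3, h4⟩ := h
  have e (s : ℝ) : ω * γ s / ω = γ s := mul_div_cancel_left₀ _ hω
  have ht (s : ℝ) : Tendsto (fun ξ => ξ / ω) (𝓝 (ω * γ s)) (𝓝 (γ s)) := by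
    have := (continuous_id.div_const ω).tendsto (ω * γ s)
    simpa only [id, e] using this
  refine ⟨fun s ξ => F s (ξ / ω), fun s hs => ?_, fun s hs => ?_,
    (ht 0).eventually h3, (ht 1).eventually h4⟩
  · have hd : AnalyticAt ℂ (fun ξ : ℂ => ξ / ω) (ω * γ s) := by fun_prop
    exact AnalyticAt.comp (by rw [e]; exact h1 s hs) hd
  · filter_upwards [h2 s hs] with u hu using (ht u).eventually hu

theorem ContinuesAlong.const_mul {γ : ℝ → ℂ} {f g : ℂ → ℂ} (h : ContinuesAlong γ f g) (c : ℂ) :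
    ContinuesAlong γ (fun ξ => c * f ξ) fun ξ => c * g ξ := by
  obtain ⟨F, h1, h2, h3, h4⟩ := h
  exact ⟨fun s ξ => c * F s ξ, fun s hs => analyticAt_const.mul (h1 s hs),
    fun s hs => (h2 s hs).mono fun u hu => hu.mono fun z hz => congrArg (c * ·) hz,
    h3.mono fun z hz => congrArg (c * ·) hz, h4.mono fun z hz => congrArg (c * ·) hz⟩

theorem rightPath_scale (ω : ℂ) (η : ℝ) : rightPath ω η = fun s => ω * rightPath 1 η s := by
  funext s; simp [rightPath]

theorem clockwiseLoop_scale (ω : ℂ) (η : ℝ) :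
    clockwiseLoop ω η = fun s => ω * clockwiseLoop 1 η s := by
  funext s; simp [clockwiseLoop]

/-- The substitution ξ = ωy scales both paths to ω = 1, so that all singular cases become a question
about the single point y = 1. -/
theorem isAlienPlus_of_unit {α : ℝ} {ω : ℂ} (hω : ω ≠ 0) {a b : PowerSeries ℂ}
    (ha : BorelConvergent α a) (hb : BorelConvergent α b)
    (h : ∀ᶠ η : ℝ in 𝓝[>] 0, ∃ fp fm : ℂ → ℂ,
      ContinuesAlong (rightPath 1 η) (fun y => borelGerm α ω a (ω * y)) fp ∧
      ContinuesAlong (clockwiseLoop 1 η) fp fm ∧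
      (fun y => fp y - fm y) =ᶠ[𝓝 (1 + η : ℂ)] fun y => borelGerm α ω b (ω * (y - 1))) :
    IsAlienPlus α ω a b := by
  refine ⟨ha, hb, ?_⟩
  filter_upwards [h] with η ⟨fp, fm, h1, h2, h3⟩
  refine ⟨fun ξ => fp (ξ / ω), fun ξ => fm (ξ / ω), ?_, ?_, ?_⟩
  · have := h1.scale hω
    rw [rightPath_scale]
    simpa only [mul_div_cancel₀ _ hω] using this
  · rw [clockwiseLoop_scale]
    exact h2.scale hω
  · have ht : Tendsto (fun ξ => ξ / ω) (𝓝 (ω * (1 + η))) (𝓝 (1 + η)) := by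
      have := (continuous_id.div_const ω).tendsto (ω * (1 + η))
      simpa only [id, mul_div_cancel_left₀ _ hω] using this
    filter_upwards [ht.eventually h3] with ξ hξ
    rw [hξ]
    congr 1
    field_simp

theorem borelSum_smul (α : ℝ) (c : ℂ) (a : PowerSeries ℂ) (ξ : ℂ) :
    borelSum α (c • a) ξ = c * borelSum α a ξ := by
  rw [borelSum, borelSum, ← tsum_mul_left]
  refine tsum_congr fun m => ?_
  rw [PowerSeries.coeff_smul, smul_eq_mul]
  ring

theorem borelGerm_smul (α : ℝ) (ω : ℂ) (c : ℂ) (a : PowerSeries ℂ) (ξ : ℂ) :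
    borelGerm α ω (c • a) ξ = c * borelGerm α ω a ξ := by
  rw [borelGerm, borelGerm, borelSum_smul]
  ring

theorem BorelConvergent.smul {α : ℝ} {a : PowerSeries ℂ} (h : BorelConvergent α a) (c : ℂ) :
    BorelConvergent α (c • a) := by
  obtain ⟨r, hr, h⟩ := h
  refine ⟨r, hr, fun ξ hξ => ((h ξ hξ).mul_left c).congr fun m => ?_⟩
  rw [PowerSeries.coeff_smul, smul_eq_mul]
  ring

theorem IsAlienPlus.smul {α : ℝ} {ω : ℂ} {a b : PowerSeries ℂ} (h : IsAlienPlus α ω a b) (c : ℂ) :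
    IsAlienPlus α ω (c • a) (c • b) := by
  refine ⟨h.1.smul c, h.2.1.smul c, ?_⟩
  filter_upwards [h.2.2] with η ⟨fp, fm, h1, h2, h3⟩
  refine ⟨fun ξ => c * fp ξ, fun ξ => c * fm ξ, ?_, h2.const_mul c, ?_⟩
  · have := h1.const_mul c
    simpa only [← borelGerm_smul] using this
  · filter_upwards [h3] with ξ hξ
    rw [borelGerm_smul, ← hξ]
    ring

/-- Only the logarithm is multivalued, since A and B are holomorphic on the whole circle. The entire
function κ covers both cases: a shifted identity for the logarithmic singularity and exp(-z/2) for
the inverse square root. -/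
theorem continuesAlong_clockwiseLoop {η : ℝ} (hη : 0 < η) {A B κ : ℂ → ℂ}
    (hA : ∀ y : ℂ, ‖y - 1‖ = η → AnalyticAt ℂ A y) (hB : ∀ y : ℂ, ‖y - 1‖ = η → AnalyticAt ℂ B y)
    (hκ : Differentiable ℂ κ) {f : ℂ → ℂ}
    (hf : f =ᶠ[𝓝 (1 + η : ℂ)] fun y => A y + B y * κ (log (y - 1))) :
    ContinuesAlong (clockwiseLoop 1 η) f
      fun y => A y + B y * κ (log (y - 1) - 2 * Real.pi * I) := by
  have hη' : (η : ℂ) ≠ 0 := ofReal_ne_zero.2 hη.ne'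
  -- The branch of log(y - 1) at time s: the point is rotated back and rescaled so that the
  -- principal logarithm is taken near 1, and the constants undo this. At s = 1 it is log(y - 1) -
  -- 2πi.
  set L : ℝ → ℂ → ℂ := fun s y =>
    log ((y - 1) / η * exp (2 * Real.pi * s * I)) + Real.log η - 2 * Real.pi * s * I with hL
  have hγ (s : ℝ) : clockwiseLoop 1 η s - 1 = η * exp (-(2 * Real.pi * s * I)) := by
    rw [clockwiseLoop]; push_cast; ring_nf
  have hone (s : ℝ) : (clockwiseLoop 1 η s - 1) / η * exp (2 * Real.pi * s * I) = 1 := by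
    rw [hγ, mul_div_cancel_left₀ _ hη', ← exp_add]; simp
  have hnorm (s : ℝ) : ‖clockwiseLoop 1 η s - 1‖ = η := by
    rw [hγ, norm_mul, Complex.norm_real, Real.norm_of_nonneg hη.le,
      show -(2 * Real.pi * s * I) = ((-(2 * Real.pi * s) : ℝ) : ℂ) * I by push_cast; ring,
      norm_exp_ofReal_mul_I, mul_one]
  refine ⟨fun s y => A y + B y * κ (L s y), fun s _ => ?_, fun s _ => ?_, ?_, ?_⟩
  · refine (hA _ (hnorm s)).add ((hB _ (hnorm s)).mul ?_)
    refine (hκ.analyticAt _).comp ?_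
    have h1 : AnalyticAt ℂ (fun y : ℂ => (y - 1) / η * exp (2 * Real.pi * s * I))
        (clockwiseLoop 1 η s) := by fun_prop
    exact ((h1.clog (by rw [hone]; exact one_mem_slitPlane)).add analyticAt_const).sub
      analyticAt_const
  · refine nhdsWithin_le_nhds ?_
    -- Two arguments below π/2 in absolute value add up without crossing the cut of the principal
    -- logarithm, so nearby branches agree.
    have hclose : ∀ᶠ u in 𝓝 s, |2 * Real.pi * (s - u)| < Real.pi / 2 := by
      have : Tendsto (fun u : ℝ => |2 * Real.pi * (s - u)|) (𝓝 s) (𝓝 |2 * Real.pi * (s - s)|) :=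
        (by fun_prop : Continuous fun u : ℝ => |2 * Real.pi * (s - u)|).tendsto s
      rw [sub_self, mul_zero, abs_zero] at this
      exact this.eventually (gt_mem_nhds (by positivity))
    filter_upwards [hclose] with u hu
    have hpos : ∀ᶠ y in 𝓝 (clockwiseLoop 1 η u),
        0 < ((y - 1) / η * exp (2 * Real.pi * u * I)).re := by
      have hc : ContinuousAt (fun y : ℂ => ((y - 1) / η * exp (2 * Real.pi * u * I)).re)
          (clockwiseLoop 1 η u) := by fun_prop
      refine hc.eventually (lt_mem_nhds ?_)
      beta_reduce
      rw [hone]; simp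
    filter_upwards [hpos] with y hy
    have key : L u y = L s y := by
      set a := (y - 1) / η * exp (2 * Real.pi * u * I) with ha
      have hb : (y - 1) / η * exp (2 * Real.pi * s * I) =
          a * exp (((2 * Real.pi * (s - u) : ℝ) : ℂ) * I) := by
        rw [ha, mul_assoc ((y - 1) / (η : ℂ)), ← exp_add]; push_cast; ring_nf
      have ha0 : a ≠ 0 := by rintro h; simp [h] at hy
      have harg := abs_lt.1 (abs_arg_lt_pi_div_two_iff.2 (Or.inl hy : 0 < a.re ∨ a = 0))
      have hu' := abs_lt.1 hu
      have hbarg : arg (exp (((2 * Real.pi * (s - u) : ℝ) : ℂ) * I)) = 2 * Real.pi * (s - u) := by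
        rw [arg_exp_mul_I, toIocMod_eq_self]
        constructor <;> linarith [hu'.1, hu'.2, Real.pi_pos]
      have hlog : log (exp (((2 * Real.pi * (s - u) : ℝ) : ℂ) * I)) =
          ((2 * Real.pi * (s - u) : ℝ) : ℂ) * I := by
        rw [log_exp] <;> simp <;> linarith [hu'.1, hu'.2, Real.pi_pos]
      simp only [hL]
      rw [hb, log_mul ha0 (exp_ne_zero _), hlog]
      · push_cast; ring
      · rw [hbarg]
        constructor <;> linarith [hu'.1, hu'.2, harg.1, harg.2]
    simp only [key]
  · have e : clockwiseLoop 1 η 0 = 1 + η := by simp [clockwiseLoop]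
    rw [e]
    have hne : ∀ᶠ y in 𝓝 (1 + η : ℂ), y - 1 ≠ 0 := by
      have hc : ContinuousAt (fun y : ℂ => y - 1) (1 + η) := by fun_prop
      exact hc.eventually_ne (by simpa using hη.ne')
    filter_upwards [hf, hne] with y hy hy0
    have : L 0 y = log (y - 1) := by
      simp only [hL, ofReal_zero, mul_zero, zero_mul, exp_zero, mul_one, sub_zero]
      rw [add_comm (log _), ← log_mul_ofReal _ hη, div_mul_cancel₀ _ hη']
      exact div_ne_zero hy0 hη'
    rw [hy, this]
  · have e : clockwiseLoop 1 η 1 = 1 + η := by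
      have h := hγ 1
      have h2 : exp (-(2 * Real.pi * ((1 : ℝ) : ℂ) * I)) = 1 := by
        rw [ofReal_one, mul_one, exp_neg, exp_two_pi_mul_I, inv_one]
      rw [h2, mul_one] at h
      linear_combination h
    rw [e]
    have hne : ∀ᶠ y in 𝓝 (1 + η : ℂ), y - 1 ≠ 0 := by
      have hc : ContinuousAt (fun y : ℂ => y - 1) (1 + η) := by fun_prop
      exact hc.eventually_ne (by simpa using hη.ne')
    filter_upwards [hne] with y hy0
    have : L 1 y = log (y - 1) - 2 * Real.pi * I := by
      simp only [hL, ofReal_one, mul_one, exp_two_pi_mul_I]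
      rw [add_comm (log _), ← log_mul_ofReal _ hη, div_mul_cancel₀ _ hη']
      exact div_ne_zero hy0 hη'
    rw [this]

/-! ### Continuation below the cut `[1, ∞)` -/

/-- The logarithm on the plane cut along the negative imaginary axis. -/
def logR (z : ℂ) : ℂ := log (-I * z) + Real.pi / 2 * I

/-- There the argument exceeds -π/2, so multiplication by -i does not cross the cut of the principal
logarithm. -/
theorem logR_eq_log {z : ℂ} (hz : 0 < z.re ∨ 0 < z.im) : logR z = log z := by
  have hz0 : z ≠ 0 := by rintro rfl; simp at hz
  have harg : -(Real.pi / 2) < arg z := by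
    rcases hz with h | h
    · exact (abs_lt.1 (abs_arg_lt_pi_div_two_iff.2 (Or.inl h : 0 < z.re ∨ z = 0))).1
    · have := arg_nonneg_iff.2 h.le
      linarith [Real.pi_pos]
  have hI : arg (-I) = -(Real.pi / 2) := arg_neg_I
  rw [logR, log_mul (neg_ne_zero.2 I_ne_zero) hz0, log_neg_I]
  · ring
  · rw [hI]
    constructor <;> linarith [arg_le_pi z, Real.pi_pos]

/-- The square root on the plane cut along the negative imaginary axis. -/
def rootR (z : ℂ) : ℂ := exp (logR z / 2)

theorem rootR_ne_zero (z : ℂ) : rootR z ≠ 0 := exp_ne_zero _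

theorem rootR_sq {z : ℂ} (hz : z ≠ 0) : rootR z ^ 2 = z := by
  have h : -I * z ≠ 0 := mul_ne_zero (neg_ne_zero.2 I_ne_zero) hz
  rw [rootR, ← exp_nat_mul, logR]
  have : ((2 : ℕ) : ℂ) * ((log (-I * z) + Real.pi / 2 * I) / 2) =
      log (-I * z) + Real.pi / 2 * I := by push_cast; ring
  rw [this, exp_add, exp_log h, exp_pi_div_two_mul_I]
  linear_combination (-z) * I_sq

theorem logR_hasDerivAt {z : ℂ} (hz : -I * z ∈ slitPlane) : HasDerivAt logR (1 / z) z := by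
  have h0 : z ≠ 0 := right_ne_zero_of_mul (slitPlane_ne_zero hz)
  refine ((((hasDerivAt_id z).const_mul (-I)).clog hz).add_const _).congr_deriv ?_
  have := I_ne_zero
  simp only [id]
  field_simp

theorem rootR_hasDerivAt {z : ℂ} (hz : -I * z ∈ slitPlane) :
    HasDerivAt rootR (1 / (2 * rootR z)) z := by
  have h0 : z ≠ 0 := right_ne_zero_of_mul (slitPlane_ne_zero hz)
  refine ((logR_hasDerivAt hz).div_const 2).cexp.congr_deriv ?_
  change rootR z * _ = _
  have h1 := rootR_ne_zero z
  have h2 := rootR_sq h0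
  field_simp
  linear_combination h2

/-- The plane cut along `(-∞, 0]` and `1 + i [0, ∞)`. -/
def rightDom : Set ℂ := {x | x ∈ slitPlane ∧ -I * (1 - x) ∈ slitPlane}

theorem isOpen_rightDom : IsOpen rightDom :=
  isOpen_slitPlane.inter
    (isOpen_slitPlane.preimage (by fun_prop : Continuous fun x : ℂ => -I * (1 - x)))

theorem mem_rightDom {x : ℂ} (h0 : 0 < x.re) (h1 : x.re ≠ 1 ∨ x.im < 0) : x ∈ rightDom := by
  refine ⟨Or.inl h0, ?_⟩
  rw [mem_slitPlane_iff]
  rcases h1 with h1 | h1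
  · right
    intro h
    refine h1 ?_
    have : (-I * (1 - x)).im = -(1 - x.re) := by simp
    linarith
  · left
    simpa using h1

/-- The continuation of `₂F₁(1/6, 5/6; 1/2; x)` to `rightDom`. -/
def halfRight (x : ℂ) : ℂ :=
  cos (2 / 3 * angle (csq x) (rootR (1 - x))) / rootR (1 - x)

theorem halfRight_sq {x : ℂ} (hx : x ∈ rightDom) : rootR (1 - x) ^ 2 = 1 - csq x ^ 2 := by
  have h0 : 1 - x ≠ 0 := right_ne_zero_of_mul (slitPlane_ne_zero hx.2)
  rw [rootR_sq h0, csq_sq (slitPlane_ne_zero hx.1)]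

theorem halfRight_differentiableAt {x : ℂ} (hx : x ∈ rightDom) :
    DifferentiableAt ℂ halfRight x := by
  have hsq := halfRight_sq hx
  have d1 := csq_hasDerivAt hx.1
  have d2 := reflect_hasDerivAt (rootR_hasDerivAt hx.2)
  have hr := rootR_ne_zero (1 - x)
  have hc := csq_ne_zero x
  -- If q = i√x + √(1 - x) were real, so would be q⁻¹ and with it q - q⁻¹ = 2i√x, against Re √x > 0.
  have hslit : I * csq x + rootR (1 - x) ∈ slitPlane := by
    rw [mem_slitPlane_iff]
    right
    intro him
    have hm := angle_mul hsq
    have hinv : rootR (1 - x) - I * csq x = (I * csq x + rootR (1 - x))⁻¹ :=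
      eq_inv_of_mul_eq_one_right hm
    have h1 : (rootR (1 - x) - I * csq x).im = 0 := by
      rw [hinv, inv_im, him]; simp
    have h2 : (2 * I * csq x).im = 0 := by
      have : 2 * I * csq x = (I * csq x + rootR (1 - x)) - (rootR (1 - x) - I * csq x) := by ring
      rw [this, sub_im, him, h1, sub_zero]
    have h3 := csq_re_pos hx.1
    simp at h2
    linarith
  have hA := angle_hasDerivAt d1 d2 hr (by field_simp) hslit
  exact (((hA.const_mul (2 / 3 : ℂ)).ccos).div d2 hr).differentiableAt

theorem halfRight_eq_hgHalf {x : ℂ} (h0 : x ∈ slitPlane) (h : ‖x‖ < 1) :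
    halfRight x = hgHalf x := by
  have hre : 0 < (1 - x).re := by
    have := (re_le_norm x).trans_lt h
    simpa using this
  have hroot : rootR (1 - x) = csq (1 - csq x ^ 2) := by
    rw [csq_sq (slitPlane_ne_zero h0), rootR, csq, logR_eq_log (Or.inl hre)]
  have hn : ‖csq x‖ < 1 := by
    have : ‖csq x‖ ^ 2 < 1 := by rwa [← norm_pow, csq_sq (slitPlane_ne_zero h0)]
    nlinarith [norm_nonneg (csq x)]
  have h2 := evenPart_eq hn
  rw [csq_sq (slitPlane_ne_zero h0)] at h2
  rw [← h2, halfRight, hroot, evenPart, asn]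

/-- The angle with sine √x is π/2 minus the angle with sine √(1 - x). Expanding cos(π/3 - 2v/3) and
using `hgHalf_asn_aux` at √(1 - x) separates the term that is odd in √(1 - x), and so changes sign
around 1, from the one that is holomorphic at 1. -/
theorem halfRight_near_one {x : ℂ} (hx : x ∈ rightDom) (h : ‖1 - x‖ < 1) :
    halfRight x = 1 / 2 * csq x * hgHalf (1 - x) / rootR (1 - x) +
      3 * Real.sqrt 3 / 4 * (hgHalf (1 - x) - 2 * x * hgHalf' (1 - x)) := by
  have h0 : 1 - x ≠ 0 := right_ne_zero_of_mul (slitPlane_ne_zero hx.2)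
  have hr2 := rootR_sq h0
  have hn : ‖rootR (1 - x)‖ < 1 := by
    have : ‖rootR (1 - x)‖ ^ 2 < 1 := by rwa [← norm_pow, hr2]
    nlinarith [norm_nonneg (rootR (1 - x))]
  have hdom : rootR (1 - x) ∈ asnDom := ball_subset_asnDom (mem_ball_zero_iff.2 hn)
  have hc : csq (1 - rootR (1 - x) ^ 2) = csq x := by rw [hr2]; ring_nf
  obtain ⟨a1, a2⟩ := hgHalf_asn_aux hn
  rw [hr2] at a1 a2
  have e1 : (1 : ℂ) - (1 - x) = x := by ring
  rw [e1] at a1 a2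
  have hu : angle (csq x) (rootR (1 - x)) = Real.pi / 2 - asn (rootR (1 - x)) := by
    rw [asn, hc, angle, angle]
    set r := rootR (1 - x)
    have hsq : csq x ^ 2 = 1 - r ^ 2 := by rw [hr2, csq_sq (slitPlane_ne_zero hx.1)]; ring
    have hm := angle_mul hsq
    have hq0 : I * r + csq x ≠ 0 := left_ne_zero_of_mul_eq_one hm
    have hpos := angle_re_pos hsq (csq_re_pos hx.1)
    have harg := abs_lt.1 (abs_arg_lt_pi_div_two_iff.2
      (Or.inl hpos : 0 < (I * r + csq x).re ∨ I * r + csq x = 0))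
    have hnpi : arg (I * r + csq x) ≠ Real.pi := by linarith [harg.2, Real.pi_pos]
    have hprod : I * csq x + r = I * (I * r + csq x)⁻¹ := by
      rw [← eq_inv_of_mul_eq_one_right hm]
      linear_combination r * I_sq
    rw [hprod, log_mul I_ne_zero (inv_ne_zero hq0), log_I, log_inv _ hnpi]
    · linear_combination (-(Real.pi / 2 : ℂ)) * I_sq
    · rw [arg_inv, if_neg hnpi, arg_I]
      constructor <;> linarith [harg.1, harg.2, Real.pi_pos]
  have hr := rootR_ne_zero (1 - x)
  have hcos : cos (2 / 3 * (Real.pi / 2 - asn (rootR (1 - x)))) =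
      1 / 2 * cos (2 / 3 * asn (rootR (1 - x))) +
        Real.sqrt 3 / 2 * sin (2 / 3 * asn (rootR (1 - x))) := by
    rw [show 2 / 3 * ((Real.pi : ℂ) / 2 - asn (rootR (1 - x))) =
      ((Real.pi / 3 : ℝ) : ℂ) - 2 / 3 * asn (rootR (1 - x)) by push_cast; ring, Complex.cos_sub,
      ← ofReal_cos, ← ofReal_sin, Real.cos_pi_div_three, Real.sin_pi_div_three]
    push_cast; ring
  rw [halfRight, hu, hcos, a1, a2]
  have hc' : csq (x) = csq x := rfl
  field_simp
  ring

/-! ### The paths of the alien operators -/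

theorem rightPath_eq (η s : ℝ) :
    rightPath 1 η s = ((η + s : ℝ) : ℂ) - ((η * Real.sin (Real.pi * s) : ℝ) : ℂ) * I := by
  rw [rightPath]; push_cast; ring

theorem rightPath_re (η s : ℝ) : (rightPath 1 η s).re = η + s := by
  rw [rightPath_eq, sub_re, ofReal_re, re_ofReal_mul, I_re, mul_zero, sub_zero]

theorem rightPath_im (η s : ℝ) : (rightPath 1 η s).im = -(η * Real.sin (Real.pi * s)) := by
  rw [rightPath_eq, sub_im, ofReal_im, im_ofReal_mul, I_im, mul_one, zero_sub]

theorem continuous_rightPath (η : ℝ) : Continuous (rightPath 1 η) := by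
  unfold rightPath; fun_prop

theorem rightPath_zero (η : ℝ) : rightPath 1 η 0 = η := by simp [rightPath]

theorem norm_clockwiseLoop {η : ℝ} (hη : 0 < η) (s : ℝ) : ‖clockwiseLoop 1 η s - 1‖ = η := by
  rw [clockwiseLoop, one_mul, add_sub_cancel_left, norm_mul, Complex.norm_real,
    Real.norm_of_nonneg hη.le, ← ofReal_neg, norm_exp_ofReal_mul_I, mul_one]

theorem abs_re_sub_one_le (y : ℂ) : |y.re - 1| ≤ ‖y - 1‖ := by
  simpa using abs_re_le_norm (y - 1)

theorem eventually_small {c : ℝ} (hc : 0 < c) : ∀ᶠ η : ℝ in 𝓝[>] 0, 0 < η ∧ η < c := by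
  filter_upwards [self_mem_nhdsWithin, nhdsWithin_le_nhds (eventually_lt_nhds hc)] with η h1 h2
  exact ⟨h1, h2⟩

theorem borelSum_zero (α : ℝ) (ξ : ℂ) : borelSum α 0 ξ = 0 := by simp [borelSum]

theorem borelGerm_zero (α : ℝ) (ω ξ : ℂ) : borelGerm α ω 0 ξ = 0 := by
  simp [borelGerm, borelSum_zero]

theorem borelConvergent_zero (α : ℝ) : BorelConvergent α 0 :=
  ⟨1, one_pos, fun ξ _ => by simp⟩

/-- If the Borel transform extends holomorphically to a neighbourhood of the paths, the alien
operator vanishes. -/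
theorem isAlienPlus_zero_of_analyticAt {α : ℝ} {ω : ℂ} (hω : ω ≠ 0) {a : PowerSeries ℂ}
    (ha : BorelConvergent α a) {f : ℂ → ℂ}
    (h : ∀ᶠ η : ℝ in 𝓝[>] 0, (∀ s ∈ Icc (0 : ℝ) 1, AnalyticAt ℂ f (rightPath 1 η s)) ∧
      (∀ s ∈ Icc (0 : ℝ) 1, AnalyticAt ℂ f (clockwiseLoop 1 η s)) ∧
      f =ᶠ[𝓝 (η : ℂ)] fun y => borelGerm α ω a (ω * y)) :
    IsAlienPlus α ω a 0 := by
  refine isAlienPlus_of_unit hω ha (borelConvergent_zero α) ?_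
  filter_upwards [h] with η ⟨h1, h2, h3⟩
  refine ⟨f, f, continuesAlong_of_analyticAt h1 ?_ EventuallyEq.rfl,
    continuesAlong_of_analyticAt h2 EventuallyEq.rfl EventuallyEq.rfl, ?_⟩
  · rwa [rightPath_zero]
  · refine Eventually.of_forall fun y => ?_
    simp [borelGerm_zero]

theorem borelGerm_one_phiSeries (ω e ξ : ℂ) :
    borelGerm 1 ω (phiSeries e) ξ = hgOne (e * (3 * ξ / 4)) := by
  rw [borelGerm, borelSum_one_phiSeries]
  simp

/-- The factor of `ξ ^ (-1/2)` that does not depend on the direction. -/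
def halfFactor (ω : ℂ) : ℂ := ω ^ (-(1 / 2) : ℂ) * (Real.sqrt Real.pi : ℂ)⁻¹

theorem borelGerm_half_phiSeries {ω : ℂ} (hω : ω ≠ 0) (e : ℂ) {y : ℂ} (hy : y ≠ 0) :
    borelGerm (1 / 2) ω (phiSeries e) (ω * y) =
      halfFactor ω * ((csq y)⁻¹ * hgHalf (e * (3 * (ω * y) / 4))) := by
  rw [borelGerm, borelSum_half_phiSeries, mul_div_cancel_left₀ _ hω, halfFactor]
  have h1 : (((1 / 2 : ℝ) : ℂ) - 1) = -(1 / 2) := by push_cast; norm_num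
  have h2 : y ^ (-(1 / 2) : ℂ) = (csq y)⁻¹ := by
    rw [cpow_def_of_ne_zero hy, csq, ← exp_neg]
    congr 1; ring
  rw [h1, h2]
  ring

theorem norm_lt_of_near {η : ℝ} (h0 : 0 < η) {c : ℝ} (hc : η < c) :
    ∀ᶠ y in 𝓝 (η : ℂ), ‖y‖ < c ∧ 0 < y.re := by
  have h1 : ContinuousAt (fun y : ℂ => ‖y‖) (η : ℂ) := by fun_prop
  have h2 : ContinuousAt (fun y : ℂ => y.re) (η : ℂ) := by fun_prop
  refine (h1.eventually (gt_mem_nhds ?_)).and (h2.eventually (lt_mem_nhds ?_))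
  · simpa [abs_of_pos h0] using hc
  · simpa using h0

theorem oneCut_analyticAt {x : ℂ} (hx : x ∈ cutDom) : AnalyticAt ℂ oneCut x :=
  oneCut_differentiableOn.analyticAt (isOpen_cutDom.mem_nhds hx)

theorem halfCut_analyticAt {x : ℂ} (hx : x ∈ cutDom) : AnalyticAt ℂ halfCut x :=
  halfCut_differentiableOn.analyticAt (isOpen_cutDom.mem_nhds hx)

theorem halfRight_analyticAt {x : ℂ} (hx : x ∈ rightDom) : AnalyticAt ℂ halfRight x :=
  DifferentiableOn.analyticAt (s := rightDom)
    (fun _ hy => (halfRight_differentiableAt hy).differentiableWithinAt)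
    (isOpen_rightDom.mem_nhds hx)

theorem csq_analyticAt {x : ℂ} (hx : x ∈ slitPlane) : AnalyticAt ℂ csq x :=
  DifferentiableOn.analyticAt (s := slitPlane)
    (fun _ hy => (csq_hasDerivAt hy).differentiableAt.differentiableWithinAt)
    (isOpen_slitPlane.mem_nhds hx)

theorem norm_mul_lt_one {c : ℝ} (hc : 0 < c) {y : ℂ} (hy : ‖y‖ < 1 / c) {ρ : ℝ} (hρ : |ρ| = c) :
    ‖(ρ : ℂ) * y‖ < 1 := by
  rw [norm_mul, Complex.norm_real, Real.norm_eq_abs, hρ]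
  rwa [lt_div_iff₀ hc, mul_comm] at hy

/-- In the direction without a singularity the alien operators vanish, `α = 1`. -/
theorem isAlienPlus_one_opposite {e ω : ℂ} (he : ‖e‖ = 1) (hω : ω ≠ 0)
    {ρ : ℝ} (hρ : ρ < 0) (heω : e * (3 * ω / 4) = ρ) :
    IsAlienPlus 1 ω (phiSeries e) 0 := by
  have hdom (y : ℂ) (hy : 0 < y.re) : (ρ : ℂ) * y ∈ cutDom := by
    rw [mem_cutDom]; left
    rw [re_ofReal_mul]; nlinarith
  have hscale (y : ℂ) : AnalyticAt ℂ (fun y : ℂ => (ρ : ℂ) * y) y := by fun_prop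
  refine isAlienPlus_zero_of_analyticAt hω (borelConvergent_one_phiSeries he)
    (f := fun y => oneCut (ρ * y)) ?_
  have hpos : 0 < |ρ| := abs_pos.2 hρ.ne
  filter_upwards [eventually_small (lt_min one_pos (one_div_pos.2 hpos))] with η ⟨h0, h1⟩
  refine ⟨fun s hs => ?_, fun s _ => ?_, ?_⟩
  · refine (oneCut_analyticAt (hdom _ ?_)).comp (hscale _)
    rw [rightPath_re]; linarith [hs.1]
  · refine (oneCut_analyticAt (hdom _ ?_)).comp (hscale _)
    have := abs_re_sub_one_le (clockwiseLoop 1 η s)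
    rw [norm_clockwiseLoop h0] at this
    linarith [(abs_le.1 this).1, min_le_left 1 (1 / |ρ|)]
  · filter_upwards [norm_lt_of_near h0 (h1.trans_le (min_le_right _ _))] with y hy
    rw [borelGerm_one_phiSeries, oneCut_eq_hgOne (norm_mul_lt_one hpos hy.1 rfl),
      ← heω]
    ring_nf

/-- In the direction without a singularity the alien operators vanish, `α = 1/2`. -/
theorem isAlienPlus_half_opposite {e ω : ℂ} (he : ‖e‖ = 1) (hω : ω ≠ 0)
    {ρ : ℝ} (hρ : ρ < 0) (heω : e * (3 * ω / 4) = ρ) :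
    IsAlienPlus (1 / 2) ω (phiSeries e) 0 := by
  have hdom (y : ℂ) (hy : 0 < y.re) : (ρ : ℂ) * y ∈ cutDom := by
    rw [mem_cutDom]; left
    rw [re_ofReal_mul]; nlinarith
  have hscale (y : ℂ) : AnalyticAt ℂ (fun y : ℂ => (ρ : ℂ) * y) y := by fun_prop
  have han (y : ℂ) (hy : 0 < y.re) : AnalyticAt ℂ
      (fun y => halfFactor ω * ((csq y)⁻¹ * halfCut (ρ * y))) y :=
    analyticAt_const.mul (((csq_analyticAt (Or.inl hy)).inv (csq_ne_zero y)).mul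
      ((halfCut_analyticAt (hdom y hy)).comp (hscale y)))
  refine isAlienPlus_zero_of_analyticAt hω (borelConvergent_half_phiSeries he)
    (f := fun y => halfFactor ω * ((csq y)⁻¹ * halfCut (ρ * y))) ?_
  have hpos : 0 < |ρ| := abs_pos.2 hρ.ne
  filter_upwards [eventually_small (lt_min one_pos (one_div_pos.2 hpos))] with η ⟨h0, h1⟩
  refine ⟨fun s hs => han _ ?_, fun s _ => han _ ?_, ?_⟩
  · rw [rightPath_re]; linarith [hs.1]
  · have := abs_re_sub_one_le (clockwiseLoop 1 η s)
    rw [norm_clockwiseLoop h0] at this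
    linarith [(abs_le.1 this).1, min_le_left 1 (1 / |ρ|)]
  · filter_upwards [norm_lt_of_near h0 (h1.trans_le (min_le_right _ _))] with y hy
    have hy0 : y ≠ 0 := by rintro rfl; simp at hy
    rw [borelGerm_half_phiSeries hω e hy0, halfCut_eq_hgHalf (norm_mul_lt_one hpos hy.1 rfl),
      ← heω]
    ring_nf

/-- Strictly between its ends the path runs below the real axis and so avoids the upward cut at 1.
Only the two real end points need to be kept away from 1, which is what the two inequations say. -/
theorem rightPath_mem {ρ η : ℝ} (hρ : 0 < ρ) (h0 : 0 < η) (h1 : ρ * η ≠ 1)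
    (h2 : ρ * (1 + η) ≠ 1) {s : ℝ} (hs : s ∈ Icc (0 : ℝ) 1) :
    (ρ : ℂ) * rightPath 1 η s ∈ rightDom := by
  refine mem_rightDom ?_ ?_
  · rw [re_ofReal_mul, rightPath_re]
    have := hs.1
    positivity
  · rw [re_ofReal_mul, im_ofReal_mul, rightPath_re, rightPath_im]
    rcases hs.1.eq_or_lt with rfl | hs0
    · left; rwa [add_zero]
    rcases hs.2.eq_or_lt with rfl | hs1
    · left; rwa [add_comm]
    · right
      have : 0 < Real.sin (Real.pi * s) :=
        Real.sin_pos_of_pos_of_lt_pi (by positivity) (by nlinarith [Real.pi_pos])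
      have : 0 < ρ * (η * Real.sin (Real.pi * s)) := by positivity
      linarith

/-- The alien operators at the regular points of the singular ray vanish. -/
theorem isAlienPlus_half_regular {e ω : ℂ} (he : ‖e‖ = 1) (hω : ω ≠ 0)
    {ρ : ℝ} (hρ : 0 < ρ) (hρ1 : ρ ≠ 1) (heω : e * (3 * ω / 4) = ρ) :
    IsAlienPlus (1 / 2) ω (phiSeries e) 0 := by
  have hscale (y : ℂ) : AnalyticAt ℂ (fun y : ℂ => (ρ : ℂ) * y) y := by fun_prop
  have han (y : ℂ) (hy : 0 < y.re) (hd : (ρ : ℂ) * y ∈ rightDom) : AnalyticAt ℂ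
      (fun y => halfFactor ω * ((csq y)⁻¹ * halfRight (ρ * y))) y :=
    analyticAt_const.mul (((csq_analyticAt (Or.inl hy)).inv (csq_ne_zero y)).mul
      ((halfRight_analyticAt hd).comp (hscale y)))
  refine isAlienPlus_zero_of_analyticAt hω (borelConvergent_half_phiSeries he)
    (f := fun y => halfFactor ω * ((csq y)⁻¹ * halfRight (ρ * y))) ?_
  -- For η below |1 - ρ|/ρ neither the end point nor the scaled loop around ω reaches the vertical
  -- line through 1.
  have hd1 : 0 < |1 - ρ| := abs_pos.2 (sub_ne_zero.2 hρ1.symm)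
  filter_upwards [eventually_small (lt_min (lt_min one_pos (one_div_pos.2 hρ))
    (div_pos hd1 hρ))] with η ⟨h0, h1⟩
  obtain ⟨h1, h3⟩ := lt_min_iff.1 h1
  obtain ⟨h1, h2⟩ := lt_min_iff.1 h1
  have h2' : ρ * η < 1 := by rwa [lt_div_iff₀ hρ, mul_comm] at h2
  have h3' : ρ * η < |1 - ρ| := by rwa [lt_div_iff₀ hρ, mul_comm] at h3
  refine ⟨fun s hs => han _ ?_ (rightPath_mem hρ h0 h2'.ne ?_ hs), fun s _ => ?_, ?_⟩
  · rw [rightPath_re]; linarith [hs.1]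
  · intro h
    have : 1 - ρ = ρ * η := by linarith
    rw [this, abs_of_pos (by positivity)] at h3'
    exact lt_irrefl _ h3'
  · have h4 := abs_re_sub_one_le (clockwiseLoop 1 η s)
    rw [norm_clockwiseLoop h0] at h4
    have hre : 0 < (clockwiseLoop 1 η s).re := by linarith [(abs_le.1 h4).1]
    refine han _ hre (mem_rightDom ?_ (Or.inl ?_))
    · rw [re_ofReal_mul]; positivity
    · rw [re_ofReal_mul]
      intro h
      have : |1 - ρ| ≤ ρ * η := by
        have e : 1 - ρ = ρ * ((clockwiseLoop 1 η s).re - 1) := by linarith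
        rw [e, abs_mul, abs_of_pos hρ]
        exact mul_le_mul_of_nonneg_left h4 hρ.le
      linarith
  · filter_upwards [norm_lt_of_near h0 h2] with y hy
    have hy0 : y ≠ 0 := by rintro rfl; simp at hy
    have hs : (ρ : ℂ) * y ∈ slitPlane := Or.inl (by rw [re_ofReal_mul]; exact mul_pos hρ hy.2)
    rw [borelGerm_half_phiSeries hω e hy0,
      halfRight_eq_hgHalf hs (norm_mul_lt_one hρ hy.1 (abs_of_pos hρ)), ← heω]
    ring_nf

/-- A path that passes below 1 carries 1 - y through the upper half plane, so behind 1 its argument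
has grown by π. -/
theorem eventually_logR {η : ℝ} (h0 : 0 < η) :
    ∀ᶠ y in 𝓝 (1 + η : ℂ), logR (1 - y) = log (y - 1) + Real.pi * I := by
  have hc : ContinuousAt (fun y : ℂ => (y - 1).re) (1 + η) := by fun_prop
  filter_upwards [hc.eventually (lt_mem_nhds (by simpa using h0 : 0 < ((1 + η : ℂ) - 1).re))]
    with y hy
  have hy0 : y - 1 ≠ 0 := by intro h; rw [h] at hy; simp at hy
  have harg := abs_lt.1 (abs_arg_lt_pi_div_two_iff.2 (Or.inl hy : 0 < (y - 1).re ∨ y - 1 = 0))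
  rw [logR, show -I * (1 - y) = I * (y - 1) by ring, log_mul I_ne_zero hy0, log_I]
  · ring
  · rw [arg_I]
    constructor <;> linarith [harg.1, harg.2, Real.pi_pos]

/-- The alien operator at the singular point, `α = 1`. -/
theorem isAlienPlus_one_singular {e ω : ℂ} (he : ‖e‖ = 1) (heω : e * (3 * ω / 4) = 1) :
    IsAlienPlus 1 ω (phiSeries e) (-I • phiSeries (-e)) := by
  have hω : ω ≠ 0 := by rintro rfl; simp at heω
  obtain ⟨r, H, hr, hr1, hH, hlog⟩ := oneCut_log
  refine isAlienPlus_of_unit hω (borelConvergent_one_phiSeries he)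
    ((borelConvergent_one_phiSeries (by rwa [norm_neg])).smul _) ?_
  have hHa (y : ℂ) (hy : ‖y - 1‖ < r) : AnalyticAt ℂ H y :=
    hH.analyticAt (Metric.isOpen_ball.mem_nhds (by rwa [Metric.mem_ball, dist_eq_norm]))
  have hua (y : ℂ) (hy : ‖y - 1‖ < r) :
      AnalyticAt ℂ (fun y => -(1 / (2 * Real.pi)) * hgOne (1 - y)) y := by
    have h1 : ‖1 - y‖ < 1 := by rw [norm_sub_rev]; linarith
    have : AnalyticAt ℂ hgOne (1 - y) :=
      (psum_differentiableOn (hgC_polyBounded half_le_one)).analyticAt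
        (Metric.isOpen_ball.mem_nhds (mem_ball_zero_iff.2 h1))
    exact analyticAt_const.mul (this.comp (f := fun y => 1 - y) (by fun_prop))
  have hla (y : ℂ) (hy : -I * (1 - y) ∈ slitPlane) : AnalyticAt ℂ (fun y => logR (1 - y)) y := by
    have h1 : AnalyticAt ℂ (fun y => -I * (1 - y)) y := by fun_prop
    exact (h1.clog hy).add analyticAt_const
  -- On the last stretch s ≥ 1 - η the path stays within 2η < r of 1, inside the disc of the
  -- logarithmic formula. There `oneCut` is exchanged for the formula with `logR`, which extends
  -- across the cut from below.
  filter_upwards [eventually_small (by positivity : 0 < r / 2)] with η ⟨h0, h1⟩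
  have hη1 : η < 1 := by linarith
  have hsin : 0 < Real.sin (Real.pi * (1 - η)) :=
    Real.sin_pos_of_pos_of_lt_pi (by nlinarith [Real.pi_pos]) (by nlinarith [Real.pi_pos])
  set g : ℂ → ℂ := fun y => H y + -(1 / (2 * Real.pi)) * hgOne (1 - y) * logR (1 - y) with hg
  have hnear (s : ℝ) (hs : s ∈ Icc (1 - η) 1) : ‖rightPath 1 η s - 1‖ < r := by
    have hle := norm_le_abs_re_add_abs_im (rightPath 1 η s - 1)
    rw [sub_re, sub_im, rightPath_re, rightPath_im, one_re, one_im, sub_zero, abs_neg, abs_mul,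
      abs_of_pos h0, abs_of_nonneg (by linarith [hs.1] : 0 ≤ η + s - 1)] at hle
    have := mul_le_of_le_one_right h0.le (Real.abs_sin_le_one (Real.pi * s))
    linarith [hs.2]
  refine ⟨g, fun y => H y + -(1 / (2 * Real.pi)) * hgOne (1 - y) *
    ((fun z => z + Real.pi * I) (log (y - 1) - 2 * Real.pi * I)), ?_, ?_, ?_⟩
  · have hglue : ContinuesAlong (rightPath 1 η) oneCut g := by
      refine continuesAlong_glue (continuous_rightPath η) (s₀ := 1 - η) (by linarith) (by linarith)
        (fun s hs => oneCut_analyticAt (mem_cutDom.2 ?_)) (fun s hs => ?_) ?_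
      · rw [rightPath_re, rightPath_im]
        rcases hs.2.eq_or_lt with rfl | hs1
        · right
          have : 0 < η * Real.sin (Real.pi * (1 - η)) := by positivity
          linarith
        · left; linarith
      · have hm := rightPath_mem one_pos h0 (by linarith) (by linarith : 1 * (1 + η) ≠ 1)
          ⟨by linarith [hs.1], hs.2⟩
        rw [ofReal_one, one_mul] at hm
        exact (hHa _ (hnear s hs)).add ((hua _ (hnear s hs)).mul (hla _ hm.2))
      · have hopen : IsOpen {y : ℂ | y.im < 0 ∧ ‖y - 1‖ < r} :=
          (isOpen_lt continuous_im continuous_const).inter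
            (isOpen_lt (continuous_id.sub continuous_const).norm continuous_const)
        have hmem : rightPath 1 η (1 - η) ∈ {y : ℂ | y.im < 0 ∧ ‖y - 1‖ < r} := by
          refine ⟨?_, hnear _ ⟨le_rfl, by linarith⟩⟩
          rw [rightPath_im]
          have : 0 < η * Real.sin (Real.pi * (1 - η)) := by positivity
          linarith
        filter_upwards [hopen.mem_nhds hmem] with y hy
        have him : 0 < (1 - y).im := by simpa using hy.1
        rw [hlog y ⟨by rw [Metric.mem_ball, dist_eq_norm]; exact hy.2,
          mem_cutDom.2 (Or.inr hy.1.ne)⟩, hg]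
        simp only
        rw [logR_eq_log (Or.inr him)]
        ring
    obtain ⟨F, f1, f2, f3, f4⟩ := hglue
    refine ⟨F, f1, f2, f3.trans ?_, f4⟩
    rw [rightPath_zero]
    filter_upwards [norm_lt_of_near h0 hη1] with y hy
    rw [borelGerm_one_phiSeries, oneCut_eq_hgOne hy.1,
      show e * (3 * (ω * y) / 4) = e * (3 * ω / 4) * y by ring, heω, one_mul]
  · refine continuesAlong_clockwiseLoop h0 (fun y hy => hHa y (by linarith))
      (fun y hy => hua y (by linarith)) (κ := fun z => z + Real.pi * I) (by fun_prop) ?_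
    filter_upwards [eventually_logR h0] with y hy
    simp only [hg, hy]
  -- The loop lowers the logarithm by 2πi, so the variation is 2πi times the coefficient -1/(2π),
  -- that is -i.
  · filter_upwards [eventually_logR h0] with y hy
    rw [borelGerm_smul, borelGerm_one_phiSeries,
      show -e * (3 * (ω * (y - 1)) / 4) = e * (3 * ω / 4) * (1 - y) by ring, heω, one_mul]
    simp only [hg, hy]
    have hpi : (Real.pi : ℂ) ≠ 0 := ofReal_ne_zero.2 Real.pi_ne_zero
    field_simp
    ring

/-- The alien operator at the singular point, `α = 1/2`. -/
theorem isAlienPlus_half_singular {e ω : ℂ} (he : ‖e‖ = 1) (heω : e * (3 * ω / 4) = 1) :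
    IsAlienPlus (1 / 2) ω (phiSeries e) (-I • phiSeries (-e)) := by
  have hω : ω ≠ 0 := by rintro rfl; simp at heω
  refine isAlienPlus_of_unit hω (borelConvergent_half_phiSeries he)
    ((borelConvergent_half_phiSeries (by rwa [norm_neg])).smul _) ?_
  have hFa {a : ℕ → ℂ} (ha : PolyBounded a) (y : ℂ) (hy : ‖y - 1‖ < 1) :
      AnalyticAt ℂ (fun y => psum a (1 - y)) y := by
    have h1 : ‖1 - y‖ < 1 := by rwa [norm_sub_rev]
    have : AnalyticAt ℂ (psum a) (1 - y) :=
      (psum_differentiableOn ha).analyticAt (Metric.isOpen_ball.mem_nhds (mem_ball_zero_iff.2 h1))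
    exact this.comp (f := fun y => 1 - y) (by fun_prop)
  have hre (y : ℂ) (hy : ‖y - 1‖ < 1) : 0 < y.re := by
    linarith [(abs_le.1 (abs_re_sub_one_le y)).1]
  -- A collects the part that is unchanged by the loop, and B is the coefficient of the inverse
  -- square root. No gluing is needed here, because `halfRight` is holomorphic along the entire
  -- path.
  set A : ℂ → ℂ := fun y => halfFactor ω * ((csq y)⁻¹ *
    (3 * Real.sqrt 3 / 4 * (hgHalf (1 - y) - 2 * y * hgHalf' (1 - y)))) with hA
  set B : ℂ → ℂ := fun y => halfFactor ω * (-I / 2 * hgHalf (1 - y)) with hB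
  set g : ℂ → ℂ := fun y => halfFactor ω * ((csq y)⁻¹ * halfRight y) with hg
  filter_upwards [eventually_small one_pos] with η ⟨h0, h1⟩
  have hnear : ∀ᶠ y in 𝓝 (1 + η : ℂ), ‖1 - y‖ < 1 ∧ 1 < y.re := by
    have c1 : ContinuousAt (fun y : ℂ => ‖1 - y‖) (1 + η) := by fun_prop
    have c2 : ContinuousAt (fun y : ℂ => y.re) (1 + η) := by fun_prop
    refine (c1.eventually (gt_mem_nhds ?_)).and (c2.eventually (lt_mem_nhds ?_))
    · simpa [abs_of_pos h0] using h1
    · simpa using h0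
  have hroot {y : ℂ} (hy : logR (1 - y) = log (y - 1) + Real.pi * I) :
      (rootR (1 - y))⁻¹ = -I * exp (-log (y - 1) / 2) := by
    have e1 : exp (-(Real.pi / 2 * I)) = -I := by
      rw [exp_neg, exp_pi_div_two_mul_I, inv_I]
    rw [rootR, ← exp_neg, hy, ← e1, ← exp_add]
    congr 1; ring
  have hgloc : g =ᶠ[𝓝 (1 + η : ℂ)] fun y => A y + B y * exp (-log (y - 1) / 2) := by
    filter_upwards [hnear, eventually_logR h0] with y hy hl
    have hd : y ∈ rightDom := mem_rightDom (by linarith [hy.2]) (Or.inl hy.2.ne')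
    simp only [hg, hA, hB]
    rw [halfRight_near_one hd hy.1, div_eq_mul_inv _ (rootR (1 - y)), hroot hl]
    have := csq_ne_zero y
    field_simp
    ring
  refine ⟨g, fun y => A y + B y * (fun z => exp (-z / 2)) (log (y - 1) - 2 * Real.pi * I),
    ?_, ?_, ?_⟩
  · refine continuesAlong_of_analyticAt (h := g) (fun s hs => ?_) ?_ EventuallyEq.rfl
    · have hm := rightPath_mem one_pos h0 (by linarith) (by linarith : 1 * (1 + η) ≠ 1) hs
      rw [ofReal_one, one_mul] at hm
      exact analyticAt_const.mul (((csq_analyticAt hm.1).inv (csq_ne_zero _)).mul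
        (halfRight_analyticAt hm))
    · rw [rightPath_zero]
      filter_upwards [norm_lt_of_near h0 h1] with y hy
      have hy0 : y ≠ 0 := by rintro rfl; simp at hy
      rw [borelGerm_half_phiSeries hω e hy0, hg]
      simp only
      rw [halfRight_eq_hgHalf (Or.inl hy.2) hy.1,
        show e * (3 * (ω * y) / 4) = e * (3 * ω / 4) * y by ring, heω, one_mul]
  · refine continuesAlong_clockwiseLoop h0 (fun y hy => ?_) (fun y hy => ?_)
      (κ := fun z => exp (-z / 2)) (by fun_prop) hgloc
    · have hy1 : ‖y - 1‖ < 1 := by linarith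
      exact analyticAt_const.mul (((csq_analyticAt (Or.inl (hre y hy1))).inv
        (csq_ne_zero _)).mul (analyticAt_const.mul
          ((hFa (hgC_polyBounded half_le_half) y hy1).sub
            ((analyticAt_const.mul analyticAt_id).mul
              (hFa (hgC_polyBounded half_le_half).dcoef y hy1)))))
    · have hy1 : ‖y - 1‖ < 1 := by linarith
      exact analyticAt_const.mul (analyticAt_const.mul
        (hFa (hgC_polyBounded half_le_half) y hy1))
  · filter_upwards [hgloc, hnear] with y hy hn
    have hy0 : y - 1 ≠ 0 := by
      intro h
      have := hn.2
      rw [sub_eq_zero.1 h] at this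
      simp at this
    rw [borelGerm_smul, borelGerm_half_phiSeries hω _ hy0,
      show -e * (3 * (ω * (y - 1)) / 4) = e * (3 * ω / 4) * (1 - y) by ring, heω, one_mul, hy]
    -- The inverse square root changes sign, so the variation is twice its term.
    have e1 : exp (-(log (y - 1) - 2 * Real.pi * I) / 2) = -exp (-log (y - 1) / 2) := by
      rw [show -(log (y - 1) - 2 * Real.pi * I) / 2 = -log (y - 1) / 2 + Real.pi * I by ring,
        exp_add, exp_pi_mul_I]
      ring
    have e2 : (csq (y - 1))⁻¹ = exp (-log (y - 1) / 2) := by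
      rw [csq, ← exp_neg]; congr 1; ring
    simp only [e1, e2, hB]
    ring

/-! ### The alien operators and the Stokes automorphism of the Airy series -/

theorem alien_phiPlus : IsAlienPlus 1 (4 / 3) airyPhiPlus (-Complex.I • airyPhiMinus) := by
  rw [airyPhiPlus_eq, airyPhiMinus_eq]
  exact isAlienPlus_one_singular (by simp) (by norm_num)

theorem alien_phiMinus : IsAlienPlus 1 (-(4 / 3)) airyPhiMinus (-Complex.I • airyPhiPlus) := by
  have := isAlienPlus_one_singular (e := -1) (ω := -(4 / 3)) (by simp) (by norm_num)
  rwa [neg_neg, ← airyPhiPlus_eq] at this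

theorem alien_phiPlus_zero : IsAlienPlus 1 (-(4 / 3)) airyPhiPlus 0 := by
  rw [airyPhiPlus_eq]
  exact isAlienPlus_one_opposite (by simp) (by norm_num) (ρ := -1) (by norm_num) (by norm_num)

theorem alien_phiMinus_zero : IsAlienPlus 1 (4 / 3) airyPhiMinus 0 := by
  rw [airyPhiMinus_eq]
  exact isAlienPlus_one_opposite (by simp) (by norm_num) (ρ := -1) (by norm_num) (by norm_num)

theorem airyPsi_one : airyPsi 1 = (-(Real.sqrt Real.pi : ℂ)) • phiSeries 1 := by
  rw [← airyPhiPlus_eq]; rfl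

theorem airyPsi_zero : airyPsi 0 = (-Complex.I * (Real.sqrt Real.pi : ℂ)) • phiSeries (-1) := rfl

theorem airyS_crit_zero : airyS (airyCrit 0) = 2 / 3 := by
  simp [airyS, airyCrit]; norm_num

theorem airyS_crit_one : airyS (airyCrit 1) = -(2 / 3) := by
  simp [airyS, airyCrit]; norm_num

theorem airyI_zero : airyI 0 = Finsupp.single (2 / 3) (airyPsi 0) := by
  rw [airyI, airyS_crit_zero]

theorem airyI_one : airyI 1 = Finsupp.single (-(2 / 3)) (airyPsi 1) := by
  rw [airyI, airyS_crit_one]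

theorem isAlienPlus_zero_zero (α : ℝ) {ω : ℂ} (hω : ω ≠ 0) : IsAlienPlus α ω 0 0 :=
  isAlienPlus_zero_of_analyticAt hω (borelConvergent_zero α) (f := fun _ => 0)
    (Eventually.of_forall fun _ => ⟨fun _ _ => analyticAt_const, fun _ _ => analyticAt_const,
      Eventually.of_forall fun _ => (borelGerm_zero α ω _).symm⟩)

theorem isPointedAlienPlus_single {ω : ℂ} (hω : ω ≠ 0) {A : ℂ} {a b : PowerSeries ℂ}
    (h : IsAlienPlus (1 / 2) ω a b) :
    IsPointedAlienPlus ω (Finsupp.single A a) (Finsupp.single (A + ω) b) := by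
  intro B
  by_cases hB : A = B
  · subst hB
    simpa using h
  · rw [Finsupp.single_eq_of_ne' hB, Finsupp.single_eq_of_ne' fun h => hB (by simpa using h)]
    exact isAlienPlus_zero_zero _ hω

theorem isPointedAlienPlus_single_zero {ω : ℂ} (hω : ω ≠ 0) {A : ℂ} {a : PowerSeries ℂ}
    (h : IsAlienPlus (1 / 2) ω a 0) : IsPointedAlienPlus ω (Finsupp.single A a) 0 := by
  have := isPointedAlienPlus_single (A := A) hω h
  rwa [Finsupp.single_zero] at this

/-- The exponents match as -2/3 + 4/3 = 2/3, and the sign comes from the prefactors: (-√π)(-i) =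
-(-i√π). -/
theorem pointedAlien_I_one : IsPointedAlienPlus (4 / 3) (airyI 1) (-airyI 0) := by
  have h := (isAlienPlus_half_singular (e := 1) (ω := 4 / 3) (by simp) (by norm_num)).smul
    (-(Real.sqrt Real.pi : ℂ))
  have h2 := isPointedAlienPlus_single (A := -(2 / 3)) (by norm_num) h
  rw [show (-(2 / 3) : ℂ) + 4 / 3 = 2 / 3 by norm_num, smul_smul,
    show -(Real.sqrt Real.pi : ℂ) * -I = -(-I * (Real.sqrt Real.pi : ℂ)) by ring, neg_smul (-I * _),
    Finsupp.single_neg] at h2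
  rwa [airyI_one, airyI_zero, airyPsi_one, airyPsi_zero]

/-- Here the prefactors give (-i√π)(-i) = -√π, with no sign left over. -/
theorem pointedAlien_I_zero : IsPointedAlienPlus (-(4 / 3)) (airyI 0) (airyI 1) := by
  have h := (isAlienPlus_half_singular (e := -1) (ω := -(4 / 3)) (by simp) (by norm_num)).smul
    (-Complex.I * (Real.sqrt Real.pi : ℂ))
  have h2 := isPointedAlienPlus_single (A := 2 / 3) (by norm_num) h
  rw [show (2 / 3 : ℂ) + -(4 / 3) = -(2 / 3) by norm_num, smul_smul, neg_neg,
    show -I * (Real.sqrt Real.pi : ℂ) * -I = -(Real.sqrt Real.pi : ℂ) by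
      linear_combination (Real.sqrt Real.pi : ℂ) * I_sq] at h2
  rwa [airyI_one, airyI_zero, airyPsi_one, airyPsi_zero]

theorem pointedAlien_I_one_zero : IsPointedAlienPlus (-(4 / 3)) (airyI 1) 0 := by
  have h := (isAlienPlus_half_opposite (e := 1) (ω := -(4 / 3)) (by simp) (by norm_num)
    (ρ := -1) (by norm_num) (by norm_num)).smul (-(Real.sqrt Real.pi : ℂ))
  rw [smul_zero] at h
  rw [airyI_one, airyPsi_one]
  exact isPointedAlienPlus_single_zero (by norm_num) h

theorem pointedAlien_I_zero_of_pos {t : ℝ} (ht : 0 < t) : IsPointedAlienPlus t (airyI 0) 0 := by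
  have h := (isAlienPlus_half_opposite (e := -1) (ω := t) (by simp)
    (ofReal_ne_zero.2 ht.ne') (ρ := -(3 * t / 4)) (by linarith) (by push_cast; ring)).smul
      (-Complex.I * (Real.sqrt Real.pi : ℂ))
  rw [smul_zero] at h
  rw [airyI_zero, airyPsi_zero]
  exact isPointedAlienPlus_single_zero (ofReal_ne_zero.2 ht.ne') h

/-- Every ω > 0 enters the Stokes automorphism. Beyond 4/3 the path has passed the singularity on
its right, and the continued function is regular there. -/
theorem pointedAlien_I_one_of_pos {t : ℝ} (ht : 0 < t) (ht1 : t ≠ 4 / 3) :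
    IsPointedAlienPlus t (airyI 1) 0 := by
  have h := (isAlienPlus_half_regular (e := 1) (ω := t) (by simp)
    (ofReal_ne_zero.2 ht.ne') (ρ := 3 * t / 4) (by linarith)
    (fun h => ht1 (by linarith)) (by push_cast; ring)).smul (-(Real.sqrt Real.pi : ℂ))
  rw [smul_zero] at h
  rw [airyI_one, airyPsi_one]
  exact isPointedAlienPlus_single_zero (ofReal_ne_zero.2 ht.ne') h

theorem airy_stokes (j : Fin 2) :
    IsStokesPlus (borelRay 0) (airyI j) (∑ i : Fin 2, airyStokesMatrix i j • airyI i) := by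
  have hray : ∀ ω ∈ borelRay 0, ∃ t : ℝ, 0 < t ∧ ω = t := by
    rintro ω ⟨t, ht, rfl⟩
    exact ⟨t, ht, by simp⟩
  fin_cases j
  · refine ⟨fun _ => 0, fun ω hω => ?_, fun A => ⟨?_, ?_⟩⟩
    · obtain ⟨t, ht, rfl⟩ := hray ω hω
      exact pointedAlien_I_zero_of_pos ht
    · simp
    · simp [airyStokesMatrix]
  · classical
    have h43 : (4 / 3 : ℂ) ∈ borelRay 0 := ⟨4 / 3, by norm_num, by simp⟩
    refine ⟨fun ω => if ω = 4 / 3 then -airyI 0 else 0, fun ω hω => ?_, fun A => ⟨?_, ?_⟩⟩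
    · by_cases h : ω = 4 / 3
      · simp only [if_pos h]
        rw [h]
        exact pointedAlien_I_one
      · simp only [if_neg h]
        obtain ⟨t, ht, rfl⟩ := hray ω hω
        exact pointedAlien_I_one_of_pos ht fun h' => h (by rw [h']; push_cast; rfl)
    · refine (finite_singleton (4 / 3 : ℂ)).subset fun ω hω => ?_
      by_contra h
      have h' : ω ≠ 4 / 3 := h
      exact hω.2 (by simp [h'])
    · rw [finsum_eq_single _ (4 / 3 : ℂ) fun ω hω => by simp [hω], finsum_eq_if, if_pos h43]
      simp [airyStokesMatrix]
      ring

/-! ### The negative gradient flow -/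

theorem hasDerivAt_re_comp {f : ℝ → ℂ} {f' : ℂ} {t : ℝ} (h : HasDerivAt f f' t) :
    HasDerivAt (fun t => (f t).re) f'.re t := reCLM.hasFDerivAt.comp_hasDerivAt t h

theorem hasDerivAt_im_comp {f : ℝ → ℂ} {f' : ℂ} {t : ℝ} (h : HasDerivAt f f' t) :
    HasDerivAt (fun t => (f t).im) f'.im t := imCLM.hasFDerivAt.comp_hasDerivAt t h

theorem hasDerivWithinAt_im_comp {f : ℝ → ℂ} {f' : ℂ} {t : ℝ} {u : Set ℝ}
    (h : HasDerivWithinAt f f' u t) :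
    HasDerivWithinAt (fun t => (f t).im) f'.im u t :=
  imCLM.hasFDerivAt.comp_hasDerivWithinAt t h

theorem airyS_hasDerivAt (z : ℂ) : HasDerivAt airyS (z ^ 2 - 1) z := by
  unfold airyS
  refine (((hasDerivAt_pow 3 z).div_const 3).sub (hasDerivAt_id z)).congr_deriv ?_
  push_cast; ring

theorem deriv_airyS (z : ℂ) : deriv airyS z = z ^ 2 - 1 := (airyS_hasDerivAt z).deriv

theorem negGradient_airyS (θ : ℝ) (z : ℂ) :
    negGradient airyS θ z = -(starRingEnd ℂ) (exp (-(θ : ℂ) * I) * (z ^ 2 - 1)) := by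
  rw [negGradient, deriv_airyS]

theorem norm_exp_neg_mul_I (θ : ℝ) : ‖exp (-(θ : ℂ) * I)‖ = 1 := by
  rw [← ofReal_neg, norm_exp_ofReal_mul_I]

/-- Along a trajectory `e^{-iθ} S` decreases with speed `‖S'‖²`. -/
theorem energy_hasDerivWithinAt {z : ℝ → ℂ} {θ s : ℝ} {t : Set ℝ}
    (h : HasDerivWithinAt z (negGradient airyS θ (z s)) t s) :
    HasDerivWithinAt (fun s => exp (-(θ : ℂ) * I) * airyS (z s))
      ((-(‖z s ^ 2 - 1‖ ^ 2) : ℝ) : ℂ) t s := by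
  refine (((airyS_hasDerivAt (z s)).comp_hasDerivWithinAt s h).const_mul _).congr_deriv ?_
  rw [negGradient_airyS, ← mul_assoc, mul_neg, mul_conj, normSq_eq_norm_sq, norm_mul,
    norm_exp_neg_mul_I, one_mul]
  push_cast; rfl

/-! ### The connecting trajectories at phase `0` -/

theorem tendsto_tanh_atTop : Tendsto Real.tanh atTop (𝓝 1) := by
  have h : Tendsto (fun s : ℝ => Real.exp (-(2 * s))) atTop (𝓝 0) :=
    Real.tendsto_exp_neg_atTop_nhds_zero.comp (tendsto_id.const_mul_atTop two_pos)
  have h2 := (h.const_sub 1).div (h.const_add 1) (by norm_num)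
  simp only [sub_zero, add_zero, div_one] at h2
  refine h2.congr fun s => ?_
  have e : Real.exp (-(2 * s)) = Real.exp (-s) ^ 2 := by
    rw [← Real.exp_nat_mul]; congr 1; push_cast; ring
  have e2 : Real.exp (-s) * Real.exp s = 1 := by rw [← Real.exp_add]; simp
  have hp := Real.exp_pos s
  have hn := Real.exp_pos (-s)
  rw [Pi.div_apply, Real.tanh_eq_sinh_div_cosh, Real.sinh_eq, Real.cosh_eq, e,
    div_div_div_cancel_right₀ two_ne_zero, div_eq_div_iff (by positivity) (by positivity)]
  linear_combination (-2 * Real.exp (-s)) * e2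

theorem tendsto_tanh_atBot : Tendsto Real.tanh atBot (𝓝 (-1)) := by
  have h := (tendsto_tanh_atTop.comp tendsto_neg_atBot_atTop).neg
  refine h.congr fun s => ?_
  simp

theorem tanh_hasDerivAt (s : ℝ) : HasDerivAt Real.tanh (1 - Real.tanh s ^ 2) s := by
  have hc := (Real.cosh_pos s).ne'
  have h := (Real.hasDerivAt_sinh s).div (Real.hasDerivAt_cosh s) hc
  have hfun : (Real.tanh) = fun s => Real.sinh s / Real.cosh s :=
    funext Real.tanh_eq_sinh_div_cosh
  rw [hfun]
  refine h.congr_deriv ?_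
  field_simp

theorem negGradient_zero (z : ℂ) : negGradient airyS 0 z = 1 - (starRingEnd ℂ) z ^ 2 := by
  rw [negGradient_airyS]; simp

theorem tanh_trajectory (s₀ : ℝ) :
    (∀ s, HasDerivAt (fun s : ℝ => (Real.tanh (s - s₀) : ℂ))
      (negGradient airyS 0 (Real.tanh (s - s₀) : ℂ)) s) ∧
    Tendsto (fun s : ℝ => (Real.tanh (s - s₀) : ℂ)) atBot (𝓝 (airyCrit 0)) ∧
    Tendsto (fun s : ℝ => (Real.tanh (s - s₀) : ℂ)) atTop (𝓝 (airyCrit 1)) := by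
  refine ⟨fun s => ?_, ?_, ?_⟩
  · have h := (tanh_hasDerivAt (s - s₀)).comp s ((hasDerivAt_id s).sub_const s₀)
    rw [negGradient_zero, conj_ofReal]
    refine h.ofReal_comp.congr_deriv ?_
    push_cast; ring
  · have := (continuous_ofReal.tendsto _).comp
      (tendsto_tanh_atBot.comp (tendsto_atBot_add_const_right _ (-s₀) tendsto_id))
    simpa [airyCrit, Function.comp_def, sub_eq_add_neg] using this
  · have := (continuous_ofReal.tendsto _).comp
      (tendsto_tanh_atTop.comp (tendsto_atTop_add_const_right _ (-s₀) tendsto_id))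
    simpa [airyCrit, Function.comp_def, sub_eq_add_neg] using this

/-- Im S is conserved and vanishes at both ends, while Re S decreases from 2/3 to -2/3. Off the real
axis these conditions are incompatible. -/
theorem connecting_im_eq_zero {z : ℝ → ℂ} (h1 : ∀ s, HasDerivAt z (negGradient airyS 0 (z s)) s)
    (h2 : Tendsto z atBot (𝓝 (airyCrit 0))) (h3 : Tendsto z atTop (𝓝 (airyCrit 1))) (s : ℝ) :
    (z s).im = 0 := by
  have hE (s : ℝ) : HasDerivAt (fun s => airyS (z s)) ((-(‖z s ^ 2 - 1‖ ^ 2) : ℝ) : ℂ) s := by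
    have := (energy_hasDerivWithinAt ((h1 s).hasDerivWithinAt (s := univ))).hasDerivAt univ_mem
    simpa using this
  have hScont : Continuous airyS := continuous_iff_continuousAt.2 fun z =>
    (airyS_hasDerivAt z).continuousAt
  have l1 := (hScont.tendsto _).comp h2
  have l2 := (hScont.tendsto _).comp h3
  rw [airyS_crit_zero] at l1
  rw [airyS_crit_one] at l2
  have hre (s : ℝ) : HasDerivAt (fun s => (airyS (z s)).re) (-(‖z s ^ 2 - 1‖ ^ 2)) s := by
    exact (hasDerivAt_re_comp (hE s)).congr_deriv (ofReal_re _)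
  have him (s : ℝ) : HasDerivAt (fun s => (airyS (z s)).im) 0 s := by
    exact (hasDerivAt_im_comp (hE s)).congr_deriv (ofReal_im _)
  have hanti : Antitone fun s => (airyS (z s)).re :=
    antitone_of_deriv_nonpos (fun s => (hre s).differentiableAt) fun s => by
      rw [(hre s).deriv]; simp
  have hup : (airyS (z s)).re ≤ 2 / 3 := by
    have := hanti.ge_of_tendsto ((continuous_re.tendsto _).comp l1) s
    simpa using this
  have hlo : -(2 / 3) ≤ (airyS (z s)).re := by
    have := hanti.le_of_tendsto ((continuous_re.tendsto _).comp l2) s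
    simpa using this
  have hzero : (airyS (z s)).im = 0 := by
    have hc : ∀ t, (airyS (z t)).im = (airyS (z s)).im := fun t =>
      is_const_of_deriv_eq_zero (fun s => (him s).differentiableAt) (fun s => (him s).deriv) t s
    have l3 := (continuous_im.tendsto _).comp l2
    have l4 : Tendsto (fun t => (airyS (z t)).im) atTop (𝓝 (airyS (z s)).im) :=
      tendsto_const_nhds.congr fun t => (hc t).symm
    have := tendsto_nhds_unique l4 l3
    simpa using this
  set x := (z s).re with hx
  set y := (z s).im with hy
  have hz : airyS (z s) = ((x ^ 3 / 3 - x * y ^ 2 - x : ℝ) : ℂ) +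
      ((y * (x ^ 2 - y ^ 2 / 3 - 1) : ℝ) : ℂ) * I := by
    have : z s = x + y * I := (re_add_im (z s)).symm
    rw [this, airyS]
    push_cast
    linear_combination (x * (y : ℂ) ^ 2 + (y : ℂ) ^ 3 * I / 3) * I_sq
  rw [hz] at hup hlo hzero
  simp only [add_re, ofReal_re, re_ofReal_mul, I_re, mul_zero, add_zero] at hup hlo
  simp only [add_im, ofReal_im, im_ofReal_mul, I_im, mul_one, zero_add] at hzero
  -- For y ≠ 0 the equation Im S = 0 is the hyperbola x² - y²/3 = 1, on which Re S = 2x - 8x³/3 and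
  -- |x| > 1. This is below -2/3 for x > 1 and above 2/3 for x < -1.
  by_contra hy0
  have h4 : x ^ 2 - y ^ 2 / 3 - 1 = 0 := (mul_eq_zero.1 hzero).resolve_left hy0
  have hy2 : y ^ 2 = 3 * (x ^ 2 - 1) := by linarith
  have hx1 : 1 < x ^ 2 := by
    have : 0 < y ^ 2 := by positivity
    linarith
  have e : x ^ 3 / 3 - x * y ^ 2 - x = 2 * x - 8 / 3 * x ^ 3 := by rw [hy2]; ring
  rw [e] at hup hlo
  rcases lt_or_ge 0 x with hpos | hneg
  · have : 1 < x := by nlinarith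
    nlinarith [mul_pos (sub_pos.2 this) (by positivity : 0 < 8 * x ^ 2 + 8 * x + 2)]
  · have : x < -1 := by nlinarith
    nlinarith [mul_pos (sub_pos.2 this) (by nlinarith : 0 < 8 * x ^ 2 - 8 * x + 2)]

theorem connecting_iff (z : ℝ → ℂ) :
    ((∀ s, HasDerivAt z (negGradient airyS 0 (z s)) s) ∧
      Tendsto z atBot (𝓝 (airyCrit 0)) ∧ Tendsto z atTop (𝓝 (airyCrit 1))) ↔
    ∃ s₀ : ℝ, ∀ s, z s = (Real.tanh (s - s₀) : ℂ) := by
  constructor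
  · rintro ⟨h1, h2, h3⟩
    have him := connecting_im_eq_zero h1 h2 h3
    set x : ℝ → ℝ := fun s => (z s).re with hx
    have hzx (s : ℝ) : z s = x s := Complex.ext (by simp [hx]) (by simp [him s])
    have hd (s : ℝ) : HasDerivAt x (1 - x s ^ 2) s := by
      have h := hasDerivAt_re_comp (h1 s)
      rw [negGradient_zero, hzx, conj_ofReal, ← ofReal_pow, ← ofReal_one, ← ofReal_sub,
        ofReal_re] at h
      exact h
    have hxc : Continuous x := continuous_iff_continuousAt.2 fun s => (hd s).continuousAt
    have l1 : Tendsto x atBot (𝓝 (-1)) := by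
      simpa [airyCrit, Function.comp_def] using (continuous_re.tendsto _).comp h2
    have l2 : Tendsto x atTop (𝓝 1) := by
      simpa [airyCrit, Function.comp_def] using (continuous_re.tendsto _).comp h3
    -- The real trajectory runs from -1 to 1 and so passes 0; that moment is the translation of
    -- time.
    obtain ⟨s₀, hs₀⟩ : (0 : ℝ) ∈ range x := mem_range_of_exists_le_of_exists_ge hxc
      (l1.eventually (eventually_le_nhds (by norm_num))).exists
      (l2.eventually (eventually_ge_nhds (by norm_num))).exists
    refine ⟨s₀, fun s => ?_⟩
    set τ : ℝ → ℝ := fun s => Real.tanh (s - s₀) with hτ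
    have hτd (s : ℝ) : HasDerivAt τ (1 - τ s ^ 2) s := by
      refine ((tanh_hasDerivAt (s - s₀)).comp s ((hasDerivAt_id s).sub_const s₀)).congr_deriv ?_
      rw [mul_one]
    have hτc : Continuous τ := continuous_iff_continuousAt.2 fun s => (hτd s).continuousAt
    -- Both x and τ solve y' = 1 - y², so (x - τ)' = -(x + τ)(x - τ). With the integrating factor
    -- e^P the difference is constant, and it vanishes at s₀.
    set P : ℝ → ℝ := fun s => ∫ t in (0 : ℝ)..s, (x t + τ t) with hP
    have hPd (s : ℝ) : HasDerivAt P (x s + τ s) s :=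
      ((hxc.add hτc).integral_hasStrictDerivAt 0 s).hasDerivAt
    have hu (s : ℝ) : HasDerivAt (fun s => (x s - τ s) * Real.exp (P s)) 0 s := by
      refine (((hd s).sub (hτd s)).mul (hPd s).exp).congr_deriv ?_
      simp only [Pi.sub_apply]
      ring
    have hc := is_const_of_deriv_eq_zero (fun s => (hu s).differentiableAt)
      (fun s => (hu s).deriv) s s₀
    have h0 : τ s₀ = 0 := by simp [hτ]
    simp only [hs₀, h0, sub_self, zero_mul, mul_eq_zero, (Real.exp_pos _).ne', or_false] at hc
    rw [hzx, sub_eq_zero.1 hc]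
  · rintro ⟨s₀, h⟩
    obtain rfl : z = fun s => (Real.tanh (s - s₀) : ℂ) := funext h
    exact tanh_trajectory s₀

theorem numConnecting_eq_one :
    numConnectingTrajectories airyS 0 (airyCrit 0) (airyCrit 1) = 1 := by
  rw [numConnectingTrajectories, Nat.card_eq_one_iff_unique]
  refine ⟨⟨fun a b => ?_⟩, ⟨Quotient.mk _ ⟨_, tanh_trajectory 0⟩⟩⟩
  induction a using Quotient.inductionOn with | h z => ?_
  induction b using Quotient.inductionOn with | h w => ?_
  obtain ⟨a, ha⟩ := (connecting_iff z.1).1 z.2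
  obtain ⟨b, hb⟩ := (connecting_iff w.1).1 w.2
  refine Quotient.sound ⟨b - a, fun s => ?_⟩
  rw [hb, ha]
  congr 2
  ring

/-! ### Curves in the level lines of the action through a critical point -/

/-- A smooth curve `g` through the critical point `p` along which `S` equals `S(p) + e^{iθ} t²`. -/
structure IsNormalCurve (θ : ℝ) (p : ℂ) (g : ℝ → ℂ) : Prop where
  sin_ne : Real.sin θ ≠ 0
  crit : p ^ 2 = 1
  contDiff : ContDiff ℝ (⊤ : ℕ∞) g
  action : ∀ t, airyS (g t) = airyS p + exp (θ * I) * (t : ℂ) ^ 2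
  base : g 0 = p
  deriv_zero : deriv g 0 ≠ 0
  opposite : ∀ t, g t ^ 2 + g t * g (-t) + g (-t) ^ 2 = 3

namespace IsNormalCurve

variable {θ : ℝ} {p : ℂ} {g : ℝ → ℂ} (hg : IsNormalCurve θ p g)
include hg

theorem hasDerivAt (t : ℝ) : HasDerivAt g (deriv g t) t :=
  (hg.contDiff.differentiable (by simp) t).hasDerivAt

theorem continuous : Continuous g := hg.contDiff.continuous

theorem continuous_deriv : Continuous (deriv g) := hg.contDiff.continuous_deriv (by simp)

theorem deriv_mul (t : ℝ) : deriv g t * (g t ^ 2 - 1) = 2 * exp (θ * I) * t := by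
  have h1 := (airyS_hasDerivAt (g t)).comp t (hg.hasDerivAt t)
  have h2 : HasDerivAt (fun t : ℝ => airyS p + exp (θ * I) * (t : ℂ) ^ 2)
      (exp (θ * I) * (2 * (t : ℂ))) t := by
    refine ((((hasDerivAt_pow 2 (t : ℂ)).comp_ofReal).const_mul (exp (θ * I))).const_add
      (airyS p)).congr_deriv ?_
    push_cast; ring
  have h3 : (airyS ∘ g) = fun t : ℝ => airyS p + exp (θ * I) * (t : ℂ) ^ 2 := funext hg.action
  rw [h3] at h1
  rw [mul_comm, h1.unique h2]
  ring

theorem crit_eq : p = 1 ∨ p = -1 := sq_eq_one_iff.1 hg.crit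

/-- The values of S at ±1 are real, so e^{iθ} t² would be real; since sin θ ≠ 0, this forces t = 0.
Away from its base the curve meets no critical point. -/
theorem eq_zero_of_sq_eq_one {t : ℝ} (h : g t ^ 2 = 1) : t = 0 := by
  have key : ∀ r : ℝ, exp (θ * I) * (t : ℂ) ^ 2 = r → t = 0 := by
    intro r hr
    have := congrArg Complex.im hr
    rw [← ofReal_pow, im_mul_ofReal, exp_ofReal_mul_I_im, ofReal_im] at this
    simpa using (mul_eq_zero.1 this).resolve_left hg.sin_ne
  have ha := hg.action t
  rcases sq_eq_one_iff.1 h with h1 | h1 <;> rcases hg.crit_eq with h2 | h2 <;>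
    rw [h1, h2] at ha <;> simp only [airyS] at ha
  · exact key 0 (by push_cast; linear_combination -ha)
  · exact key (-(4 / 3)) (by push_cast; linear_combination -ha)
  · exact key (4 / 3) (by push_cast; linear_combination -ha)
  · exact key 0 (by push_cast; linear_combination -ha)

theorem deriv_ne_zero (t : ℝ) : deriv g t ≠ 0 := by
  rcases eq_or_ne t 0 with rfl | ht
  · exact hg.deriv_zero
  · intro h
    have := hg.deriv_mul t
    rw [h, zero_mul] at this
    simp [exp_ne_zero, ht] at this

theorem sq_eq_sq {t t' : ℝ} (h : airyS (g t) = airyS (g t')) : t ^ 2 = t' ^ 2 := by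
  rw [hg.action, hg.action] at h
  exact_mod_cast mul_left_cancel₀ (exp_ne_zero _) (add_left_cancel h)

/-- The action determines t², and g(t) = g(-t) turns `opposite` into 3 g(t)² = 3, hence t = 0. -/
theorem injective : Function.Injective g := by
  intro t t' h
  rcases sq_eq_sq_iff_eq_or_eq_neg.1 (hg.sq_eq_sq (congrArg airyS h)) with h1 | h1
  · exact h1
  · have h2 := hg.opposite t'
    rw [← h1, ← h] at h2
    have h3 : g t ^ 2 = 1 := by linear_combination h2 / 3
    have h4 := hg.eq_zero_of_sq_eq_one h3
    rw [h4] at h1 ⊢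
    linarith

/-- The three roots of `S(z) = S(p) + e^{iθ} t²`. -/
theorem root_cases {t : ℝ} {z : ℂ} (h : airyS z = airyS p + exp (θ * I) * (t : ℂ) ^ 2) :
    z = g t ∨ z = g (-t) ∨ z = -(g t + g (-t)) := by
  rw [← hg.action] at h
  -- With a = g(t) and b = g(-t): 3(S(z) - S(a)) = (z - a)(z² + za + a² - 3), and a² + ab + b² = 3
  -- makes the quadratic factor (z - b)(z + a + b).
  have h0 : (z - g t) * ((z - g (-t)) * (z + (g t + g (-t)))) = 0 := by
    simp only [airyS] at h
    linear_combination 3 * h - (z - g t) * hg.opposite t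
  rcases mul_eq_zero.1 h0 with h1 | h1
  · exact Or.inl (sub_eq_zero.1 h1)
  rcases mul_eq_zero.1 h1 with h1 | h1
  · exact Or.inr (Or.inl (sub_eq_zero.1 h1))
  · exact Or.inr (Or.inr (eq_neg_of_add_eq_zero_left h1))

theorem crit_ne_third : p ≠ -(p + p) := by
  intro h
  have h0 : p = 0 := by linear_combination h / 3
  simpa [h0] using hg.crit

/-- A coincidence would mean g(-t) = -2 g(t), hence g(t)² = 1 and t = 0; but at t = 0 the third root
is -2p. -/
theorem ne_third (t : ℝ) : g t ≠ -(g t + g (-t)) := by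
  intro h
  have h1 : g (-t) = -2 * g t := by linear_combination h
  have h2 := hg.opposite t
  rw [h1] at h2
  have h3 := hg.eq_zero_of_sq_eq_one (t := t) (by linear_combination h2 / 3)
  rw [h3, neg_zero, hg.base] at h
  exact hg.crit_ne_third h

/-- Differentiating the action gives e^{-iθ} S'(g) g' = 2t, which is real, so the gradient field is
tangent to the curve and moves the parameter at the rate -2t/‖g'‖². -/
theorem negGradient_eq (t : ℝ) :
    negGradient airyS θ (g t) = ((-(2 * t / ‖deriv g t‖ ^ 2) : ℝ) : ℂ) * deriv g t := by
  have hd := hg.deriv_ne_zero t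
  have hc : (starRingEnd ℂ) (deriv g t) ≠ 0 := (map_ne_zero _).2 hd
  have h1 : exp (-(θ : ℂ) * I) * (g t ^ 2 - 1) = 2 * t / deriv g t := by
    rw [eq_div_iff hd, mul_assoc, mul_comm _ (deriv g t), hg.deriv_mul, ← mul_assoc,
      mul_left_comm, ← Complex.exp_add]
    simp
  rw [negGradient_airyS, h1, map_div₀, map_mul, conj_ofReal, map_ofNat]
  have h2 : ((‖deriv g t‖ ^ 2 : ℝ) : ℂ) = deriv g t * (starRingEnd ℂ) (deriv g t) := by
    rw [mul_conj, normSq_eq_norm_sq]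
  rw [ofReal_neg, ofReal_div, h2]
  push_cast
  field_simp

/-- Points of the curve flow into the critical point. -/
theorem mem_stableManifold (t : ℝ) : g t ∈ stableManifold airyS θ p := by
  -- The parameter equation is solved by t e^{-x(s)}, where x(s) is the inverse of M(x) = ∫ m and m
  -- = ‖g'‖²/2. Clipping x at 0 keeps the argument of g' in a compact set, so that m is bounded
  -- below and M is onto; for s ≥ 0 the clipping has no effect.
  set m : ℝ → ℝ := fun x => ‖deriv g (t * Real.exp (-(max x 0)))‖ ^ 2 / 2 with hm
  have hmc : Continuous m := by
    have := hg.continuous_deriv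
    fun_prop
  have hexp (x : ℝ) : Real.exp (-(max x 0)) ∈ Icc (0 : ℝ) 1 :=
    ⟨(Real.exp_pos _).le, Real.exp_le_one_iff.2 (by simp)⟩
  obtain ⟨c, hc0, hc⟩ : ∃ c > 0, ∀ x, c ≤ m x := by
    have hcont : ContinuousOn (fun u => ‖deriv g (t * u)‖ ^ 2 / 2) (Icc (0 : ℝ) 1) := by
      have := hg.continuous_deriv
      exact Continuous.continuousOn (by fun_prop)
    obtain ⟨u, -, hu⟩ := isCompact_Icc.exists_isMinOn ⟨0, by simp⟩ hcont
    refine ⟨‖deriv g (t * u)‖ ^ 2 / 2, ?_, fun x => hu (hexp x)⟩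
    have := norm_pos_iff.2 (hg.deriv_ne_zero (t * u))
    positivity
  set M : ℝ → ℝ := fun x => ∫ u in (0 : ℝ)..x, m u with hM
  have hMd (x : ℝ) : HasDerivAt M (m x) x := (hmc.integral_hasStrictDerivAt 0 x).hasDerivAt
  have hMc : Continuous M := continuous_iff_continuousAt.2 fun x => (hMd x).continuousAt
  have hMs : StrictMono M := strictMono_of_deriv_pos fun x => by
    rw [(hMd x).deriv]; exact hc0.trans_le (hc x)
  have hM0 : M 0 = 0 := by simp [hM]
  have hmono : Monotone fun x => M x - c * x := by
    refine monotone_of_deriv_nonneg (fun x => ?_) fun x => ?_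
    · exact ((hMd x).sub ((hasDerivAt_id x).const_mul c)).differentiableAt
    · have := ((hMd x).sub ((hasDerivAt_id x).const_mul c)).deriv
      rw [show (fun x => M x - c * x) = (M - fun x => c * id x) from rfl, this]
      linarith [hc x]
  have htop : Tendsto M atTop atTop := by
    refine tendsto_atTop_mono' atTop ?_ (tendsto_id.const_mul_atTop hc0)
    filter_upwards [eventually_ge_atTop 0] with x hx
    have := hmono hx
    simp only [hM0] at this
    simp only [id]; linarith
  have hbot : Tendsto M atBot atBot := by
    refine tendsto_atBot_mono' atBot ?_ (tendsto_id.const_mul_atBot hc0)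
    filter_upwards [eventually_le_atBot 0] with x hx
    have := hmono hx
    simp only [hM0] at this
    simp only [id]; linarith
  have hsurj : Function.Surjective M := hMc.surjective htop hbot
  set e := hMs.orderIsoOfSurjective M hsurj with he
  have heM (s : ℝ) : M (e.symm s) = s := e.apply_symm_apply s
  have he0 : e.symm 0 = 0 := hMs.injective (by rw [heM, hM0])
  have hed (s : ℝ) : HasDerivAt e.symm (m (e.symm s))⁻¹ s :=
    HasDerivAt.of_local_left_inverse e.symm.continuous.continuousAt (hMd _)
      (hc0.trans_le (hc _)).ne' (Eventually.of_forall heM)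
  have hτ (s : ℝ) : HasDerivAt (fun s => t * Real.exp (-(e.symm s)))
      (-(t * Real.exp (-(e.symm s))) / m (e.symm s)) s := by
    refine (((hed s).neg.exp).const_mul t).congr_deriv ?_
    rw [Pi.neg_apply]
    ring
  refine ⟨fun s => g (t * Real.exp (-(e.symm s))), by simp [he0], fun s hs => ?_, ?_⟩
  · refine HasDerivAt.hasDerivWithinAt ?_
    refine ((hg.hasDerivAt _).scomp s (hτ s)).congr_deriv ?_
    have hs0 : 0 ≤ e.symm s := by rw [← he0]; exact e.symm.monotone hs
    rw [hg.negGradient_eq, real_smul]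
    simp only [hm, max_eq_left hs0]
    congr 2
    ring
  · have h1 : Tendsto (fun s => t * Real.exp (-(e.symm s))) atTop (𝓝 (t * 0)) :=
      (Real.tendsto_exp_neg_atTop_nhds_zero.comp e.symm.tendsto_atTop).const_mul t
    rw [mul_zero] at h1
    simpa [hg.base, Function.comp_def] using (hg.continuous.tendsto 0).comp h1

/-- Along a trajectory that ends in `p`, the action is `S(p) + e^{iθ} r²` with `r` real. -/
theorem mem_range_of_mem_stableManifold {z₀ : ℂ} (h : z₀ ∈ stableManifold airyS θ p) :
    z₀ ∈ range g := by
  obtain ⟨z, hz0, hz, hlim⟩ := h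
  have hScont : Continuous airyS := continuous_iff_continuousAt.2 fun z =>
    (airyS_hasDerivAt z).continuousAt
  have hzc : ContinuousOn z (Ici 0) := fun s hs => (hz s hs).continuousWithinAt
  set E : ℝ → ℂ := fun s => exp (-(θ : ℂ) * I) * airyS (z s) with hE
  have hEd (s : ℝ) (hs : s ∈ Ici (0 : ℝ)) := energy_hasDerivWithinAt (hz s hs)
  set E₀ := exp (-(θ : ℂ) * I) * airyS p with hE0
  have hElim : Tendsto E atTop (𝓝 E₀) := ((hScont.tendsto p).comp hlim).const_mul _
  have hint : ∀ s ∈ interior (Ici (0 : ℝ)), HasDerivAt E ((-(‖z s ^ 2 - 1‖ ^ 2) : ℝ) : ℂ) s := by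
    intro s hs
    rw [interior_Ici] at hs
    exact (hEd s (mem_Ici.2 (le_of_lt hs))).hasDerivAt (Ici_mem_nhds hs)
  have hEc : ContinuousOn E (Ici 0) := fun s hs => (hEd s hs).continuousWithinAt
  have hanti : AntitoneOn (fun s => (E s).re) (Ici 0) := by
    refine antitoneOn_of_deriv_nonpos (convex_Ici 0) (continuous_re.comp_continuousOn hEc)
      (fun s hs => (hasDerivAt_re_comp (hint s hs)).differentiableAt.differentiableWithinAt)
      fun s hs => ?_
    rw [(hasDerivAt_re_comp (hint s hs)).deriv, ofReal_re]
    exact neg_nonpos.2 (sq_nonneg _)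
  have him (s : ℝ) (hs : s ∈ Ici (0 : ℝ)) : (E s).im = (E 0).im := by
    have hd : DifferentiableOn ℝ (fun s => (E s).im) (Ici 0) := fun s hs =>
      (hasDerivWithinAt_im_comp (hEd s hs)).differentiableWithinAt
    refine (convex_Ici (0 : ℝ)).is_const_of_fderivWithin_eq_zero hd (fun s hs => ?_) hs (by simp)
    have h1 := hasDerivWithinAt_im_comp (hEd s hs)
    rw [ofReal_im] at h1
    have := h1.hasFDerivWithinAt.fderivWithin (uniqueDiffOn_Ici 0 s hs)
    rw [this]; ext; simp
  have hre (s : ℝ) (hs : s ∈ Ici (0 : ℝ)) : E₀.re ≤ (E s).re := by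
    refine le_of_tendsto ((continuous_re.tendsto _).comp hElim) ?_
    filter_upwards [eventually_ge_atTop s] with u hu
    exact hanti hs (mem_Ici.2 ((mem_Ici.1 hs).trans hu)) hu
  have him0 (s : ℝ) (hs : s ∈ Ici (0 : ℝ)) : (E s).im = E₀.im := by
    rw [him s hs]
    refine tendsto_nhds_unique (tendsto_const_nhds.congr' ?_)
      ((continuous_im.tendsto _).comp hElim)
    filter_upwards [eventually_ge_atTop 0] with u hu using (him u hu).symm
  -- The excess of energy over the limit is real and nonnegative, and its square root plays the role
  -- of the parameter t.
  set r : ℝ → ℝ := fun s => Real.sqrt ((E s).re - E₀.re) with hr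
  have hrc : ContinuousOn r (Ici 0) :=
    Real.continuous_sqrt.comp_continuousOn
      ((continuous_re.comp_continuousOn hEc).sub continuousOn_const)
  have hrlim : Tendsto r atTop (𝓝 0) := by
    have := (Real.continuous_sqrt.tendsto _).comp
      (((continuous_re.tendsto _).comp hElim).sub_const E₀.re)
    simpa [Function.comp_def] using this
  have hact (s : ℝ) (hs : s ∈ Ici (0 : ℝ)) :
      airyS (z s) = airyS p + exp (θ * I) * (r s : ℂ) ^ 2 := by
    have h1 : ((r s : ℝ) : ℂ) ^ 2 = E s - E₀ := by
      rw [← ofReal_pow, hr, Real.sq_sqrt (sub_nonneg.2 (hre s hs))]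
      exact Complex.ext (by simp) (by simp [him0 s hs])
    rw [h1, hE, hE0, ← mul_sub, ← mul_assoc, ← Complex.exp_add]
    simp
  have hcases (s : ℝ) (hs : s ∈ Ici (0 : ℝ)) := hg.root_cases (hact s hs)
  have hc1 : ContinuousOn (fun s => g (r s)) (Ici 0) := hg.continuous.comp_continuousOn hrc
  have hc2 : ContinuousOn (fun s => g (-(r s))) (Ici 0) := hg.continuous.comp_continuousOn hrc.neg
  have hclosed : ∀ {f : ℝ → ℂ}, ContinuousOn f (Ici 0) →
      IsClosed {s : Ici (0 : ℝ) | f s = 0} := by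
    intro f hf
    exact isClosed_eq (continuousOn_iff_continuous_domRestrict.1 hf) continuous_const
  -- U holds the times at which z is on the curve, V those at which z is the third root. They are
  -- closed, disjoint and cover the half line, so one of them is everything.
  set U : Set (Ici (0 : ℝ)) := {s | (z s - g (r s)) * (z s - g (-(r s))) = 0} with hU
  set V : Set (Ici (0 : ℝ)) := {s | z s + (g (r s) + g (-(r s))) = 0} with hV
  have hUc : IsClosed U := hclosed ((hzc.sub hc1).mul (hzc.sub hc2))
  have hVc : IsClosed V := hclosed (hzc.add (hc1.add hc2))
  have hUV : U ∪ V = univ := by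
    refine eq_univ_of_forall fun s => ?_
    rcases hcases s s.2 with h | h | h
    · left; simp [hU, h]
    · left; simp [hU, h]
    · right; rw [hV, mem_ofPred_eq]; rw [h]; ring
  have hdisj : U ∩ V = ∅ := by
    refine eq_empty_of_forall_notMem fun s hs => ?_
    obtain ⟨h1, h2⟩ := hs
    have h3 : z s = -(g (r s) + g (-(r s))) := eq_neg_of_add_eq_zero_left h2
    rcases mul_eq_zero.1 h1 with h4 | h4
    · exact hg.ne_third (r s) ((sub_eq_zero.1 h4).symm.trans h3)
    · refine hg.ne_third (-(r s)) ?_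
      rw [neg_neg, add_comm]
      exact (sub_eq_zero.1 h4).symm.trans h3
  have hpre : IsPreconnected (univ : Set (Ici (0 : ℝ))) := by
    have : PreconnectedSpace (Ici (0 : ℝ)) :=
      Subtype.preconnectedSpace isPreconnected_Ici
    exact isPreconnected_univ
  -- If V were everything, the trajectory would tend to -2p instead of p.
  have h0 : (⟨0, self_mem_Ici⟩ : Ici (0 : ℝ)) ∈ U := by
    by_contra hnot
    have hallV : ∀ s : Ici (0 : ℝ), s ∈ V := by
      intro s
      by_contra hs
      have hsU : s ∈ U := (hUV.symm ▸ mem_univ s : s ∈ U ∪ V).resolve_right hs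
      have h0V := (hUV.symm ▸ mem_univ _ : (⟨0, self_mem_Ici⟩ : Ici (0 : ℝ)) ∈ U ∪ V).resolve_left
        hnot
      obtain ⟨x, hx⟩ := isPreconnected_closed_iff.1 hpre U V hUc hVc hUV.symm.subset
        ⟨s, trivial, hsU⟩ ⟨_, trivial, h0V⟩
      rw [hdisj] at hx
      exact hx.2
    have l1 : Tendsto (fun s => -(g (r s) + g (-(r s)))) atTop (𝓝 (-(p + p))) := by
      have a1 := (hg.continuous.tendsto 0).comp hrlim
      have a2 := (hg.continuous.tendsto (-0)).comp hrlim.neg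
      rw [neg_zero, hg.base] at a2
      rw [hg.base] at a1
      exact (a1.add a2).neg
    refine hg.crit_ne_third (tendsto_nhds_unique hlim (l1.congr' ?_))
    filter_upwards [eventually_ge_atTop 0] with s hs
    exact (eq_neg_of_add_eq_zero_left (hallV ⟨s, hs⟩)).symm
  rcases mul_eq_zero.1 h0 with h | h
  · exact ⟨r 0, by rw [← hz0]; exact (sub_eq_zero.1 h).symm⟩
  · exact ⟨-(r 0), by rw [← hz0]; exact (sub_eq_zero.1 h).symm⟩

theorem range_eq : range g = stableManifold airyS θ p :=
  Subset.antisymm (range_subset_iff.2 hg.mem_stableManifold)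
    fun _ h => hg.mem_range_of_mem_stableManifold h

end IsNormalCurve

/-! ### The canonical parametrization of the thimbles -/

/-- A branch through `p` of the solution `z` of `S(z) = S(p) + ζ²`, when `p² = 1`, `k² = 3p/4`. -/
def sheet (p k ζ : ℂ) : ℂ :=
  p * cos (2 / 3 * asn (k * ζ)) - (Real.sqrt 3 : ℂ) * sin (2 / 3 * asn (k * ζ))

theorem sqrt_three_sq : (Real.sqrt 3 : ℂ) ^ 2 = 3 := by
  rw [← ofReal_pow, Real.sq_sqrt (by norm_num)]; norm_num

theorem sqrt_three_ne : (Real.sqrt 3 : ℂ) ≠ 0 := by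
  intro h; have := sqrt_three_sq; rw [h] at this; norm_num at this

theorem cos_two_of_sin {y w : ℂ} (h : sin y = w) :
    4 * cos (2 / 3 * y) ^ 3 - 3 * cos (2 / 3 * y) = 1 - 2 * w ^ 2 := by
  rw [← Complex.cos_three_mul, ← h, show 3 * (2 / 3 * y) = 2 * y by ring, Complex.cos_two_mul,
    Complex.cos_sq']
  ring

/-- For p = ±1 the branch is 2p cos(u + pπ/3) with u = (2/3) arcsin(kζ). Hence S = -(2/3) p cos 3u,
where cos 3u = 1 - 2k²ζ², and k² = 3p/4 makes the coefficient of ζ² equal to 1. -/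
theorem airyS_sheet {p k ζ : ℂ} (hp : p ^ 2 = 1) (hk : k ^ 2 = 3 / 4 * p)
    (h : k * ζ ∈ asnDom) : airyS (sheet p k ζ) = airyS p + ζ ^ 2 := by
  have h1 := cos_two_of_sin (sin_asn h)
  have h2 := Complex.sin_sq_add_cos_sq (2 / 3 * asn (k * ζ))
  rw [airyS, airyS, sheet]
  set C := cos (2 / 3 * asn (k * ζ))
  set s := sin (2 / 3 * asn (k * ζ))
  set q := (Real.sqrt 3 : ℂ)
  have hq : q ^ 2 = 3 := sqrt_three_sq
  have hp3 : p ^ 3 = p := by rw [pow_succ, hp, one_mul]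
  have e : (p * C - q * s) ^ 3 / 3 - (p * C - q * s) = -(2 / 3) * p * (4 * C ^ 3 - 3 * C) := by
    linear_combination (C ^ 3 / 3) * hp3 - (C ^ 2 * q * s) * hp + (p * C * s ^ 2 - q * s ^ 3 / 3) * hq
      + (3 * p * C - q * s) * h2
  rw [e, h1, mul_pow, hk]
  linear_combination (ζ ^ 2) * hp - (1 / 3) * hp3

theorem sheet_zero (p k : ℂ) : sheet p k 0 = p := by simp [sheet, asn_zero]

theorem sheet_opposite {p k ζ : ℂ} (hp : p ^ 2 = 1) (h : k * ζ ∈ asnDom) :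
    sheet p k ζ ^ 2 + sheet p k ζ * sheet p k (-ζ) + sheet p k (-ζ) ^ 2 = 3 := by
  have h2 := Complex.sin_sq_add_cos_sq (2 / 3 * asn (k * ζ))
  rw [sheet, sheet, mul_neg, asn_neg h, mul_neg, Complex.cos_neg, Complex.sin_neg]
  linear_combination (3 * cos (2 / 3 * asn (k * ζ)) ^ 2) * hp +
    sin (2 / 3 * asn (k * ζ)) ^ 2 * sqrt_three_sq + 3 * h2

/-- The derivative of `sheet`. -/
def sheet' (p k ζ : ℂ) : ℂ :=
  -(2 / 3 * k * (p * sin (2 / 3 * asn (k * ζ)) + (Real.sqrt 3 : ℂ) * cos (2 / 3 * asn (k * ζ))))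
    / csq (1 - (k * ζ) ^ 2)

theorem sheet_hasDerivAt {p k ζ : ℂ} (h : k * ζ ∈ asnDom) :
    HasDerivAt (sheet p k) (sheet' p k ζ) ζ := by
  have h1 : HasDerivAt (fun ζ => 2 / 3 * asn (k * ζ)) (2 / 3 * (1 / csq (1 - (k * ζ) ^ 2) * k)) ζ :=
    ((asn_hasDerivAt h).comp ζ (by simpa using (hasDerivAt_id ζ).const_mul k)).const_mul _
  refine ((h1.ccos.const_mul p).sub (h1.csin.const_mul (Real.sqrt 3 : ℂ))).congr_deriv ?_
  rw [sheet']
  ring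

/-- The sine terms cancel, and what remains is the elementary function of the Borel side. This is
the link between the saddle expansion and the Borel transform. -/
theorem sheet'_add {p k ζ : ℂ} (h : k * ζ ∈ asnDom) :
    sheet' p k ζ + sheet' p k (-ζ) = -(4 / (Real.sqrt 3 : ℂ)) * k * evenPart (k * ζ) := by
  have h0 := csq_ne_zero (1 - (k * ζ) ^ 2)
  have h3 := sqrt_three_ne
  rw [sheet', sheet', evenPart, mul_neg, asn_neg h, mul_neg, Complex.cos_neg, Complex.sin_neg,
    neg_sq]
  generalize csq (1 - (k * ζ) ^ 2) = r at h0 ⊢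
  field_simp
  linear_combination (-4 * k * cos (2 * asn (k * ζ) / 3)) * sqrt_three_sq

/-- The square root `k` of `3p/4` that is used at the critical point `p`. -/
def critRoot : Fin 2 → ℂ := ![I * (Real.sqrt 3 / 2), Real.sqrt 3 / 2]

theorem airyCrit_sq (j : Fin 2) : airyCrit j ^ 2 = 1 := by
  fin_cases j <;> simp [airyCrit]

theorem airyCrit_cases (j : Fin 2) : airyCrit j = ((1 : ℝ) : ℂ) ∨ airyCrit j = ((-1 : ℝ) : ℂ) := by
  fin_cases j <;> simp [airyCrit]

theorem critRoot_sq (j : Fin 2) : critRoot j ^ 2 = 3 / 4 * airyCrit j := by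
  have h := sqrt_three_sq
  fin_cases j
  · change (I * (Real.sqrt 3 / 2) : ℂ) ^ 2 = 3 / 4 * (-1)
    linear_combination (Real.sqrt 3 : ℂ) ^ 2 / 4 * I_sq - h / 4
  · change ((Real.sqrt 3 / 2) : ℂ) ^ 2 = 3 / 4 * 1
    linear_combination h / 4

/-- The right-hand side is the derivative of the canonical curve at its base; the sign of `critRoot`
is what fixes the orientation. -/
theorem airyOrientation_eq (θ : ℝ) (j : Fin 2) :
    airyOrientation θ j = -(2 / (Real.sqrt 3 : ℂ)) * critRoot j * exp (θ / 2 * I) := by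
  have h3 := sqrt_three_ne
  fin_cases j
  · change -I * exp (θ / 2 * I) = -(2 / (Real.sqrt 3 : ℂ)) * (I * (Real.sqrt 3 / 2)) * exp (θ / 2 * I)
    field_simp
  · change -exp (θ / 2 * I) = -(2 / (Real.sqrt 3 : ℂ)) * (Real.sqrt 3 / 2) * exp (θ / 2 * I)
    field_simp

theorem exp_half_sq (θ : ℝ) : exp (θ / 2 * I) ^ 2 = exp (θ * I) := by
  rw [← Complex.exp_nat_mul]; congr 1; push_cast; ring

theorem one_sub_critRoot_sq (θ : ℝ) (j : Fin 2) (t : ℝ) :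
    1 - (critRoot j * (exp (θ / 2 * I) * t)) ^ 2 =
      1 - 3 / 4 * airyCrit j * exp (θ * I) * (t ^ 2 : ℝ) := by
  rw [mul_pow, mul_pow, critRoot_sq, exp_half_sq]; push_cast; ring

/-- For t ≠ 0 the imaginary part of 1 - (kζ)² is a nonzero multiple of t² sin θ, so the ray never
meets the cuts of the arcsine. -/
theorem ray_mem_asnDom {θ : ℝ} (hθ : Real.sin θ ≠ 0) (j : Fin 2) (t : ℝ) :
    critRoot j * (exp (θ / 2 * I) * t) ∈ asnDom := by
  change _ ∈ slitPlane
  rw [one_sub_critRoot_sq]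
  rcases eq_or_ne t 0 with rfl | ht
  · simp
  · refine Or.inr ?_
    have key (a : ℝ) (ha : a ≠ 0) : (1 - 3 / 4 * (a : ℂ) * exp (θ * I) * (t ^ 2 : ℝ)).im ≠ 0 := by
      have e : (1 - 3 / 4 * (a : ℂ) * exp (θ * I) * (t ^ 2 : ℝ)) =
          1 - ((3 / 4 * a * t ^ 2 : ℝ) : ℂ) * exp (θ * I) := by push_cast; ring
      rw [e, sub_im, im_ofReal_mul, exp_ofReal_mul_I_im, one_im, zero_sub, neg_ne_zero]
      positivity
    rcases airyCrit_cases j with h | h <;> rw [h]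
    · exact key 1 one_ne_zero
    · exact key (-1) (by norm_num)

/-- The canonical parametrization of the thimble through `airyCrit j` at phase `θ`. -/
def normalCurve (θ : ℝ) (j : Fin 2) (t : ℝ) : ℂ :=
  sheet (airyCrit j) (critRoot j) (exp (θ / 2 * I) * t)

theorem normalCurve_hasDerivAt {θ : ℝ} (hθ : Real.sin θ ≠ 0) (j : Fin 2) (t : ℝ) :
    HasDerivAt (normalCurve θ j)
      (sheet' (airyCrit j) (critRoot j) (exp (θ / 2 * I) * t) * exp (θ / 2 * I)) t := by
  have h1 : HasDerivAt (fun t : ℝ => exp (θ / 2 * I) * (t : ℂ)) (exp (θ / 2 * I)) t := by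
    simpa using ((hasDerivAt_id (t : ℂ)).comp_ofReal).const_mul (exp (θ / 2 * I))
  exact (sheet_hasDerivAt (ray_mem_asnDom hθ j t)).comp t h1

theorem deriv_normalCurve_zero {θ : ℝ} (hθ : Real.sin θ ≠ 0) (j : Fin 2) :
    deriv (normalCurve θ j) 0 = airyOrientation θ j := by
  have h := (normalCurve_hasDerivAt hθ j 0).deriv
  rw [h, airyOrientation_eq, sheet']
  simp only [ofReal_zero, mul_zero, asn_zero, Complex.sin_zero, Complex.cos_zero, zero_add, mul_one]
  rw [zero_pow two_ne_zero, sub_zero, csq_one, div_one]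
  have h3 := sqrt_three_ne
  field_simp
  linear_combination (-critRoot j) * sqrt_three_sq

theorem normalCurve_isNormalCurve {θ : ℝ} (hθ : Real.sin θ ≠ 0) (j : Fin 2) :
    IsNormalCurve θ (airyCrit j) (normalCurve θ j) where
  sin_ne := hθ
  crit := airyCrit_sq j
  contDiff := by
    rw [contDiff_iff_contDiffAt]
    intro t
    have hopen : IsOpen {ζ : ℂ | critRoot j * ζ ∈ asnDom} :=
      isOpen_asnDom.preimage (continuous_const.mul continuous_id)
    have hd : DifferentiableOn ℂ (sheet (airyCrit j) (critRoot j)) {ζ | critRoot j * ζ ∈ asnDom} :=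
      fun ζ hζ => (sheet_hasDerivAt hζ).differentiableAt.differentiableWithinAt
    have ha := hd.analyticAt (hopen.mem_nhds (ray_mem_asnDom hθ j t))
    have hc : ContDiffAt ℝ (⊤ : ℕ∞) (sheet (airyCrit j) (critRoot j)) (exp (θ / 2 * I) * t) :=
      ha.contDiffAt.restrict_scalars ℝ
    have hl : ContDiffAt ℝ (⊤ : ℕ∞) (fun t : ℝ => exp (θ / 2 * I) * (t : ℂ)) t :=
      contDiffAt_const.mul ofRealCLM.contDiff.contDiffAt
    exact hc.comp t hl
  action := fun t => by
    rw [normalCurve, airyS_sheet (airyCrit_sq j) (critRoot_sq j) (ray_mem_asnDom hθ j t), mul_pow,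
      exp_half_sq]
  base := by simp [normalCurve, sheet_zero]
  deriv_zero := by
    rw [deriv_normalCurve_zero hθ]
    fin_cases j <;> simp [airyOrientation, exp_ne_zero]
  opposite := fun t => by
    have := sheet_opposite (airyCrit_sq j) (ray_mem_asnDom hθ j t)
    simpa [normalCurve] using this

theorem sin_ne_zero_of_abs_lt {θ : ℝ} (h0 : 0 < |θ|) (h1 : |θ| < Real.pi / 2) :
    Real.sin θ ≠ 0 := by
  have := abs_lt.1 h1
  intro h
  exact abs_pos.1 h0 ((Real.sin_eq_zero_iff_of_lt_of_lt (by linarith [Real.pi_pos])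
    (by linarith [Real.pi_pos])).1 h)

theorem exists_isOrientedThimble {θ : ℝ} (hθ : Real.sin θ ≠ 0) (j : Fin 2) :
    ∃ γ : C(ℝ, ℂ), IsOrientedThimble airyS θ (airyCrit j) (airyOrientation θ j) γ := by
  have h := normalCurve_isNormalCurve hθ j
  exact ⟨⟨normalCurve θ j, h.continuous⟩, h.contDiff, h.injective, h.deriv_ne_zero, h.range_eq,
    h.base, 1, one_pos, by
      rw [ofReal_one, one_mul]; exact deriv_normalCurve_zero hθ j⟩

open MeasureTheory

/-! ### All oriented parametrizations of a thimble -/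

theorem continuous_airyS : Continuous airyS := continuous_iff_continuousAt.2 fun z =>
  (airyS_hasDerivAt z).continuousAt

/-- The identity |S(g(t)) - S(p)| = t² makes the curve proper. -/
theorem IsNormalCurve.isClosedEmbedding {θ : ℝ} {p : ℂ} {g : ℝ → ℂ} (hg : IsNormalCurve θ p g) :
    IsClosedEmbedding g := by
  refine IsClosedEmbedding.of_continuous_injective_isClosedMap hg.continuous hg.injective ?_
  refine (isProperMap_iff_isCompact_preimage.2 ⟨hg.continuous, fun K hK => ?_⟩).isClosedMap
  obtain ⟨C, hC⟩ := hK.exists_bound_of_continuousOn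
    (continuous_airyS.sub continuous_const).continuousOn (f := fun z => airyS z - airyS p)
  refine Metric.isCompact_of_isClosed_isBounded (hK.isClosed.preimage hg.continuous)
    ((Metric.isBounded_iff_subset_closedBall 0).2 ⟨C + 1, fun t ht => ?_⟩)
  have h := hC _ ht
  rw [hg.action, add_sub_cancel_left, norm_mul, norm_exp_ofReal_mul_I, one_mul, norm_pow,
    norm_real] at h
  rw [mem_closedBall_zero_iff]
  nlinarith [sq_nonneg (‖t‖ - 1), norm_nonneg t]

/-- Every oriented parametrization of a thimble is an increasing reparametrization of the
canonical one. -/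
theorem IsOrientedThimble.exists_reparametrization {θ : ℝ} (hθ : Real.sin θ ≠ 0) {j : Fin 2}
    {γ : C(ℝ, ℂ)} (hγ : IsOrientedThimble airyS θ (airyCrit j) (airyOrientation θ j) γ) :
    ∃ τ τ' : ℝ → ℝ, (∀ t, HasDerivAt τ (τ' t) t) ∧ StrictMono τ ∧ Function.Surjective τ ∧
      ∀ t, γ t = normalCurve θ j (τ t) := by
  have hg := normalCurve_isNormalCurve hθ j
  set g := normalCurve θ j with hgdef
  have hmem (t : ℝ) : ∃ u, g u = γ t := by
    have : γ t ∈ range g := by rw [hg.range_eq, ← hγ.range_eq]; exact mem_range_self t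
    exact this
  choose τ hτ using hmem
  have hcont : Continuous τ := by
    rw [hg.isClosedEmbedding.isInducing.continuous_iff]
    exact γ.continuous.congr fun t => (hτ t).symm
  have hinj : Function.Injective τ := fun a b h => hγ.injective (by rw [← hτ, ← hτ, h])
  have hsurj : Function.Surjective τ := fun u => by
    have : g u ∈ range γ := by rw [hγ.range_eq, ← hg.range_eq]; exact mem_range_self u
    obtain ⟨t, ht⟩ := this
    exact ⟨t, hg.injective (by rw [hτ, ht])⟩
  have h0 : τ 0 = 0 := hg.injective (by rw [hτ, hγ.base, hg.base])
  have hγd (t : ℝ) : HasDerivAt γ (deriv γ t) t :=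
    (hγ.contDiff.differentiable (by simp) t).hasDerivAt
  -- The difference quotient of τ is the quotient of those of γ and g, whose limits exist and the
  -- second of which is nonzero.
  have hτd (t : ℝ) : HasDerivAt τ (deriv γ t / deriv g (τ t)).re t := by
    rw [hasDerivAt_iff_tendsto_slope]
    have h1 : Tendsto (slope γ t) (𝓝[≠] t) (𝓝 (deriv γ t)) :=
      hasDerivAt_iff_tendsto_slope.1 (hγd t)
    have h2 : Tendsto (fun s => slope g (τ t) (τ s)) (𝓝[≠] t) (𝓝 (deriv g (τ t))) := by
      refine (hasDerivAt_iff_tendsto_slope.1 (hg.hasDerivAt (τ t))).comp ?_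
      refine tendsto_nhdsWithin_iff.2 ⟨(hcont.tendsto t).mono_left nhdsWithin_le_nhds, ?_⟩
      filter_upwards [self_mem_nhdsWithin] with s hs
      exact fun h => hs (hinj h)
    have h3 := (continuous_re.tendsto _).comp (h1.div h2 (hg.deriv_ne_zero _))
    refine h3.congr' ?_
    filter_upwards [self_mem_nhdsWithin] with s hs
    have hs' : τ s - τ t ≠ 0 := sub_ne_zero.2 fun h => hs (hinj h)
    have hst : s - t ≠ 0 := sub_ne_zero.2 hs
    have hgs : g (τ s) - g (τ t) ≠ 0 := sub_ne_zero.2 fun h => hs (hinj (hg.injective h))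
    simp only [Function.comp_apply, slope_def_module, Pi.div_apply, ← hτ, real_smul, smul_eq_mul]
    have hgoal : ((s - t : ℝ)⁻¹ : ℂ) * (g (τ s) - g (τ t)) /
        (((τ s - τ t)⁻¹ : ℝ) * (g (τ s) - g (τ t))) = (((s - t)⁻¹ * (τ s - τ t) : ℝ) : ℂ) := by
      have a1 : ((s - t : ℝ) : ℂ) ≠ 0 := by exact_mod_cast hst
      have a2 : ((τ s - τ t : ℝ) : ℂ) ≠ 0 := by exact_mod_cast hs'
      rw [mul_div_mul_right _ _ hgs, ofReal_mul, ofReal_inv, ofReal_inv, div_inv_eq_mul]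
    rw [ofReal_inv, hgoal, ofReal_re]
  refine ⟨τ, _, hτd, ?_, hsurj, fun t => (hτ t).symm⟩
  -- A continuous injective τ is monotone. A decreasing one would have derivative at most 0 at the
  -- base, against the positive constant in the orientation.
  rcases hcont.strictMono_of_inj hinj with h | h
  · exact h
  exfalso
  obtain ⟨c, hc, hc'⟩ := hγ.orientation
  have h1 := (hτd 0).deriv
  have hv : deriv g 0 ≠ 0 := hg.deriv_zero
  rw [h0, hc', ← deriv_normalCurve_zero hθ, ← hgdef, mul_div_cancel_right₀ _ hv, ofReal_re] at h1
  have h2 : deriv τ 0 ≤ 0 := h.antitone.deriv_nonpos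
  linarith

/-- The integrand of the exponential integral over the canonical parametrization. -/
def normalIntegrand (θ : ℝ) (j : Fin 2) (h : ℂ) (t : ℝ) : ℂ :=
  exp (-(airyS (normalCurve θ j t)) / h) * deriv (normalCurve θ j) t

theorem IsOrientedThimble.integrable_and_integral {θ : ℝ} (hθ : Real.sin θ ≠ 0) {j : Fin 2}
    {γ : C(ℝ, ℂ)} (hγ : IsOrientedThimble airyS θ (airyCrit j) (airyOrientation θ j) γ) (h : ℂ) :
    (Integrable (normalIntegrand θ j h) → Integrable (expIntegrand airyS γ h)) ∧
      expIntegral airyS γ h = ∫ t : ℝ, normalIntegrand θ j h t := by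
  obtain ⟨τ, τ', hd, hmono, hsurj, hτ⟩ := hγ.exists_reparametrization hθ
  have hg := normalCurve_isNormalCurve hθ j
  have e : expIntegrand airyS γ h = fun t => |τ' t| • normalIntegrand θ j h (τ t) := by
    funext t
    have h1 : HasDerivAt γ ((τ' t) • deriv (normalCurve θ j) (τ t)) t := by
      have := (hg.hasDerivAt (τ t)).scomp t (hd t)
      rwa [show normalCurve θ j ∘ τ = γ from (funext hτ).symm] at this
    have h2 : 0 ≤ τ' t := by
      rw [← (hd t).deriv]; exact hmono.monotone.deriv_nonneg
    rw [expIntegrand, h1.deriv, hτ, normalIntegrand, abs_of_nonneg h2, real_smul, real_smul]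
    ring
  have hd' : ∀ t ∈ univ, HasDerivWithinAt τ (τ' t) univ t := fun t _ =>
    (hd t).hasDerivWithinAt
  have hr : τ '' univ = univ := by rw [image_univ, hsurj.range_eq]
  constructor
  · intro hi
    have := integrableOn_image_iff_integrableOn_abs_deriv_smul MeasurableSet.univ hd'
      hmono.injective.injOn (normalIntegrand θ j h)
    rw [hr, integrableOn_univ, integrableOn_univ] at this
    rw [e]
    exact this.1 hi
  · have := integral_image_eq_integral_abs_deriv_smul MeasurableSet.univ hd'
      hmono.injective.injOn (normalIntegrand θ j h)
    rw [hr, setIntegral_univ, setIntegral_univ] at this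
    rw [expIntegral, e, this]

/-! ### Gaussian moments -/

theorem integrable_pow_mul_gauss {b : ℂ} (hb : 0 < b.re) (n : ℕ) :
    Integrable fun t : ℝ => (t : ℂ) ^ n * exp (-b * (t : ℂ) ^ 2) := by
  have h := (integrable_rpow_mul_exp_neg_mul_sq hb (s := n) (by linarith [n.cast_nonneg (α := ℝ)]))
  refine h.mono (by fun_prop) (Eventually.of_forall fun t => le_of_eq ?_)
  rw [norm_mul, norm_cexp_neg_mul_sq, norm_mul, Real.rpow_natCast, norm_pow, norm_pow, norm_real,
    Real.norm_of_nonneg (Real.exp_pos _).le]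

theorem integral_pow_mul_gauss_succ {b : ℂ} (hb : 0 < b.re) (m : ℕ) :
    2 * b * ∫ t : ℝ, (t : ℂ) ^ (2 * (m + 1)) * exp (-b * (t : ℂ) ^ 2) =
      (2 * m + 1) * ∫ t : ℝ, (t : ℂ) ^ (2 * m) * exp (-b * (t : ℂ) ^ 2) := by
  have hd (t : ℝ) : HasDerivAt (fun t : ℝ => (t : ℂ) ^ (2 * m + 1) * exp (-b * (t : ℂ) ^ 2))
      ((2 * m + 1) * ((t : ℂ) ^ (2 * m) * exp (-b * (t : ℂ) ^ 2)) -
        2 * b * ((t : ℂ) ^ (2 * (m + 1)) * exp (-b * (t : ℂ) ^ 2))) t := by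
    have h1 := hasDerivAt_pow (2 * m + 1) (t : ℂ)
    have h2 := ((hasDerivAt_pow 2 (t : ℂ)).const_mul (-b)).cexp
    refine (h1.mul h2).comp_ofReal.congr_deriv ?_
    push_cast
    ring
  have i1 := (integrable_pow_mul_gauss hb (2 * m)).const_mul (2 * m + 1 : ℂ)
  have i2 := (integrable_pow_mul_gauss hb (2 * (m + 1))).const_mul (2 * b)
  have h := integral_eq_zero_of_hasDerivAt_of_integrable hd (i1.sub i2)
    (integrable_pow_mul_gauss hb (2 * m + 1))
  rw [integral_sub i1 i2, integral_const_mul, integral_const_mul] at h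
  exact (sub_eq_zero.1 h).symm

theorem integral_pow_mul_gauss {b : ℂ} (hb : 0 < b.re) (m : ℕ) :
    (Real.sqrt Real.pi : ℂ) * ∫ t : ℝ, (t : ℂ) ^ (2 * m) * exp (-b * (t : ℂ) ^ 2) =
      (Real.Gamma (m + 1 / 2) : ℂ) * b⁻¹ ^ m * ∫ t : ℝ, exp (-b * (t : ℂ) ^ 2) := by
  have hb0 : b ≠ 0 := by rintro rfl; simp at hb
  induction m with
  | zero =>
    simp only [Nat.cast_zero, zero_add, Real.Gamma_one_half_eq, mul_zero, pow_zero, one_mul, mul_one]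
  | succ m ih =>
    have h1 := integral_pow_mul_gauss_succ hb m
    have h2 : Real.Gamma ((m + 1 : ℕ) + 1 / 2) = (m + 1 / 2) * Real.Gamma (m + 1 / 2) := by
      rw [← Real.Gamma_add_one (by positivity)]; push_cast; ring_nf
    rw [h2]
    generalize (∫ t : ℝ, (t : ℂ) ^ (2 * (m + 1)) * exp (-b * (t : ℂ) ^ 2)) = J at *
    generalize (∫ t : ℝ, (t : ℂ) ^ (2 * m) * exp (-b * (t : ℂ) ^ 2)) = K at *
    have h3 : J = (2 * m + 1) / (2 * b) * K := by field_simp; linear_combination h1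
    rw [h3, pow_succ]
    push_cast
    have : ((2 * m + 1) / (2 * b) : ℂ) = (m + 1 / 2) * b⁻¹ := by field_simp
    rw [this]
    linear_combination ((m + 1 / 2) * b⁻¹ : ℂ) * ih

/-- The inverse width `e^{iθ}/ħ` of the Gaussian on a thimble. -/
def gaussWidth (θ : ℝ) (h : ℂ) : ℂ := exp (θ * I) / h

theorem gaussWidth_re {θ : ℝ} {h : ℂ} (h0 : h ≠ 0) :
    (gaussWidth θ h).re = Real.cos (h.arg - θ) / ‖h‖ := by
  have e : gaussWidth θ h = ((‖h‖⁻¹ : ℝ) : ℂ) * exp (((θ - h.arg : ℝ) : ℂ) * I) := by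
    rw [gaussWidth]
    conv_lhs => rw [← norm_mul_exp_arg_mul_I h]
    rw [ofReal_sub, sub_mul, Complex.exp_sub, ofReal_inv]
    have := norm_ne_zero_iff.2 h0
    field_simp
  rw [e, re_ofReal_mul, exp_ofReal_mul_I_re, ← Real.cos_neg, neg_sub, inv_mul_eq_div]

theorem gaussWidth_re_pos {θ : ℝ} {h : ℂ} (h0 : h ≠ 0) (ha : |h.arg - θ| < Real.pi / 2) :
    0 < (gaussWidth θ h).re := by
  rw [gaussWidth_re h0]
  have := abs_lt.1 ha
  exact div_pos (Real.cos_pos_of_mem_Ioo ⟨this.1, this.2⟩) (norm_pos_iff.2 h0)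

/-- The argument of π/b is arg h - θ, which lies in (-π/2, π/2), so the principal root factors
without a correction of branch. -/
theorem integral_gaussWidth {θ : ℝ} {h : ℂ} (h0 : h ≠ 0) (ha : |h.arg - θ| < Real.pi / 2) :
    ∫ t : ℝ, exp (-gaussWidth θ h * (t : ℂ) ^ 2) =
      (Real.sqrt Real.pi : ℂ) * (exp (-(θ / 2 * I)) * h ^ (1 / 2 : ℂ)) := by
  have hpi := Real.pi_pos
  have hlt := abs_lt.1 ha
  have e : (Real.pi : ℂ) / gaussWidth θ h =
      exp (((Real.log Real.pi : ℝ) : ℂ) + (log h - θ * I)) := by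
    rw [Complex.exp_add, Complex.exp_sub, exp_log h0, ← ofReal_exp, Real.exp_log hpi, gaussWidth]
    have := exp_ne_zero ((θ : ℂ) * I)
    field_simp
  have e2 : (Real.sqrt Real.pi : ℂ) = exp (((Real.log Real.pi : ℝ) : ℂ) / 2) := by
    rw [Real.sqrt_eq_rpow, Real.rpow_def_of_pos hpi]
    push_cast; ring_nf
  rw [integral_gaussian_complex (gaussWidth_re_pos h0 ha), cpow_def_of_ne_zero
    (by rw [e]; exact exp_ne_zero _), e, log_exp, e2, cpow_def_of_ne_zero h0, ← Complex.exp_add,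
    ← Complex.exp_add]
  · congr 1; ring
  · simp [log_im]; linarith
  · simp [log_im]; linarith

/-! ### Growth along a thimble, integrability -/

/-- The identity (z² - 1)²(z² - 4) = 9S² - 4 = 9(S - S(p))(S + S(p)) bounds S' below: for |t| ≥ 1
the first factor has modulus t² and the second an imaginary part of modulus t² |sin θ|. As S'(g) g'
= 2e^{iθ} t, the derivative g' then grows at most linearly. -/
theorem IsNormalCurve.abs_sin_le {θ : ℝ} {p : ℂ} {g : ℝ → ℂ} (hg : IsNormalCurve θ p g) {t : ℝ}
    (ht : 1 ≤ |t|) : |Real.sin θ| ≤ ‖g t ^ 2 - 1‖ := by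
  set w := exp (θ * I) * (t : ℂ) ^ 2 with hw
  have hsp : airyS p = -(2 / 3) * p := by
    rw [airyS]; linear_combination p / 3 * hg.crit
  have h1 : (g t ^ 2 - 1) ^ 2 * (g t ^ 2 - 4) = 9 * w * (w - 4 / 3 * p) := by
    have h := hg.action t
    rw [hsp, ← hw] at h
    have : (g t ^ 2 - 1) ^ 2 * (g t ^ 2 - 4) = 9 * airyS (g t) ^ 2 - 4 := by rw [airyS]; ring
    rw [this, h]
    linear_combination 4 * hg.crit
  have ht2 : 1 ≤ t ^ 2 := by rw [← sq_abs]; nlinarith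
  have hwn : ‖w‖ = t ^ 2 := by
    rw [hw, norm_mul, norm_exp_ofReal_mul_I, one_mul, norm_pow, norm_real, Real.norm_eq_abs, sq_abs]
  have him : |Real.sin θ| ≤ ‖w - 4 / 3 * p‖ := by
    have e : (w - 4 / 3 * p).im = Real.sin θ * t ^ 2 := by
      rw [sub_im, hw, ← ofReal_pow, im_mul_ofReal, exp_ofReal_mul_I_im]
      rcases hg.crit_eq with h | h <;> simp [h]
    have := abs_im_le_norm (w - 4 / 3 * p)
    rw [e, abs_mul, abs_of_nonneg (sq_nonneg t)] at this
    nlinarith [abs_nonneg (Real.sin θ)]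
  set x := ‖g t ^ 2 - 1‖ with hx
  have hx0 : 0 ≤ x := norm_nonneg _
  have h2 : 9 * |Real.sin θ| ≤ x ^ 2 * (x + 3) := by
    have h3 : ‖(g t ^ 2 - 1) ^ 2 * (g t ^ 2 - 4)‖ ≤ x ^ 2 * (x + 3) := by
      rw [norm_mul, norm_pow]
      refine mul_le_mul_of_nonneg_left ?_ (sq_nonneg _)
      calc ‖g t ^ 2 - 4‖ = ‖(g t ^ 2 - 1) - 3‖ := by congr 1; ring
        _ ≤ x + ‖(3 : ℂ)‖ := norm_sub_le _ _
        _ = x + 3 := by simp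
    rw [h1, norm_mul, norm_mul, hwn] at h3
    refine le_trans ?_ h3
    have : ‖(9 : ℂ)‖ = 9 := by simp
    rw [this]
    nlinarith [norm_nonneg (w - 4 / 3 * p)]
  have hs1 := Real.abs_sin_le_one θ
  by_contra hlt
  have hlt := not_le.1 hlt
  nlinarith [mul_nonneg hx0 hx0]

theorem IsNormalCurve.norm_deriv_le {θ : ℝ} {p : ℂ} {g : ℝ → ℂ} (hg : IsNormalCurve θ p g) {t : ℝ}
    (ht : 1 ≤ |t|) : ‖deriv g t‖ ≤ 2 / |Real.sin θ| * |t| := by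
  have h := congrArg norm (hg.deriv_mul t)
  rw [norm_mul, norm_mul, norm_mul, norm_exp_ofReal_mul_I, norm_real, Real.norm_eq_abs,
    Complex.norm_two, mul_one] at h
  have h1 := hg.abs_sin_le ht
  have h2 := abs_pos.2 hg.sin_ne
  rw [div_mul_eq_mul_div, le_div_iff₀ h2]
  nlinarith [norm_nonneg (deriv g t)]

theorem IsNormalCurve.exists_norm_deriv_le {θ : ℝ} {p : ℂ} {g : ℝ → ℂ}
    (hg : IsNormalCurve θ p g) : ∃ C : ℝ, ∀ t, ‖deriv g t‖ ≤ C * (1 + t ^ 2) := by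
  obtain ⟨C, hC⟩ := (isCompact_Icc (a := (-1 : ℝ)) (b := 1)).exists_bound_of_continuousOn
    hg.continuous_deriv.continuousOn
  have hC0 : 0 ≤ C := (norm_nonneg _).trans (hC 0 (by norm_num))
  have hs : 0 ≤ 2 / |Real.sin θ| := by positivity
  refine ⟨C + 2 / |Real.sin θ|, fun t => ?_⟩
  rcases le_total |t| 1 with h | h
  · have := hC t (abs_le.1 h)
    nlinarith [sq_nonneg t, mul_nonneg hC0 (sq_nonneg t), mul_nonneg hs (sq_nonneg t)]
  · have h1 := hg.norm_deriv_le h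
    have h2 : |t| ≤ 1 + t ^ 2 := by rw [← sq_abs]; nlinarith
    nlinarith [mul_le_mul_of_nonneg_left h2 hs, mul_nonneg hC0 (sq_nonneg t)]

theorem normalIntegrand_eq {θ : ℝ} (hθ : Real.sin θ ≠ 0) (j : Fin 2) (h : ℂ) (t : ℝ) :
    normalIntegrand θ j h t = exp (-airyS (airyCrit j) / h) *
      (exp (-gaussWidth θ h * (t : ℂ) ^ 2) * deriv (normalCurve θ j) t) := by
  rw [normalIntegrand, (normalCurve_isNormalCurve hθ j).action, ← mul_assoc, ← Complex.exp_add]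
  congr 2
  rw [gaussWidth]
  ring

theorem integrable_gauss_mul_deriv {θ : ℝ} {p : ℂ} {g : ℝ → ℂ} (hg : IsNormalCurve θ p g) {b : ℂ}
    (hb : 0 < b.re) : Integrable fun t : ℝ => exp (-b * (t : ℂ) ^ 2) * deriv g t := by
  obtain ⟨C, hC⟩ := hg.exists_norm_deriv_le
  have hi : Integrable fun t : ℝ => C * (((t : ℂ) ^ 0 * exp (-b * (t : ℂ) ^ 2)) +
      (t : ℂ) ^ 2 * exp (-b * (t : ℂ) ^ 2)) :=
    ((integrable_pow_mul_gauss hb 0).add (integrable_pow_mul_gauss hb 2)).const_mul _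
  have hm := hg.continuous_deriv
  refine hi.mono (by fun_prop) (Eventually.of_forall fun t => ?_)
  have e : C * (((t : ℂ) ^ 0 * exp (-b * (t : ℂ) ^ 2)) +
      (t : ℂ) ^ 2 * exp (-b * (t : ℂ) ^ 2)) =
      exp (-b * (t : ℂ) ^ 2) * ((C * (1 + t ^ 2) : ℝ) : ℂ) := by push_cast; ring
  rw [e, norm_mul, norm_mul]
  refine mul_le_mul_of_nonneg_left ((hC t).trans ?_) (norm_nonneg _)
  rw [norm_real]
  exact le_abs_self _

theorem integrable_normalIntegrand {θ : ℝ} (hθ : Real.sin θ ≠ 0) (j : Fin 2) {h : ℂ} (h0 : h ≠ 0)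
    (ha : |h.arg - θ| < Real.pi / 2) : Integrable (normalIntegrand θ j h) := by
  rw [show normalIntegrand θ j h = _ from funext (normalIntegrand_eq hθ j h)]
  exact (integrable_gauss_mul_deriv (normalCurve_isNormalCurve hθ j)
    (gaussWidth_re_pos h0 ha)).const_mul _

/-! ### The even part of the integrand -/

/-- The even part of the derivative of the canonical parametrization, divided by the tangent vector
at the critical point. -/
def rayEven (θ : ℝ) (j : Fin 2) (t : ℝ) : ℂ := evenPart (critRoot j * (exp (θ / 2 * I) * t))

theorem deriv_add_deriv_neg {θ : ℝ} (hθ : Real.sin θ ≠ 0) (j : Fin 2) (t : ℝ) :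
    deriv (normalCurve θ j) t + deriv (normalCurve θ j) (-t) =
      2 * airyOrientation θ j * rayEven θ j t := by
  rw [(normalCurve_hasDerivAt hθ j t).deriv, (normalCurve_hasDerivAt hθ j (-t)).deriv, ← add_mul,
    ofReal_neg, mul_neg, sheet'_add (ray_mem_asnDom hθ j t), airyOrientation_eq, rayEven]
  ring

theorem norm_airyOrientation (θ : ℝ) (j : Fin 2) : ‖airyOrientation θ j‖ = 1 := by
  have h : ‖exp ((θ : ℂ) / 2 * I)‖ = 1 := by
    have := norm_exp_ofReal_mul_I (θ / 2)
    push_cast at this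
    exact this
  fin_cases j <;> simp [airyOrientation, h]

theorem norm_rayEven_le {θ : ℝ} (hθ : Real.sin θ ≠ 0) (j : Fin 2) {t : ℝ} (ht : 1 ≤ |t|) :
    ‖rayEven θ j t‖ ≤ 2 / |Real.sin θ| * |t| := by
  have hg := normalCurve_isNormalCurve hθ j
  have h := congrArg norm (deriv_add_deriv_neg hθ j t)
  rw [norm_mul, norm_mul, norm_airyOrientation, Complex.norm_two] at h
  have h1 := norm_add_le (deriv (normalCurve θ j) t) (deriv (normalCurve θ j) (-t))
  have h2 := hg.norm_deriv_le ht
  have h3 := hg.norm_deriv_le (t := -t) (by rwa [abs_neg])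
  rw [abs_neg] at h3
  linarith

theorem norm_hgC_half_le (m : ℕ) : ‖hgC (1 / 2) m‖ ≤ 1 := by
  rw [hgC, norm_real, Real.norm_of_nonneg (hgCoef_pos half_le_half m).le]
  exact hgCoef_le_one half_le_half m

theorem norm_hgHalf_sub_le {x : ℂ} (hx : ‖x‖ ≤ 3 / 4) (M : ℕ) :
    ‖hgHalf x - ∑ m ∈ Finset.range M, hgC (1 / 2) m * x ^ m‖ ≤ 4 * ‖x‖ ^ M := by
  have hx1 : ‖x‖ < 1 := by linarith
  have hs := (hgC_polyBounded half_le_half).hasSum hx1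
  have h1 := hs.summable.sum_add_tsum_nat_add M
  rw [hgHalf, ← hs.tsum_eq, ← h1, add_sub_cancel_left]
  have hgeo : HasSum (fun i : ℕ => ‖x‖ ^ M * ‖x‖ ^ i) (‖x‖ ^ M * (1 - ‖x‖)⁻¹) :=
    (hasSum_geometric_of_lt_one (norm_nonneg x) hx1).mul_left _
  refine (tsum_of_norm_bounded hgeo fun i => ?_).trans ?_
  · rw [norm_mul, norm_pow, ← pow_add, add_comm M]
    exact mul_le_of_le_one_left (by positivity) (norm_hgC_half_le _)
  · rw [mul_comm]
    refine mul_le_mul_of_nonneg_right ?_ (by positivity)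
    rw [inv_le_comm₀ (by linarith) (by norm_num)]
    linarith

theorem norm_airyCrit (j : Fin 2) : ‖airyCrit j‖ = 1 := by
  fin_cases j <;> simp [airyCrit]

/-- For |t| ≤ 1 the argument of the power series is at most 3/4 in modulus and the tail is
geometric. For |t| ≥ 1 every term of the polynomial is at most t^{2M}, and so is |t| because M ≥ 1.
-/
theorem norm_rayEven_sub_le {θ : ℝ} (hθ : Real.sin θ ≠ 0) (j : Fin 2) (t : ℝ) {M : ℕ}
    (hM : 1 ≤ M) :
    ‖rayEven θ j t - ∑ m ∈ Finset.range M,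
      hgC (1 / 2) m * (3 / 4 * airyCrit j * exp (θ * I) * (t ^ 2 : ℝ)) ^ m‖ ≤
      (4 + 2 / |Real.sin θ| + M) * t ^ (2 * M) := by
  set x := 3 / 4 * airyCrit j * exp (θ * I) * (t ^ 2 : ℝ) with hx
  have hxn : ‖x‖ = 3 / 4 * t ^ 2 := by
    rw [hx, norm_mul, norm_mul, norm_mul, norm_exp_ofReal_mul_I, norm_airyCrit, norm_real,
      Real.norm_of_nonneg (sq_nonneg t)]
    norm_num
  have hw : (critRoot j * (exp (θ / 2 * I) * t)) ^ 2 = x := by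
    have := one_sub_critRoot_sq θ j t
    rw [← hx] at this
    linear_combination -this
  have hs : 0 ≤ 2 / |Real.sin θ| := by positivity
  have ht2 : 0 ≤ t ^ (2 * M) := by rw [pow_mul]; positivity
  rcases le_total |t| 1 with h | h
  · have ht : t ^ 2 ≤ 1 := by rw [← sq_abs]; exact pow_le_one₀ (abs_nonneg t) h
    have hwn : ‖critRoot j * (exp (θ / 2 * I) * t)‖ < 1 := by
      have h2 := congrArg norm hw
      rw [norm_pow, hxn] at h2
      nlinarith [norm_nonneg (critRoot j * (exp (θ / 2 * I) * t))]
    rw [rayEven, evenPart_eq hwn, hw]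
    refine (norm_hgHalf_sub_le (by linarith) M).trans ?_
    have h3 : ‖x‖ ^ M ≤ t ^ (2 * M) := by
      rw [pow_mul]
      exact pow_le_pow_left₀ (norm_nonneg _) (by rw [hxn]; nlinarith [sq_nonneg t]) M
    nlinarith [mul_nonneg hs ht2, mul_nonneg (Nat.cast_nonneg (α := ℝ) M) ht2]
  · have ht : 1 ≤ t ^ 2 := by rw [← sq_abs]; exact one_le_pow₀ h
    have h1 := norm_rayEven_le hθ j h
    have h2 : |t| ≤ t ^ (2 * M) := by
      have h3 : (t ^ 2) ^ 1 ≤ (t ^ 2) ^ M := pow_le_pow_right₀ ht hM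
      rw [pow_mul]
      rw [pow_one] at h3
      refine le_trans ?_ h3
      rw [← sq_abs]; nlinarith
    have h4 : ‖∑ m ∈ Finset.range M, hgC (1 / 2) m * x ^ m‖ ≤ M * t ^ (2 * M) := by
      refine (norm_sum_le_of_le (Finset.range M) (f := fun m => hgC (1 / 2) m * x ^ m)
        (n := fun _ => t ^ (2 * M)) fun m hm => ?_).trans (by simp)
      rw [norm_mul, norm_pow, hxn]
      refine (mul_le_of_le_one_left (by positivity) (norm_hgC_half_le m)).trans ?_
      rw [pow_mul]
      refine (pow_le_pow_left₀ (by positivity) (by linarith : 3 / 4 * t ^ 2 ≤ t ^ 2) m).trans ?_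
      exact pow_le_pow_right₀ ht (Finset.mem_range.1 hm).le
    refine (norm_sub_le _ _).trans ?_
    nlinarith [mul_le_mul_of_nonneg_left h2 hs]

/-! ### The saddle expansion -/

theorem continuous_rayEven {θ : ℝ} (hθ : Real.sin θ ≠ 0) (j : Fin 2) :
    Continuous (rayEven θ j) :=
  continuous_iff_continuousAt.2 fun t =>
    (evenPart_differentiableAt (ray_mem_asnDom hθ j t)).continuousAt.comp
      (f := fun t : ℝ => critRoot j * (exp (θ / 2 * I) * t)) (by fun_prop)

/-- The Gaussian is even, so replacing t by -t leaves only the even part of the derivative. -/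
theorem integral_gauss_mul_deriv {θ : ℝ} (hθ : Real.sin θ ≠ 0) (j : Fin 2) {b : ℂ}
    (hb : 0 < b.re) :
    ∫ t : ℝ, exp (-b * (t : ℂ) ^ 2) * deriv (normalCurve θ j) t =
      airyOrientation θ j * ∫ t : ℝ, exp (-b * (t : ℂ) ^ 2) * rayEven θ j t := by
  set f : ℝ → ℂ := fun t => exp (-b * (t : ℂ) ^ 2) * deriv (normalCurve θ j) t with hf
  have hi : Integrable f := integrable_gauss_mul_deriv (normalCurve_isNormalCurve hθ j) hb
  have h1 : ∫ t, f (-t) = ∫ t, f t := integral_neg_eq_self f volume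
  have h2 : ∫ t, (f t + f (-t)) = (∫ t, f t) + ∫ t, f (-t) := integral_add hi hi.comp_neg
  have h3 : (fun t => f t + f (-t)) =
      fun t : ℝ => (2 * airyOrientation θ j) * (exp (-b * (t : ℂ) ^ 2) * rayEven θ j t) := by
    funext t
    simp only [hf, ofReal_neg, neg_sq]
    linear_combination exp (-b * (t : ℂ) ^ 2) * deriv_add_deriv_neg hθ j t
  rw [h1, h3, integral_const_mul] at h2
  linear_combination -h2 / 2

theorem integral_real_pow_mul_gauss {β : ℝ} (hβ : 0 < β) (m : ℕ) :
    ∫ t : ℝ, t ^ (2 * m) * Real.exp (-β * t ^ 2) =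
      Real.Gamma (m + 1 / 2) * β⁻¹ ^ m * Real.sqrt β⁻¹ := by
  have h := integral_pow_mul_gauss (b := (β : ℂ)) (by simpa using hβ) m
  have e1 : (∫ t : ℝ, (t : ℂ) ^ (2 * m) * exp (-(β : ℂ) * (t : ℂ) ^ 2)) =
      ((∫ t : ℝ, t ^ (2 * m) * Real.exp (-β * t ^ 2) : ℝ) : ℂ) := by
    rw [← integral_complex_ofReal]; push_cast; rfl
  have e2 : (∫ t : ℝ, exp (-(β : ℂ) * (t : ℂ) ^ 2)) =
      ((∫ t : ℝ, Real.exp (-β * t ^ 2) : ℝ) : ℂ) := by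
    rw [← integral_complex_ofReal]; push_cast; rfl
  rw [e1, e2, integral_gaussian] at h
  have h' : Real.sqrt Real.pi * (∫ t : ℝ, t ^ (2 * m) * Real.exp (-β * t ^ 2)) =
      Real.Gamma (m + 1 / 2) * β⁻¹ ^ m * Real.sqrt (Real.pi / β) := by exact_mod_cast h
  have hpi : Real.sqrt Real.pi ≠ 0 := (Real.sqrt_pos.2 Real.pi_pos).ne'
  rw [div_eq_mul_inv Real.pi, Real.sqrt_mul Real.pi_pos.le] at h'
  apply mul_left_cancel₀ hpi
  rw [h']
  ring

theorem coeff_airyPsi (θ : ℝ) (j : Fin 2) (m : ℕ) :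
    PowerSeries.coeff m (airyPsi j) = airyOrientation θ j * exp (-(θ / 2 * I)) *
      ((Real.sqrt Real.pi : ℂ) * airyCoeff m * airyCrit j ^ m) := by
  have h : exp ((θ : ℂ) / 2 * I) * exp (-(θ / 2 * I)) = 1 := by rw [← Complex.exp_add]; simp
  fin_cases j
  · simp only [airyPsi, airyOrientation, airyCrit, Fin.zero_eta, Matrix.cons_val_zero,
      PowerSeries.coeff_smul, coeff_airyPhiMinus, smul_eq_mul]
    linear_combination (I * (Real.sqrt Real.pi : ℂ) * airyCoeff m * (-1) ^ m) * h
  · simp only [airyPsi, airyOrientation, airyCrit, Fin.mk_one, Matrix.cons_val_one,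
      Matrix.cons_val_fin_one, PowerSeries.coeff_smul, coeff_airyPhiPlus, smul_eq_mul, one_pow]
    linear_combination ((Real.sqrt Real.pi : ℂ) * airyCoeff m) * h

/-- The Gaussian integral of a term of the Taylor series of `rayEven`. -/
theorem integral_gauss_mul_term {θ : ℝ} (j : Fin 2) {h : ℂ} (h0 : h ≠ 0)
    (ha : |h.arg - θ| < Real.pi / 2) (m : ℕ) :
    ∫ t : ℝ, exp (-gaussWidth θ h * (t : ℂ) ^ 2) *
        (hgC (1 / 2) m * (3 / 4 * airyCrit j * exp (θ * I) * (t ^ 2 : ℝ)) ^ m) =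
      (Real.sqrt Real.pi : ℂ) * airyCoeff m * airyCrit j ^ m * h ^ m *
        (exp (-(θ / 2 * I)) * h ^ (1 / 2 : ℂ)) := by
  have hb := gaussWidth_re_pos h0 ha
  have e : (fun t : ℝ => exp (-gaussWidth θ h * (t : ℂ) ^ 2) *
      (hgC (1 / 2) m * (3 / 4 * airyCrit j * exp (θ * I) * (t ^ 2 : ℝ)) ^ m)) =
      fun t : ℝ => (hgC (1 / 2) m * (3 / 4 * airyCrit j * exp (θ * I)) ^ m) *
        ((t : ℂ) ^ (2 * m) * exp (-gaussWidth θ h * (t : ℂ) ^ 2)) := by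
    funext t
    rw [pow_mul, mul_pow _ (((t ^ 2 : ℝ)) : ℂ), ofReal_pow]
    ring
  have h1 := integral_pow_mul_gauss hb m
  rw [integral_gaussWidth h0 ha] at h1
  rw [e, integral_const_mul]
  have h2 : exp (θ * I) * (gaussWidth θ h)⁻¹ = h := by
    rw [gaussWidth, inv_div, mul_div_cancel₀ _ (exp_ne_zero _)]
  have h3 : (3 / 4 * airyCrit j * exp (θ * I)) ^ m * (gaussWidth θ h)⁻¹ ^ m =
      (3 / 4) ^ m * airyCrit j ^ m * h ^ m := by
    rw [← mul_pow, mul_assoc, h2, mul_pow, mul_pow]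
  have h4 := airyCoeff_eq_half m
  generalize (∫ t : ℝ, (t : ℂ) ^ (2 * m) * exp (-gaussWidth θ h * (t : ℂ) ^ 2)) = J at h1 ⊢
  apply mul_left_cancel₀ sqrt_pi_ne_zero
  calc (Real.sqrt Real.pi : ℂ) * (hgC (1 / 2) m * (3 / 4 * airyCrit j * exp (θ * I)) ^ m * J)
      = hgC (1 / 2) m * (3 / 4 * airyCrit j * exp (θ * I)) ^ m * ((Real.sqrt Real.pi : ℂ) * J) := by
        ring
    _ = hgC (1 / 2) m * (Real.Gamma (m + 1 / 2) : ℂ) *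
        ((3 / 4 * airyCrit j * exp (θ * I)) ^ m * (gaussWidth θ h)⁻¹ ^ m) *
        ((Real.sqrt Real.pi : ℂ) * (exp (-(θ / 2 * I)) * h ^ (1 / 2 : ℂ))) := by rw [h1]; ring
    _ = (hgC (1 / 2) m * (Real.Gamma (m + 1 / 2) : ℂ) * (3 / 4) ^ m) *
        (airyCrit j ^ m * h ^ m) *
        ((Real.sqrt Real.pi : ℂ) * (exp (-(θ / 2 * I)) * h ^ (1 / 2 : ℂ))) := by rw [h3]; ring
    _ = _ := by rw [← h4]; ring

/-- In the closed sector Re b ≥ cos η / |h|. The Taylor remainder, of size t^{2M}, integrates to a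
multiple of (Re b)^{-M-1/2}, hence of |h|^{M+1/2}, and the division by h^{1/2} leaves |h|^M. -/
theorem exists_saddle_bound {θ : ℝ} (hθ : Real.sin θ ≠ 0) (j : Fin 2) {η : ℝ} (hη0 : 0 < η)
    (hη : η < Real.pi / 2) {M : ℕ} (hM : 1 ≤ M) :
    ∃ C : ℝ, ∀ h : ℂ, h ≠ 0 → |h.arg - θ| ≤ η →
      ‖exp (airyS (airyCrit j) / h) * (∫ t, normalIntegrand θ j h t) / h ^ (1 / 2 : ℂ) -
        ∑ m ∈ Finset.range M, PowerSeries.coeff m (airyPsi j) * h ^ m‖ ≤ C * ‖h‖ ^ M := by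
  set c := Real.cos η with hc
  have hc0 : 0 < c := Real.cos_pos_of_mem_Ioo ⟨by linarith, hη⟩
  set A : ℝ := 4 + 2 / |Real.sin θ| + M with hA
  have hA0 : 0 ≤ A := by positivity
  refine ⟨A * (Real.Gamma (M + 1 / 2) * c⁻¹ ^ M * Real.sqrt c⁻¹), fun h h0 hη' => ?_⟩
  have ha : |h.arg - θ| < Real.pi / 2 := hη'.trans_lt hη
  have hb := gaussWidth_re_pos h0 ha
  set b := gaussWidth θ h with hbdef
  have hn := norm_pos_iff.2 h0
  set R : ℝ → ℂ := fun t => rayEven θ j t - ∑ m ∈ Finset.range M,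
    hgC (1 / 2) m * (3 / 4 * airyCrit j * exp (θ * I) * (t ^ 2 : ℝ)) ^ m with hR
  have hRle (t : ℝ) : ‖R t‖ ≤ A * t ^ (2 * M) := norm_rayEven_sub_le hθ j t hM
  have hterm (m : ℕ) : Integrable fun t : ℝ => exp (-b * (t : ℂ) ^ 2) *
      (hgC (1 / 2) m * (3 / 4 * airyCrit j * exp (θ * I) * (t ^ 2 : ℝ)) ^ m) := by
    refine ((integrable_pow_mul_gauss hb (2 * m)).const_mul
      (hgC (1 / 2) m * (3 / 4 * airyCrit j * exp (θ * I)) ^ m)).congr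
      (Eventually.of_forall fun t => ?_)
    simp only
    rw [pow_mul, mul_pow _ (((t ^ 2 : ℝ)) : ℂ), ofReal_pow]
    ring
  have hgi : Integrable fun t : ℝ => A * (t ^ (2 * M) * Real.exp (-b.re * t ^ 2)) := by
    have := integrable_rpow_mul_exp_neg_mul_sq hb (s := (2 * M : ℕ))
      (by linarith [(2 * M).cast_nonneg (α := ℝ)])
    simp only [Real.rpow_natCast] at this
    exact this.const_mul A
  have hbound (t : ℝ) : ‖exp (-b * (t : ℂ) ^ 2) * R t‖ ≤
      A * (t ^ (2 * M) * Real.exp (-b.re * t ^ 2)) := by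
    rw [norm_mul, norm_cexp_neg_mul_sq]
    nlinarith [mul_le_mul_of_nonneg_left (hRle t) (Real.exp_pos (-b.re * t ^ 2)).le]
  have hRi : Integrable fun t : ℝ => exp (-b * (t : ℂ) ^ 2) * R t := by
    refine hgi.mono' ?_ (Eventually.of_forall hbound)
    have := continuous_rayEven hθ j
    exact Continuous.aestronglyMeasurable (by fun_prop)
  have hsplit : ∫ t : ℝ, exp (-b * (t : ℂ) ^ 2) * rayEven θ j t =
      (∫ t : ℝ, exp (-b * (t : ℂ) ^ 2) * R t) + ∑ m ∈ Finset.range M,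
        (Real.sqrt Real.pi : ℂ) * airyCoeff m * airyCrit j ^ m * h ^ m *
        (exp (-(θ / 2 * I)) * h ^ (1 / 2 : ℂ)) := by
    rw [← Finset.sum_congr rfl fun m _ => integral_gauss_mul_term j h0 ha m,
      ← integral_finsetSum _ fun m _ => hterm m, ← integral_add hRi
      (integrable_finsetSum _ fun m _ => hterm m)]
    congr 1
    funext t
    rw [← Finset.mul_sum, ← mul_add, hR, sub_add_cancel]
  have hh : h ^ (1 / 2 : ℂ) ≠ 0 := by simp [cpow_eq_zero_iff, h0]
  have hJ : ∫ t, normalIntegrand θ j h t = exp (-airyS (airyCrit j) / h) *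
      (airyOrientation θ j * ∫ t : ℝ, exp (-b * (t : ℂ) ^ 2) * rayEven θ j t) := by
    rw [show normalIntegrand θ j h = _ from funext (normalIntegrand_eq hθ j h),
      integral_const_mul, integral_gauss_mul_deriv hθ j hb]
  have hee : exp (airyS (airyCrit j) / h) * exp (-airyS (airyCrit j) / h) = 1 := by
    rw [← Complex.exp_add, neg_div, add_neg_cancel, Complex.exp_zero]
  have key : exp (airyS (airyCrit j) / h) * (∫ t, normalIntegrand θ j h t) / h ^ (1 / 2 : ℂ) -
      ∑ m ∈ Finset.range M, PowerSeries.coeff m (airyPsi j) * h ^ m =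
      airyOrientation θ j * (∫ t : ℝ, exp (-b * (t : ℂ) ^ 2) * R t) / h ^ (1 / 2 : ℂ) := by
    have hsum : ∑ m ∈ Finset.range M, PowerSeries.coeff m (airyPsi j) * h ^ m =
        airyOrientation θ j * (∑ m ∈ Finset.range M,
        (Real.sqrt Real.pi : ℂ) * airyCoeff m * airyCrit j ^ m * h ^ m *
        (exp (-(θ / 2 * I)) * h ^ (1 / 2 : ℂ))) / h ^ (1 / 2 : ℂ) := by
      rw [mul_div_assoc, Finset.sum_div, Finset.mul_sum]
      refine Finset.sum_congr rfl fun m _ => ?_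
      rw [coeff_airyPsi θ]
      field_simp
    rw [hsum, hJ, ← mul_assoc, hee, one_mul, hsplit, ← sub_div]
    congr 1
    ring
  rw [key, norm_div, norm_mul, norm_airyOrientation, one_mul]
  have hnh : ‖h ^ (1 / 2 : ℂ)‖ = Real.sqrt ‖h‖ := by
    have := norm_cpow_real h (1 / 2)
    push_cast at this
    rw [this, Real.sqrt_eq_rpow]
  rw [hnh, div_le_iff₀ (Real.sqrt_pos.2 hn)]
  refine (norm_integral_le_of_norm_le hgi (Eventually.of_forall hbound)).trans ?_
  rw [integral_const_mul, integral_real_pow_mul_gauss hb]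
  have hbinv : b.re⁻¹ ≤ c⁻¹ * ‖h‖ := by
    rw [hbdef, gaussWidth_re h0, inv_div, div_eq_inv_mul]
    refine mul_le_mul_of_nonneg_right (inv_anti₀ hc0 ?_) hn.le
    rw [← Real.cos_abs (h.arg - θ)]
    exact Real.cos_le_cos_of_nonneg_of_le_pi (abs_nonneg _) (by linarith [Real.pi_pos]) hη'
  have hbp : 0 ≤ b.re⁻¹ := (inv_pos.2 hb).le
  have hG : 0 ≤ Real.Gamma (M + 1 / 2) := (Real.Gamma_pos_of_pos (by positivity)).le
  calc A * (Real.Gamma (M + 1 / 2) * b.re⁻¹ ^ M * Real.sqrt b.re⁻¹)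
      ≤ A * (Real.Gamma (M + 1 / 2) * (c⁻¹ * ‖h‖) ^ M * Real.sqrt (c⁻¹ * ‖h‖)) := by
        gcongr
    _ = _ := by
        rw [mul_pow, Real.sqrt_mul (inv_pos.2 hc0).le]
        ring

theorem hasSaddleExpansion_normalCurve {θ : ℝ} (hθ : Real.sin θ ≠ 0) (j : Fin 2) {η : ℝ}
    (hη0 : 0 < η) (hη : η < Real.pi / 2) :
    HasSaddleExpansion (fun h => ∫ t, normalIntegrand θ j h t) (airyS (airyCrit j)) (airyPsi j)
      {h | h ≠ 0 ∧ |h.arg - θ| ≤ η} := by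
  intro N
  -- The bound requires at least one term; using N + 1 terms and moving the last one into the error
  -- covers N = 0 as well.
  obtain ⟨C, hC⟩ := exists_saddle_bound hθ j hη0 hη (M := N + 1) (by omega)
  refine Asymptotics.IsBigO.of_bound (|C| + ‖PowerSeries.coeff N (airyPsi j)‖) ?_
  have hball : ∀ᶠ h : ℂ in 𝓝[{h | h ≠ 0 ∧ |h.arg - θ| ≤ η}] 0, ‖h‖ < 1 := by
    filter_upwards [mem_nhdsWithin_of_mem_nhds (Metric.ball_mem_nhds (0 : ℂ) one_pos)] with h hh
    exact mem_ball_zero_iff.1 hh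
  filter_upwards [hball, self_mem_nhdsWithin] with h h1 h2
  have h3 := hC h h2.1 h2.2
  rw [Finset.sum_range_succ, ← sub_sub] at h3
  have h4 := norm_le_norm_sub_add
    (exp (airyS (airyCrit j) / h) * (∫ t, normalIntegrand θ j h t) / h ^ (1 / 2 : ℂ) -
      ∑ m ∈ Finset.range N, PowerSeries.coeff m (airyPsi j) * h ^ m)
    (PowerSeries.coeff N (airyPsi j) * h ^ N)
  refine h4.trans ?_
  rw [add_mul, norm_mul]
  refine add_le_add (h3.trans ?_) le_rfl
  rw [norm_pow]
  calc C * ‖h‖ ^ (N + 1) ≤ |C| * ‖h‖ ^ (N + 1) :=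
        mul_le_mul_of_nonneg_right (le_abs_self C) (by positivity)
    _ ≤ |C| * ‖h‖ ^ N :=
        mul_le_mul_of_nonneg_left (pow_le_pow_of_le_one (norm_nonneg h) h1.le (Nat.le_succ N))
          (abs_nonneg C)

/-! ### The ends of the thimbles -/

/-- With r² = 1 + (at)² one has r - at = 1/(r + at), so the error is 1/((r + at)t), which is small
because Re r and Re a are positive. -/
theorem tendsto_csq_add_div {a : ℂ} (ha : 0 < a.re)
    (hD : ∀ t : ℝ, 1 + (a * t) ^ 2 ∈ slitPlane) :
    Tendsto (fun t : ℝ => (csq (1 + (a * t) ^ 2) + a * t) / t) atTop (𝓝 (2 * a)) := by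
  rw [tendsto_iff_norm_sub_tendsto_zero]
  have hlim : Tendsto (fun t : ℝ => a.re⁻¹ * t⁻¹) atTop (𝓝 0) := by
    simpa using tendsto_inv_atTop_zero.const_mul a.re⁻¹
  refine squeeze_zero' (Eventually.of_forall fun _ => norm_nonneg _) ?_ hlim
  filter_upwards [eventually_ge_atTop 1] with t ht
  have ht0 : (0 : ℝ) < t := by linarith
  have htc : (t : ℂ) ≠ 0 := by exact_mod_cast ht0.ne'
  set r := csq (1 + (a * t) ^ 2) with hr
  have h1 : r ^ 2 = 1 + (a * t) ^ 2 := csq_sq (slitPlane_ne_zero (hD t))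
  have h2 : 0 < r.re := csq_re_pos (hD t)
  have h3 : a.re * t ≤ ‖r + a * t‖ := by
    refine le_trans ?_ (re_le_norm _)
    rw [add_re, re_mul_ofReal]
    linarith
  have hpos : 0 < a.re * t := mul_pos ha ht0
  have h4 : (r + a * t) / t - 2 * a = 1 / ((r + a * t) * t) := by
    have hne : r + a * t ≠ 0 := norm_pos_iff.1 (hpos.trans_le h3)
    field_simp
    linear_combination h1
  rw [h4, norm_div, norm_one, norm_mul, norm_real, Real.norm_of_nonneg ht0.le, ← mul_inv,
    ← one_div]
  refine one_div_le_one_div_of_le hpos ?_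
  nlinarith

theorem exp_mul_asn {e w : ℂ} (he : e = I ∨ e = -I) (hw : w ∈ asnDom) :
    exp (e * asn w) = csq (1 - w ^ 2) + e * w := by
  rcases he with rfl | rfl
  · rw [mul_comm, asn, exp_I_angle (csq_one_sub_sq hw), add_comm]
  · rw [show -I * asn w = -asn w * I by ring, asn, exp_neg_I_angle (csq_one_sub_sq hw)]
    ring

/-- The exponential of 2e arcsin is (√(1 + (at)²) + at)², asymptotic to 4a²t² = 3e^{iψ}t². The sign
in e = ±i is to be chosen such that Re a > 0. -/
theorem tendsto_two_mul_asn {a e : ℂ} {ψ : ℝ} (he : e = I ∨ e = -I) (ha : 0 < a.re)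
    (hψ : |ψ| < Real.pi) (h4 : 4 * a ^ 2 = 3 * exp (ψ * I))
    (hD : ∀ t : ℝ, -e * a * t ∈ asnDom) :
    Tendsto (fun t : ℝ => 2 * e * asn (-e * a * t) - (Real.log (3 * t ^ 2) : ℂ)) atTop
      (𝓝 (ψ * I)) := by
  have hψ' := abs_lt.1 hψ
  have hee : e ^ 2 = -1 := by rcases he with rfl | rfl <;> simp
  have hsq (t : ℝ) : 1 - (-e * a * t) ^ 2 = 1 + (a * t) ^ 2 := by
    linear_combination (-(a * t) ^ 2) * hee
  have hlim := (tendsto_csq_add_div ha fun t => by rw [← hsq]; exact hD t).pow 2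
  have hlim2 := hlim.div_const 3
  rw [mul_pow, show (2 : ℂ) ^ 2 = 4 by norm_num, h4, mul_div_cancel_left₀ _ three_ne_zero] at hlim2
  have hslit : exp (ψ * I) ∈ slitPlane := by
    rw [mem_slitPlane_iff_arg]
    refine ⟨?_, exp_ne_zero _⟩
    rw [arg_exp_mul_I, toIocMod_eq_self _ |>.2 ⟨hψ'.1, by linarith⟩]
    exact hψ'.2.ne
  have hlog := (continuousAt_clog hslit).tendsto.comp hlim2
  rw [log_exp (by simpa using hψ'.1) (by simpa using hψ'.2.le)] at hlog
  refine hlog.congr' ?_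
  filter_upwards [eventually_ge_atTop 1] with t ht
  have ht0 : (0 : ℝ) < t := by linarith
  have htc : (t : ℂ) ≠ 0 := by exact_mod_cast ht0.ne'
  -- The real part of the arcsine is below π/2 in modulus, so the principal logarithm recovers this
  -- quantity with no multiple of 2πi.
  have him : |(2 * e * asn (-e * a * t) - (Real.log (3 * t ^ 2) : ℂ)).im| < Real.pi := by
    have := abs_asn_re_lt (hD t)
    have e1 : |(2 * e * asn (-e * a * t) - (Real.log (3 * t ^ 2) : ℂ)).im| =
        2 * |(asn (-e * a * t)).re| := by
      rcases he with h | h <;> rw [h] <;> simp [abs_mul]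
    rw [e1]; linarith
  have him' := abs_lt.1 him
  rw [Function.comp_apply, ← log_exp him'.1 him'.2.le]
  congr 1
  rw [Complex.exp_sub, ← ofReal_exp, Real.exp_log (by positivity),
    show 2 * e * asn (-e * a * t) = (2 : ℕ) * (e * asn (-e * a * t)) by push_cast; ring,
    Complex.exp_nat_mul, exp_mul_asn he (hD t), hsq]
  have : e * (-e * a * t) = a * t := by linear_combination (-(a * t)) * hee
  rw [this]
  push_cast
  field_simp

/-- The curve `f` goes to infinity like `2 cosh (Y/3)` with `Y = log (3T²) + i(θ + κ) + o(1)`. -/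
def HasEnd (κ θ : ℝ) (f : ℝ → ℂ) : Prop :=
  ∃ Y : ℝ → ℂ, (∀ᶠ T in atTop, f T = 2 * cosh ((Y T + κ * I) / 3)) ∧
    Tendsto (fun T : ℝ => Y T - (Real.log (3 * T ^ 2) : ℂ)) atTop (𝓝 (θ * I))

theorem cos_pi_third_mul (s : ℝ) (x : ℂ) (hs : s = 1 ∨ s = -1) :
    2 * cosh (x + s * (Real.pi / 3) * I) = cosh x + s * (Real.sqrt 3 : ℂ) * I * sinh x := by
  have hc : cos ((Real.pi / 3 : ℂ)) = 1 / 2 := by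
    have := congrArg Complex.ofReal Real.cos_pi_div_three
    push_cast at this; exact this
  have hsn : sin ((Real.pi / 3 : ℂ)) = (Real.sqrt 3 : ℂ) / 2 := by
    have := congrArg Complex.ofReal Real.sin_pi_div_three
    push_cast at this; exact this
  rw [Complex.cosh_add, Complex.cosh_mul_I, Complex.sinh_mul_I]
  rcases hs with rfl | rfl
  · rw [ofReal_one, one_mul, one_mul, hc, hsn]; ring
  · rw [ofReal_neg, ofReal_one, neg_one_mul, Complex.cos_neg, Complex.sin_neg, hc, hsn]; ring

theorem cos_two_pi_third_mul (s : ℝ) (x : ℂ) (hs : s = 1 ∨ s = -1) :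
    2 * cosh (x + s * (2 * Real.pi / 3) * I) = -cosh x + s * (Real.sqrt 3 : ℂ) * I * sinh x := by
  have h := cos_pi_third_mul (-s) (x + s * Real.pi * I) (by
    rcases hs with rfl | rfl <;> simp)
  have e1 : x + s * Real.pi * I + (-s : ℝ) * (Real.pi / 3) * I =
      x + s * (2 * Real.pi / 3) * I := by push_cast; ring
  have e2 : cosh (x + s * Real.pi * I) = -cosh x ∧ sinh (x + s * Real.pi * I) = -sinh x := by
    rcases hs with rfl | rfl
    · simp [Complex.cosh_add, Complex.sinh_add, Complex.cosh_mul_I, Complex.sinh_mul_I]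
    · simp [← sub_eq_add_neg, Complex.cosh_sub, Complex.sinh_sub, Complex.cosh_mul_I,
        Complex.sinh_mul_I]
  rw [e1, e2.1, e2.2] at h
  rw [h]; push_cast; ring

/-- The two ends of the canonical thimble in terms of `Z = 2 e asn`. -/
theorem normalCurve_eq_cosh {θ : ℝ} (hθ : Real.sin θ ≠ 0) (j : Fin 2) {e : ℂ}
    (he : e = I ∨ e = -I) (t : ℝ) (s : ℝ) (hs : s = 1 ∨ s = -1) :
    normalCurve θ j (s * t) = airyCrit j *
        cosh (2 * e * asn (critRoot j * (exp (θ / 2 * I) * t)) / 3) +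
      s * (Real.sqrt 3 : ℂ) * e *
        sinh (2 * e * asn (critRoot j * (exp (θ / 2 * I) * t)) / 3) := by
  have hD := ray_mem_asnDom hθ j t
  set y := asn (critRoot j * (exp (θ / 2 * I) * t)) with hy
  have hcos : cosh (2 * e * y / 3) = cos (2 / 3 * y) := by
    rcases he with rfl | rfl
    · rw [show 2 * I * y / 3 = 2 / 3 * y * I by ring, Complex.cosh_mul_I]
    · rw [show 2 * -I * y / 3 = -(2 / 3 * y * I) by ring, Complex.cosh_neg, Complex.cosh_mul_I]
  have hsin : e * sinh (2 * e * y / 3) = -sin (2 / 3 * y) := by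
    rcases he with rfl | rfl
    · rw [show 2 * I * y / 3 = 2 / 3 * y * I by ring, Complex.sinh_mul_I]
      linear_combination sin (2 / 3 * y) * I_sq
    · rw [show 2 * -I * y / 3 = -(2 / 3 * y * I) by ring, Complex.sinh_neg, Complex.sinh_mul_I]
      linear_combination sin (2 / 3 * y) * I_sq
  rw [hcos, mul_assoc (s * (Real.sqrt 3 : ℂ)), hsin, normalCurve, sheet]
  rcases hs with rfl | rfl
  · rw [one_mul, ← hy]; push_cast; ring
  · rw [neg_one_mul, ofReal_neg, mul_neg, mul_neg, asn_neg hD, ← hy, mul_neg, Complex.cos_neg,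
      Complex.sin_neg]
    push_cast; ring

theorem HasEnd.of_cosh {κ θ ψ : ℝ} {f Z : ℝ → ℂ}
    (hZ : Tendsto (fun T : ℝ => Z T - (Real.log (3 * T ^ 2) : ℂ)) atTop (𝓝 (ψ * I)))
    (h : ∀ T, f T = 2 * cosh (Z T / 3 + (κ + θ - ψ) / 3 * I)) : HasEnd κ θ f := by
  refine ⟨fun T => Z T + (θ - ψ) * I, Eventually.of_forall fun T => ?_, ?_⟩
  · rw [h]; congr 2; ring
  · have := hZ.add_const ((θ - ψ) * I : ℂ)
    rw [show (ψ * I + (θ - ψ) * I : ℂ) = θ * I by ring] at this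
    refine this.congr fun T => by ring

theorem exp_half_re (x : ℝ) : exp ((x : ℂ) / 2 * I) = ((Real.cos (x / 2) : ℝ) : ℂ) +
    ((Real.sin (x / 2) : ℝ) : ℂ) * I := by
  rw [exp_mul_I]; push_cast; rfl

theorem four_mul_sq_sqrt_three (x : ℂ) : 4 * ((Real.sqrt 3 / 2 : ℂ) * x) ^ 2 = 3 * x ^ 2 := by
  linear_combination x ^ 2 * sqrt_three_sq

/-- At -1 the number k is imaginary, and e = -i gives a = (√3/2) e^{iθ/2}, whose real part is
positive for either sign of θ. Hence the ends lie in the same sectors on both sides. -/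
theorem hasEnd_minus {θ : ℝ} (h0 : 0 < |θ|) (h1 : |θ| < Real.pi / 2) {s : ℝ}
    (hs : s = 1 ∨ s = -1) :
    HasEnd (-s * (2 * Real.pi)) θ fun T => normalCurve θ 0 (s * T) := by
  have hθ := sin_ne_zero_of_abs_lt h0 h1
  have hl := abs_lt.1 h1
  set a : ℂ := (Real.sqrt 3 / 2 : ℂ) * exp (θ / 2 * I) with ha
  have hew (t : ℝ) : -(-I) * a * t = critRoot 0 * (exp (θ / 2 * I) * t) := by
    rw [ha]; change _ = I * (Real.sqrt 3 / 2 : ℂ) * (exp (θ / 2 * I) * t); ring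
  have hare : 0 < a.re := by
    have e : a = ((Real.sqrt 3 / 2 : ℝ) : ℂ) * exp (θ / 2 * I) := by rw [ha]; push_cast; ring
    rw [e, re_ofReal_mul, exp_half_re, add_re, ofReal_re, re_ofReal_mul, I_re, mul_zero, add_zero]
    have := Real.cos_pos_of_mem_Ioo (x := θ / 2) ⟨by linarith [Real.pi_pos], by
      linarith [Real.pi_pos]⟩
    positivity
  have hZ := tendsto_two_mul_asn (Or.inr rfl) hare (ψ := θ) (by linarith [Real.pi_pos])
    (by rw [ha, four_mul_sq_sqrt_three, exp_half_sq])
    (fun t => by rw [hew]; exact ray_mem_asnDom hθ 0 t)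
  refine HasEnd.of_cosh hZ fun T => ?_
  rw [normalCurve_eq_cosh hθ 0 (Or.inr rfl) T s hs, hew]
  have h := cos_two_pi_third_mul (-s)
    (2 * -I * asn (critRoot 0 * (exp (θ / 2 * I) * T)) / 3) (by rcases hs with rfl | rfl <;> simp)
  have e : (((-s * (2 * Real.pi) : ℝ) : ℂ) + θ - θ) / 3 * I =
      (-s : ℝ) * (2 * Real.pi / 3) * I := by push_cast; ring
  rw [e, h]
  change -1 * _ + _ = _
  push_cast; ring

/-- At 1 the number k is real, and Re a > 0 requires e = -ui with u the sign of θ. This shifts the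
phase to θ - uπ and sends the end s = 1 to the sector -2πu: here the Stokes jump arises. -/
theorem hasEnd_plus {θ u : ℝ} (hu : u = 1 ∨ u = -1) (h0 : 0 < u * θ) (h1 : u * θ < Real.pi / 2)
    {s : ℝ} (hs : s = 1 ∨ s = -1) :
    HasEnd (-u * (s + 1) * Real.pi) θ fun T => normalCurve θ 1 (s * T) := by
  have habs : |θ| = u * θ := by
    rcases hu with rfl | rfl
    · rw [one_mul] at h0 ⊢; exact abs_of_pos h0
    · rw [neg_one_mul] at h0 ⊢; exact abs_of_neg (by linarith)
  have hθ := sin_ne_zero_of_abs_lt (habs ▸ h0) (habs ▸ h1)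
  have huc : (u : ℂ) ^ 2 = 1 := by rcases hu with rfl | rfl <;> simp
  set e : ℂ := -(u * I) with he_def
  have he : e = I ∨ e = -I := by rcases hu with rfl | rfl <;> simp [he_def]
  set a : ℂ := (Real.sqrt 3 / 2 : ℂ) * (e * exp (θ / 2 * I)) with ha
  have hew (t : ℝ) : -e * a * t = critRoot 1 * (exp (θ / 2 * I) * t) := by
    rw [ha, he_def]; change _ = (Real.sqrt 3 / 2 : ℂ) * (exp (θ / 2 * I) * t)
    linear_combination (-(Real.sqrt 3 / 2 : ℂ) * (exp (θ / 2 * I) * t)) * (I_sq * u ^ 2 - huc)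
  have hare : 0 < a.re := by
    have e1 : a = ((Real.sqrt 3 / 2 * u : ℝ) : ℂ) * (-I * exp (θ / 2 * I)) := by
      rw [ha, he_def]; push_cast; ring
    have e2 : (-I * exp (θ / 2 * I)).re = Real.sin (θ / 2) := by
      rw [exp_half_re]
      generalize Real.cos (θ / 2) = c
      generalize Real.sin (θ / 2) = d
      simp
    rw [e1, re_ofReal_mul, e2]
    have h3 : 0 < u * Real.sin (θ / 2) := by
      rcases hu with rfl | rfl
      · rw [one_mul] at *
        exact Real.sin_pos_of_pos_of_lt_pi (by linarith) (by linarith [Real.pi_pos])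
      · rw [neg_one_mul] at *
        have := Real.sin_pos_of_pos_of_lt_pi (x := -(θ / 2)) (by linarith)
          (by linarith [Real.pi_pos])
        rwa [Real.sin_neg] at this
    have h4 : 0 < Real.sqrt 3 := by positivity
    nlinarith [mul_pos h4 h3]
  have hexp : exp (((θ - u * Real.pi : ℝ) : ℂ) * I) = -exp (θ * I) := by
    rw [ofReal_sub, sub_mul, Complex.exp_sub]
    rcases hu with rfl | rfl
    · simp [div_neg]
    · simp [Complex.exp_neg, div_neg]
  have hψ : |θ - u * Real.pi| < Real.pi := by
    rw [abs_lt]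
    rcases hu with rfl | rfl <;> constructor <;> linarith [Real.pi_pos]
  have hZ := tendsto_two_mul_asn he hare (ψ := θ - u * Real.pi) hψ
    (by rw [ha, four_mul_sq_sqrt_three, mul_pow, exp_half_sq, hexp, he_def]
        linear_combination (3 * exp (θ * I)) * (I_sq * u ^ 2 - huc))
    (fun t => by rw [hew]; exact ray_mem_asnDom hθ 1 t)
  refine HasEnd.of_cosh hZ fun T => ?_
  rw [normalCurve_eq_cosh hθ 1 he T s hs, hew]
  have h := cos_pi_third_mul (-(u * s))
    (2 * e * asn (critRoot 1 * (exp (θ / 2 * I) * T)) / 3)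
    (by rcases hs with rfl | rfl <;> rcases hu with rfl | rfl <;> simp)
  have e3 : (((-u * (s + 1) * Real.pi : ℝ) : ℂ) + θ - ((θ - u * Real.pi : ℝ) : ℂ)) / 3 * I =
      ((-(u * s) : ℝ) : ℂ) * (Real.pi / 3) * I := by push_cast; ring
  rw [e3, h]
  change 1 * _ + _ = _
  rw [he_def]; push_cast; ring

/-! ### Sectors at infinity -/

/-- The term e^Y is turned by an angle of at most μ, and the term e^{-Y} contributes at least -1. -/
theorem re_exp_mul_cosh_ge {φ μ : ℝ} {Y : ℂ} (hx : 0 ≤ Y.re) (h : |Y.im| + |φ| ≤ μ)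
    (hμ : μ ≤ Real.pi) :
    (Real.exp Y.re * Real.cos μ - 1) / 2 ≤ (exp (-(φ : ℂ) * I) * cosh Y).re := by
  have e : exp (-(φ : ℂ) * I) * cosh Y =
      (exp (((Y.re : ℝ) : ℂ) + ((Y.im - φ : ℝ) : ℂ) * I) +
        exp (((-Y.re : ℝ) : ℂ) + ((-Y.im - φ : ℝ) : ℂ) * I)) / 2 := by
    rw [Complex.cosh, mul_div_assoc', mul_add, ← Complex.exp_add, ← Complex.exp_add]
    conv_lhs => rw [← re_add_im Y]
    congr 3 <;> push_cast <;> ring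
  have h1 : Real.cos μ ≤ Real.cos (Y.im - φ) := by
    rw [← Real.cos_abs (Y.im - φ)]
    exact Real.cos_le_cos_of_nonneg_of_le_pi (abs_nonneg _) hμ ((abs_sub _ _).trans h)
  have h2 : Real.exp (-Y.re) * Real.cos (-Y.im - φ) ≥ -1 := by
    have a1 : Real.exp (-Y.re) ≤ 1 := Real.exp_le_one_iff.2 (by linarith)
    nlinarith [Real.neg_one_le_cos (-Y.im - φ), Real.exp_pos (-Y.re)]
  have e2 : (exp (-(φ : ℂ) * I) * cosh Y).re = (Real.exp Y.re * Real.cos (Y.im - φ) +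
      Real.exp (-Y.re) * Real.cos (-Y.im - φ)) / 2 := by
    rw [e, show (2 : ℂ) = ((2 : ℝ) : ℂ) by norm_num, div_ofReal_re, add_re, Complex.exp_add,
      Complex.exp_add, ← ofReal_exp, ← ofReal_exp, re_ofReal_mul, re_ofReal_mul,
      exp_ofReal_mul_I_re, exp_ofReal_mul_I_re]
  rw [e2]
  nlinarith [mul_le_mul_of_nonneg_left h1 (Real.exp_pos Y.re).le]

theorem airyS_two_cosh {κ : ℝ} (hκ : exp (κ * I) = 1) (Y : ℂ) :
    airyS (2 * cosh ((Y + κ * I) / 3)) = 2 / 3 * cosh Y := by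
  have h1 : cosh (3 * ((Y + κ * I) / 3)) = cosh Y := by
    rw [show 3 * ((Y + κ * I) / 3) = Y + κ * I by ring, Complex.cosh, Complex.cosh, neg_add,
      Complex.exp_add, Complex.exp_add, Complex.exp_neg (κ * I), hκ]
    simp
  rw [Complex.cosh_three_mul] at h1
  rw [airyS, ← h1]
  ring

theorem norm_sinh_le {z : ℂ} (hz : 0 ≤ z.re) : ‖sinh z‖ ≤ Real.exp z.re := by
  rw [Complex.sinh, norm_div, Complex.norm_two]
  have h1 := norm_sub_le (exp z) (exp (-z))
  rw [norm_exp, norm_exp, neg_re] at h1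
  have h2 : Real.exp (-z.re) ≤ Real.exp z.re := Real.exp_le_exp.2 (by linarith)
  linarith

theorem exp_neg_le_two_div_sq {u : ℝ} (hu : 0 < u) : Real.exp (-u) ≤ 2 / u ^ 2 := by
  rw [Real.exp_neg, inv_eq_one_div, div_le_div_iff₀ (Real.exp_pos u) (by positivity)]
  have := Real.quadratic_le_exp_of_nonneg hu.le
  nlinarith

theorem re_div_eq (v h : ℂ) : (v / h).re = ‖h‖⁻¹ * (exp (-(h.arg : ℂ) * I) * v).re := by
  rcases eq_or_ne h 0 with rfl | h0
  · simp
  have : v / h = ((‖h‖⁻¹ : ℝ) : ℂ) * (exp (-(h.arg : ℂ) * I) * v) := by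
    conv_lhs => rw [← norm_mul_exp_arg_mul_I h]
    rw [neg_mul, Complex.exp_neg, ofReal_inv]
    have := norm_ne_zero_iff.2 h0
    field_simp
  rw [this, re_ofReal_mul]

/-- The half strip that parametrizes a sector at infinity. -/
def endStrip (δ X : ℝ) : Set ℂ := {Y | X ≤ Y.re ∧ |Y.im| ≤ δ}

theorem convex_endStrip (δ X : ℝ) : Convex ℝ (endStrip δ X) := by
  have h1 : Convex ℝ {Y : ℂ | X ≤ Y.re} := convex_halfSpace_re_ge X
  have h2 : Convex ℝ {Y : ℂ | Y.im ≤ δ} := convex_halfSpace_im_le δ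
  have h3 : Convex ℝ {Y : ℂ | -δ ≤ Y.im} := convex_halfSpace_im_ge (-δ)
  have : endStrip δ X = {Y : ℂ | X ≤ Y.re} ∩ ({Y : ℂ | -δ ≤ Y.im} ∩ {Y : ℂ | Y.im ≤ δ}) := by
    ext Y; simp [endStrip, abs_le]
  rw [this]
  exact h1.inter (h3.inter h2)

/-- The exponential of -S/h decays like exp(-A e^{Re Y}), while the hyperbolic sine grows at most
like e^{Re Y}. The crude bound e^{-u} ≤ 2/u² at u = A e^{Re Y} already beats this growth. -/
theorem exists_deriv_bound {κ δ : ℝ} {h : ℂ} (hκ : exp (κ * I) = 1) (h0 : h ≠ 0)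
    (hδ : δ + |h.arg| < Real.pi / 2) : ∃ C : ℝ, 0 ≤ C ∧ ∀ X, 0 ≤ X → ∀ Y ∈ endStrip δ X,
      ‖exp (-airyS (2 * cosh ((Y + κ * I) / 3)) / h) * (2 / 3 * sinh ((Y + κ * I) / 3))‖ ≤
        C * Real.exp (-X) := by
  by_cases hδ0 : 0 ≤ δ
  swap
  · refine ⟨0, le_rfl, fun X _ Y hY => ?_⟩
    exact absurd ((abs_nonneg _).trans hY.2) hδ0
  set μ := δ + |h.arg| with hμ
  have hn := norm_pos_iff.2 h0
  set c := Real.cos μ with hc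
  have hμ0 : 0 ≤ μ := by positivity
  have hc0 : 0 < c := Real.cos_pos_of_mem_Ioo ⟨by linarith [Real.pi_pos], by linarith⟩
  set A := ‖h‖⁻¹ * (c / 3) with hA
  have hA0 : 0 < A := by positivity
  set K := Real.exp (‖h‖⁻¹ / 3) with hK
  have hK0 : 0 < K := Real.exp_pos _
  refine ⟨K * (2 / A ^ 2), by positivity, fun X hX Y hY => ?_⟩
  have hx : 0 ≤ Y.re := hX.trans hY.1
  have hE := Real.exp_pos Y.re
  have h1 : ‖exp (-airyS (2 * cosh ((Y + κ * I) / 3)) / h)‖ ≤ K * (2 / (A * Real.exp Y.re) ^ 2) := by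
    have h2 := re_exp_mul_cosh_ge (φ := h.arg) (μ := μ) hx (by linarith [hY.2])
      (by linarith [Real.pi_pos])
    have e : (-airyS (2 * cosh ((Y + κ * I) / 3)) / h).re =
        -(‖h‖⁻¹ * (2 / 3 * (exp (-(h.arg : ℂ) * I) * cosh Y).re)) := by
      rw [neg_div, neg_re, airyS_two_cosh hκ, re_div_eq, mul_left_comm (exp _),
        show (2 / 3 : ℂ) = ((2 / 3 : ℝ) : ℂ) by norm_num, re_ofReal_mul]
    rw [norm_exp, e]
    have h3 : -(‖h‖⁻¹ * (2 / 3 * (exp (-(h.arg : ℂ) * I) * cosh Y).re)) ≤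
        ‖h‖⁻¹ / 3 + -(A * Real.exp Y.re) := by
      have := mul_le_mul_of_nonneg_left h2 (inv_pos.2 hn).le
      rw [hA]
      nlinarith
    refine (Real.exp_le_exp.2 h3).trans ?_
    rw [Real.exp_add]
    exact mul_le_mul_of_nonneg_left (exp_neg_le_two_div_sq (by positivity)) hK0.le
  have hre : ((Y + κ * I) / 3).re = Y.re / 3 := by
    rw [show (3 : ℂ) = ((3 : ℝ) : ℂ) by norm_num, div_ofReal_re]; simp
  have h4 : ‖(2 / 3 * sinh ((Y + κ * I) / 3))‖ ≤ Real.exp Y.re := by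
    have h5 := norm_sinh_le (z := (Y + κ * I) / 3) (by rw [hre]; positivity)
    rw [hre] at h5
    have h6 : Real.exp (Y.re / 3) ≤ Real.exp Y.re := Real.exp_le_exp.2 (by linarith)
    have h7 : ‖(2 / 3 : ℂ)‖ = 2 / 3 := by simp
    rw [norm_mul, h7]
    nlinarith [norm_nonneg (sinh ((Y + κ * I) / 3))]
  rw [norm_mul]
  calc _ ≤ K * (2 / (A * Real.exp Y.re) ^ 2) * Real.exp Y.re :=
        mul_le_mul h1 h4 (norm_nonneg _) (by positivity)
    _ = K * (2 / A ^ 2) * Real.exp (-Y.re) := by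
        rw [Real.exp_neg]; field_simp
    _ ≤ K * (2 / A ^ 2) * Real.exp (-X) := by
        refine mul_le_mul_of_nonneg_left (Real.exp_le_exp.2 ?_) (by positivity)
        linarith [hY.1]

theorem tendsto_log_three_mul_sq : Tendsto (fun T : ℝ => Real.log (3 * T ^ 2)) atTop atTop :=
  Real.tendsto_log_atTop.comp ((tendsto_pow_atTop two_ne_zero).const_mul_atTop three_pos)

theorem eventually_mem_endStrip {θ δ : ℝ} {Y : ℝ → ℂ} (hθ : |θ| < δ)
    (hY : Tendsto (fun T : ℝ => Y T - (Real.log (3 * T ^ 2) : ℂ)) atTop (𝓝 (θ * I))) :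
    ∀ᶠ T in atTop, Y T ∈ endStrip δ (Real.log (3 * T ^ 2) - 1) := by
  have h1 := (continuous_re.tendsto _).comp hY
  have h2 := ((continuous_im.tendsto _).comp hY).abs
  simp only [re_ofReal_mul, I_re, mul_zero] at h1
  simp only [im_ofReal_mul, I_im, mul_one] at h2
  filter_upwards [h1.eventually (eventually_gt_nhds (by norm_num : (-1 : ℝ) < 0)),
    h2.eventually (eventually_lt_nhds hθ)] with T h3 h4
  simp only [Function.comp_apply, sub_re, ofReal_re] at h3
  simp only [Function.comp_apply, sub_im, ofReal_im, sub_zero] at h4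
  exact ⟨by linarith, h4.le⟩

/-- Primitives of `e^{-S/ħ}` have the same limit along curves that end in the same sector. -/
theorem HasEnd.tendsto_sub {κ θ₁ θ₂ ε : ℝ} {f g : ℝ → ℂ} {P : ℂ → ℂ} {h : ℂ}
    (hf : HasEnd κ θ₁ f) (hg : HasEnd κ θ₂ g) (hκ : exp (κ * I) = 1) (h1 : |θ₁| ≤ ε)
    (h2 : |θ₂| ≤ ε) (h0 : h ≠ 0) (ha : |h.arg| < Real.pi / 2 - ε)
    (hP : ∀ z, HasDerivAt P (exp (-airyS z / h)) z) :
    Tendsto (fun T => P (f T) - P (g T)) atTop (𝓝 0) := by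
  obtain ⟨Y₁, hf1, hY1⟩ := hf
  obtain ⟨Y₂, hg1, hY2⟩ := hg
  -- The strip has to contain both curves eventually and still lie in the sector of decay for h.
  obtain ⟨δ, hδ1, hδ2⟩ := exists_between (show ε < Real.pi / 2 - |h.arg| by linarith)
  obtain ⟨C, hC0, hC⟩ := exists_deriv_bound (κ := κ) (δ := δ) hκ h0 (by linarith)
  set Q : ℂ → ℂ := fun Y => P (2 * cosh ((Y + κ * I) / 3)) with hQ
  have hQd (Y : ℂ) : HasDerivAt Q (exp (-airyS (2 * cosh ((Y + κ * I) / 3)) / h) *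
      (2 / 3 * sinh ((Y + κ * I) / 3))) Y := by
    have h3 := ((((hasDerivAt_id Y).add_const (κ * I : ℂ)).div_const 3).ccosh.const_mul 2)
    refine ((hP _).comp Y h3).congr_deriv ?_
    simp only [id]
    ring
  -- The points Y₁ and Y₂ stay at bounded distance while the derivative on the convex strip tends to
  -- 0, so the mean value inequality finishes.
  have hdist := (hY1.sub hY2).norm
  have hlim : Tendsto (fun T : ℝ => C * Real.exp (-(Real.log (3 * T ^ 2) - 1)) *
      ‖Y₁ T - (Real.log (3 * T ^ 2) : ℂ) - (Y₂ T - (Real.log (3 * T ^ 2) : ℂ))‖) atTop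
      (𝓝 (C * 0 * ‖(θ₁ * I - θ₂ * I : ℂ)‖)) := by
    refine Tendsto.mul ?_ hdist
    refine (Real.tendsto_exp_neg_atTop_nhds_zero.comp ?_).const_mul C
    exact tendsto_atTop_add_const_right _ (-1) tendsto_log_three_mul_sq
  rw [mul_zero, zero_mul] at hlim
  rw [tendsto_zero_iff_norm_tendsto_zero]
  refine squeeze_zero' (Eventually.of_forall fun _ => norm_nonneg _) ?_ hlim
  filter_upwards [hf1, hg1, eventually_mem_endStrip (h1.trans_lt hδ1) hY1,
    eventually_mem_endStrip (h2.trans_lt hδ1) hY2,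
    tendsto_log_three_mul_sq.eventually_ge_atTop 1] with T e1 e2 m1 m2 hT
  rw [e1, e2, sub_sub_sub_cancel_right]
  exact (convex_endStrip δ _).norm_image_sub_le_of_norm_hasDerivWithin_le
    (fun Y _ => (hQd Y).hasDerivWithinAt) (fun Y hY => hC _ (by linarith) Y hY) m2 m1

/-! ### The jump of the thimble integrals -/

theorem exists_primitive (h : ℂ) :
    ∃ P : ℂ → ℂ, ∀ z, HasDerivAt P (exp (-airyS z / h)) z := by
  have hd : Differentiable ℂ fun z => exp (-airyS z / h) := fun z =>
    ((airyS_hasDerivAt z).neg.div_const h).cexp.differentiableAt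
  obtain ⟨P, hP⟩ := hd.isExactOn_univ
  exact ⟨P, fun z => hP z trivial⟩

theorem tendsto_primitive_sub {θ : ℝ} (hθ : Real.sin θ ≠ 0) (j : Fin 2) {h : ℂ} (h0 : h ≠ 0)
    (ha : |h.arg - θ| < Real.pi / 2) {P : ℂ → ℂ}
    (hP : ∀ z, HasDerivAt P (exp (-airyS z / h)) z) :
    Tendsto (fun T : ℝ => P (normalCurve θ j (1 * T)) - P (normalCurve θ j (-1 * T))) atTop
      (𝓝 (∫ t, normalIntegrand θ j h t)) := by
  have hi := integrable_normalIntegrand hθ j h0 ha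
  refine (intervalIntegral_tendsto_integral hi tendsto_neg_atTop_atBot tendsto_id).congr
    fun T => ?_
  have hd (t : ℝ) : HasDerivAt (fun t => P (normalCurve θ j t)) (normalIntegrand θ j h t) t :=
    (hP _).comp t ((normalCurve_isNormalCurve hθ j).hasDerivAt t)
  rw [intervalIntegral.integral_eq_sub_of_hasDerivAt (fun t _ => hd t) hi.intervalIntegrable,
    one_mul, neg_one_mul]
  rfl

theorem exp_two_pi_mul {s : ℝ} (hs : s = 1 ∨ s = -1) :
    exp (((-s * (2 * Real.pi) : ℝ) : ℂ) * I) = 1 := by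
  rcases hs with rfl | rfl
  · rw [show (((-1 * (2 * Real.pi) : ℝ) : ℂ) * I) = -(2 * Real.pi * I) by push_cast; ring,
      Complex.exp_neg, Complex.exp_two_pi_mul_I, inv_one]
  · rw [show (((- -1 * (2 * Real.pi) : ℝ) : ℂ) * I) = 2 * Real.pi * I by push_cast; ring,
      Complex.exp_two_pi_mul_I]

/-- The three sectors in which the thimbles end. -/
structure JumpEnds (ε : ℝ) : Prop where
  minus : ∀ θ ∈ ({ε, -ε} : Set ℝ), ∀ s ∈ ({1, -1} : Set ℝ),
    HasEnd (-s * (2 * Real.pi)) θ fun T => normalCurve θ 0 (s * T)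
  plus_right : HasEnd (-1 * (2 * Real.pi)) ε fun T => normalCurve ε 1 (1 * T)
  plus_left : HasEnd (- -1 * (2 * Real.pi)) (-ε) fun T => normalCurve (-ε) 1 (1 * T)
  plus_neg : ∀ θ ∈ ({ε, -ε} : Set ℝ), HasEnd 0 θ fun T => normalCurve θ 1 (-1 * T)

theorem jumpEnds {ε : ℝ} (h0 : 0 < ε) (h1 : ε < Real.pi / 2) : JumpEnds ε where
  minus := by
    rintro θ hθ s hs
    have habs : |θ| = ε := by
      rcases hθ with rfl | rfl
      · exact abs_of_pos h0
      · rw [abs_neg]; exact abs_of_pos h0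
    exact hasEnd_minus (habs ▸ h0) (habs ▸ h1) hs
  plus_right := by
    have := hasEnd_plus (θ := ε) (u := 1) (Or.inl rfl) (by linarith) (by linarith) (Or.inl rfl)
    rwa [show (-1 * (1 + 1) * Real.pi : ℝ) = -1 * (2 * Real.pi) by ring] at this
  plus_left := by
    have := hasEnd_plus (θ := -ε) (u := -1) (Or.inr rfl) (by linarith) (by linarith) (Or.inl rfl)
    rwa [show (- -1 * (1 + 1) * Real.pi : ℝ) = - -1 * (2 * Real.pi) by ring] at this
  plus_neg := by
    rintro θ (rfl | rfl)
    · have := hasEnd_plus (θ := θ) (u := 1) (Or.inl rfl) (by linarith) (by linarith) (Or.inr rfl)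
      rwa [show (-1 * (-1 + 1) * Real.pi : ℝ) = 0 by ring] at this
    · have := hasEnd_plus (θ := -ε) (u := -1) (Or.inr rfl) (by linarith) (by linarith)
        (Or.inr rfl)
      rwa [show (- -1 * (-1 + 1) * Real.pi : ℝ) = 0 by ring] at this

/-- Each integral is a difference of limits of one primitive, and these depend only on the sector.
At phase ε the thimble through 1 ends where the one through -1 ends, at phase -ε where it starts, so
the two integrals differ by that over the thimble through -1. -/
theorem integral_jump {ε : ℝ} (hε : 0 < ε) (hε2 : ε < Real.pi / 2) {h : ℂ} (h0 : h ≠ 0)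
    (ha : |h.arg| < Real.pi / 2 - ε) :
    (∫ t, normalIntegrand (-ε) 0 h t) = (∫ t, normalIntegrand ε 0 h t) ∧
    (∫ t, normalIntegrand (-ε) 1 h t) =
      -(∫ t, normalIntegrand ε 0 h t) + ∫ t, normalIntegrand ε 1 h t := by
  obtain ⟨P, hP⟩ := exists_primitive h
  have hsr : Real.sin ε ≠ 0 := sin_ne_zero_of_abs_lt (by rwa [abs_of_pos hε])
    (by rwa [abs_of_pos hε])
  have hsl : Real.sin (-ε) ≠ 0 := by rwa [Real.sin_neg, neg_ne_zero]
  have har : |h.arg - ε| < Real.pi / 2 := by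
    have := abs_lt.1 ha
    rw [abs_lt]; constructor <;> linarith
  have hal : |h.arg - -ε| < Real.pi / 2 := by
    have := abs_lt.1 ha
    rw [abs_lt]; constructor <;> linarith
  have e1 : |ε| ≤ ε := (abs_of_pos hε).le
  have e2 : |-ε| ≤ ε := by rw [abs_neg]; exact e1
  have r0 := tendsto_primitive_sub hsr 0 h0 har hP
  have r1 := tendsto_primitive_sub hsr 1 h0 har hP
  have l0 := tendsto_primitive_sub hsl 0 h0 hal hP
  have l1 := tendsto_primitive_sub hsl 1 h0 hal hP
  have E := jumpEnds hε hε2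
  have k1 := exp_two_pi_mul (s := 1) (Or.inl rfl)
  have k2 := exp_two_pi_mul (s := -1) (Or.inr rfl)
  have k0 : exp (((0 : ℝ) : ℂ) * I) = 1 := by simp
  have d1 := (E.minus (-ε) (by simp) 1 (by simp)).tendsto_sub (E.minus ε (by simp) 1 (by simp)) k1
    e2 e1 h0 ha hP
  have d2 := (E.minus (-ε) (by simp) (-1) (by simp)).tendsto_sub
    (E.minus ε (by simp) (-1) (by simp)) k2 e2 e1 h0 ha hP
  have d3 := E.plus_right.tendsto_sub (E.minus ε (by simp) 1 (by simp)) k1 e1 e1 h0 ha hP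
  have d4 := E.plus_left.tendsto_sub (E.minus ε (by simp) (-1) (by simp)) k2 e2 e1 h0 ha hP
  have d5 := (E.plus_neg (-ε) (by simp)).tendsto_sub (E.plus_neg ε (by simp)) k0 e2 e1 h0 ha hP
  constructor
  · have := (d1.sub d2).add r0
    rw [sub_zero, zero_add] at this
    exact tendsto_nhds_unique (l0.congr fun T => by ring) this
  · have := ((d4.sub d3).sub d5).add ((r0.neg).add r1)
    rw [sub_zero, sub_zero, zero_add] at this
    exact tendsto_nhds_unique (l1.congr fun T => by ring) this

theorem expIntegral_jump {ε : ℝ} (hε : 0 < ε) (hε2 : ε < Real.pi / 2) {γl γr : Fin 2 → C(ℝ, ℂ)}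
    (hl : ∀ j, IsOrientedThimble airyS (-ε) (airyCrit j) (airyOrientation (-ε) j) (γl j))
    (hr : ∀ j, IsOrientedThimble airyS ε (airyCrit j) (airyOrientation ε j) (γr j))
    {h : ℂ} (h0 : h ≠ 0) (ha : |h.arg| < Real.pi / 2 - ε) :
    (∀ j, expIntegral airyS (γl j) h =
      ∑ i : Fin 2, (airyStokesMatrix i j : ℂ) * expIntegral airyS (γr i) h) ∧
    (∀ j, expIntegral airyS (γr j) h =
      ∑ i : Fin 2, (airyJumpMatrix i j : ℂ) * expIntegral airyS (γl i) h) := by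
  have hsr : Real.sin ε ≠ 0 := sin_ne_zero_of_abs_lt (by rwa [abs_of_pos hε])
    (by rwa [abs_of_pos hε])
  have hsl : Real.sin (-ε) ≠ 0 := by rwa [Real.sin_neg, neg_ne_zero]
  obtain ⟨j1, j2⟩ := integral_jump hε hε2 h0 ha
  have el (j : Fin 2) := ((hl j).integrable_and_integral hsl h).2
  have er (j : Fin 2) := ((hr j).integrable_and_integral hsr h).2
  constructor
  · intro j
    fin_cases j
    · simp [Fin.sum_univ_two, airyStokesMatrix, el, er, j1]
    · simp [Fin.sum_univ_two, airyStokesMatrix, el, er, j2]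
  · intro j
    fin_cases j
    · simp [Fin.sum_univ_two, airyJumpMatrix, el, er, j1]
    · simp [Fin.sum_univ_two, airyJumpMatrix, el, er, j1, j2]

/-! ### Relative one-dimensional homology of the plane -/

theorem stdSimplex_map_apply {m n : ℕ} (f : Fin m → Fin n) (x : stdSimplex ℝ (Fin m)) (k : Fin n) :
    (stdSimplex.map f x).1 k = ∑ i with f i = k, x.1 i :=
  FunOnFinite.linearMap_apply_apply ..

theorem stdSimplex_two_add (x : stdSimplex ℝ (Fin 2)) : x.1 0 + x.1 1 = 1 := by
  have := x.2.2
  rwa [Fin.sum_univ_two] at this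

theorem continuous_coord {n : ℕ} (k : Fin n) :
    Continuous fun x : stdSimplex ℝ (Fin n) => x.1 k :=
  (continuous_apply k).comp continuous_subtype_val

/-- The linear singular simplex from `0` to `a`. -/
def segmentFromZero (a : ℂ) : C(stdSimplex ℝ (Fin 2), ℂ) :=
  ⟨fun x => x.1 1 • a, (continuous_coord 1).smul continuous_const⟩

/-- The singular simplex given by a curve on `[0, 1]`. -/
def curveSimplex (g : C(ℝ, ℂ)) : C(stdSimplex ℝ (Fin 2), ℂ) :=
  ⟨fun x => g (x.1 1), g.continuous.comp (continuous_coord 1)⟩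

/-- The cone with apex `0` over a curve on `[0, 1]`. -/
def coneSimplex (g : C(ℝ, ℂ)) : C(stdSimplex ℝ (Fin 3), ℂ) where
  toFun x := (x.1 1 + x.1 2) • g (x.1 2 / (x.1 1 + x.1 2))
  continuous_toFun := by
    have c1 := continuous_coord (n := 3) 1
    have c2 := continuous_coord (n := 3) 2
    refine continuous_iff_continuousAt.2 fun x => ?_
    -- At the apex the quotient is the default 0/0 = 0. The values of g on [0, 1] are bounded and
    -- the factor in front tends to 0, so continuity holds.
    by_cases hx : x.1 1 + x.1 2 = 0
    · obtain ⟨C, hC⟩ := (isCompact_Icc (a := (0 : ℝ)) (b := 1)).exists_bound_of_continuousOn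
        g.continuous.continuousOn
      rw [ContinuousAt, hx, zero_smul, tendsto_zero_iff_norm_tendsto_zero]
      have hlim : Tendsto (fun y : stdSimplex ℝ (Fin 3) => (y.1 1 + y.1 2) * C) (𝓝 x) (𝓝 0) := by
        have := ((c1.add c2).tendsto x).mul_const C
        rwa [Pi.add_apply, hx, zero_mul] at this
      refine squeeze_zero (fun _ => norm_nonneg _) (fun y => ?_) hlim
      have h1 := y.2.1 1
      have h2 := y.2.1 2
      rw [norm_smul, Real.norm_of_nonneg (add_nonneg h1 h2)]
      refine mul_le_mul_of_nonneg_left (hC _ ⟨div_nonneg h2 (add_nonneg h1 h2), ?_⟩)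
        (add_nonneg h1 h2)
      exact div_le_one_of_le₀ (by linarith) (add_nonneg h1 h2)
    · exact (c1.add c2).continuousAt.smul (g.continuous.continuousAt.comp
        (c2.continuousAt.div (c1.add c2).continuousAt hx))

theorem coneSimplex_face_zero (g : C(ℝ, ℂ)) : singFace 0 (coneSimplex g) = curveSimplex g := by
  ext x
  change ((stdSimplex.map (Fin.succAbove 0) x).1 1 + (stdSimplex.map (Fin.succAbove 0) x).1 2) •
    g ((stdSimplex.map (Fin.succAbove 0) x).1 2 / ((stdSimplex.map (Fin.succAbove 0) x).1 1 +
      (stdSimplex.map (Fin.succAbove 0) x).1 2)) = g (x.1 1)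
  have h1 : (stdSimplex.map (Fin.succAbove 0) x).1 1 = x.1 0 := by
    rw [stdSimplex_map_apply, Finset.sum_filter, Fin.sum_univ_two]; simp
  have h2 : (stdSimplex.map (Fin.succAbove 0) x).1 2 = x.1 1 := by
    rw [stdSimplex_map_apply, Finset.sum_filter, Fin.sum_univ_two]; simp
  rw [h1, h2, stdSimplex_two_add, one_smul, div_one]

theorem coneSimplex_face_one (g : C(ℝ, ℂ)) :
    singFace 1 (coneSimplex g) = segmentFromZero (g 1) := by
  ext x
  change ((stdSimplex.map (Fin.succAbove 1) x).1 1 + (stdSimplex.map (Fin.succAbove 1) x).1 2) •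
    g ((stdSimplex.map (Fin.succAbove 1) x).1 2 / ((stdSimplex.map (Fin.succAbove 1) x).1 1 +
      (stdSimplex.map (Fin.succAbove 1) x).1 2)) = x.1 1 • g 1
  have h1 : (stdSimplex.map (Fin.succAbove 1) x).1 1 = 0 := by
    rw [stdSimplex_map_apply, Finset.sum_filter, Fin.sum_univ_two]; simp
  have h2 : (stdSimplex.map (Fin.succAbove 1) x).1 2 = x.1 1 := by
    rw [stdSimplex_map_apply, Finset.sum_filter, Fin.sum_univ_two]; simp [Fin.succAbove]
  rw [h1, h2, zero_add]
  rcases eq_or_ne (x.1 1) 0 with h | h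
  · rw [h, zero_smul, zero_smul]
  · rw [div_self h]

theorem coneSimplex_face_two (g : C(ℝ, ℂ)) :
    singFace 2 (coneSimplex g) = segmentFromZero (g 0) := by
  ext x
  change ((stdSimplex.map (Fin.succAbove 2) x).1 1 + (stdSimplex.map (Fin.succAbove 2) x).1 2) •
    g ((stdSimplex.map (Fin.succAbove 2) x).1 2 / ((stdSimplex.map (Fin.succAbove 2) x).1 1 +
      (stdSimplex.map (Fin.succAbove 2) x).1 2)) = x.1 1 • g 0
  have h1 : (stdSimplex.map (Fin.succAbove 2) x).1 1 = x.1 1 := by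
    rw [stdSimplex_map_apply, Finset.sum_filter, Fin.sum_univ_two]; simp [Fin.succAbove]
  have h2 : (stdSimplex.map (Fin.succAbove 2) x).1 2 = 0 := by
    rw [stdSimplex_map_apply, Finset.sum_filter, Fin.sum_univ_two]; simp [Fin.succAbove]
  rw [h1, h2, add_zero, zero_div]

/-- A singular simplex given by a curve is homologous to the difference of two segments. -/
theorem curveSimplex_sub_mem (A : Set ℂ) (g : C(ℝ, ℂ)) :
    Finsupp.single (curveSimplex g) (1 : ℤ) - (Finsupp.single (segmentFromZero (g 1)) 1 -
      Finsupp.single (segmentFromZero (g 0)) 1) ∈ relBoundaries A 0 := by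
  refine Submodule.mem_sup_left ⟨Finsupp.single (coneSimplex g) 1, ?_⟩
  rw [singBoundary, Finsupp.linearCombination_single, one_smul, Fin.sum_univ_three,
    coneSimplex_face_zero, coneSimplex_face_one, coneSimplex_face_two]
  simp only [Fin.val_zero, Fin.val_one, Fin.val_two, pow_zero, pow_one, one_smul, neg_smul,
    even_two.neg_one_pow]
  abel

/-- A path inside A is a chain of A, hence trivial in the relative group, and the cone over it
compares the two segments. -/
theorem segmentFromZero_sub_mem {A : Set ℂ} {a b : ℂ} (h : JoinedIn A a b) :
    Finsupp.single (segmentFromZero b) (1 : ℤ) - Finsupp.single (segmentFromZero a) 1 ∈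
      relBoundaries A 0 := by
  obtain ⟨p, hp⟩ := h
  have h1 := curveSimplex_sub_mem A ⟨p.extend, p.continuous_extend⟩
  simp only [ContinuousMap.coe_mk, Path.extend_one, Path.extend_zero] at h1
  have h2 : Finsupp.single (curveSimplex ⟨p.extend, p.continuous_extend⟩) (1 : ℤ) ∈
      relBoundaries A 0 := by
    refine Submodule.mem_sup_right (Finsupp.single_mem_supported ℤ 1 ?_)
    rintro - ⟨x, rfl⟩
    have hx : x.1 1 ∈ Icc (0 : ℝ) 1 := ⟨x.2.1 1, by
      have := x.2.1 0
      have := stdSimplex_two_add x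
      linarith⟩
    change p.extend (x.1 1) ∈ A
    rw [Path.extend_apply p hx]
    exact hp _
  have := Submodule.sub_mem _ h2 h1
  rwa [sub_sub_cancel] at this

theorem truncatedChain_eq (γ : C(ℝ, ℂ)) (T : ℝ) : truncatedChain γ T =
    Finsupp.single (curveSimplex ⟨fun s => γ (T * (2 * s - 1)), by fun_prop⟩) 1 := by
  rw [truncatedChain]
  congr 1
  ext x
  change γ (T * (x.1 1 - x.1 0)) = γ (T * (2 * x.1 1 - 1))
  rw [← stdSimplex_two_add x]
  congr 2
  ring

theorem truncatedChain_mem_relCycles {A : Set ℂ} {γ : C(ℝ, ℂ)} {T : ℝ} (h1 : γ T ∈ A)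
    (h2 : γ (-T) ∈ A) : truncatedChain γ T ∈ relCycles A 0 := by
  change singBoundary ℂ 0 (truncatedChain γ T) ∈ chainsIn A 0
  rw [truncatedChain, singBoundary, Finsupp.linearCombination_single, one_smul, Fin.sum_univ_two]
  have hone (x : stdSimplex ℝ (Fin 1)) : x.1 0 = 1 := by
    have := x.2.2
    rwa [Fin.sum_univ_one] at this
  refine Submodule.add_mem _ (Submodule.smul_mem _ _ (Finsupp.single_mem_supported ℤ 1 ?_))
    (Submodule.smul_mem _ _ (Finsupp.single_mem_supported ℤ 1 ?_))
  · rintro - ⟨x, rfl⟩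
    change γ (T * ((stdSimplex.map (Fin.succAbove 0) x).1 1 -
      (stdSimplex.map (Fin.succAbove 0) x).1 0)) ∈ A
    have e1 : (stdSimplex.map (Fin.succAbove (0 : Fin 2)) x).1 1 = x.1 0 := by
      rw [stdSimplex_map_apply, Finset.sum_filter, Fin.sum_univ_one]; simp
    have e2 : (stdSimplex.map (Fin.succAbove (0 : Fin 2)) x).1 0 = 0 := by
      rw [stdSimplex_map_apply, Finset.sum_filter, Fin.sum_univ_one]; simp
    rw [e1, e2, hone, sub_zero, mul_one]
    exact h1
  · rintro - ⟨x, rfl⟩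
    change γ (T * ((stdSimplex.map (Fin.succAbove 1) x).1 1 -
      (stdSimplex.map (Fin.succAbove 1) x).1 0)) ∈ A
    have e1 : (stdSimplex.map (Fin.succAbove (1 : Fin 2)) x).1 1 = 0 := by
      rw [stdSimplex_map_apply, Finset.sum_filter, Fin.sum_univ_one]; simp
    have e2 : (stdSimplex.map (Fin.succAbove (1 : Fin 2)) x).1 0 = x.1 0 := by
      rw [stdSimplex_map_apply, Finset.sum_filter, Fin.sum_univ_one]; simp
    rw [e1, e2, hone, zero_sub, mul_neg, mul_one]
    exact h2

/-- The truncations of a curve, whose ends are joined in `A` with `a` and `b`, are relative cycles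
homologous to the difference of the segments to `a` and `b`. -/
theorem exists_truncatedChain_sub_mem {A : Set ℂ} {γ : C(ℝ, ℂ)} {a b : ℂ}
    (h : ∀ᶠ T in atTop, JoinedIn A a (γ T) ∧ JoinedIn A b (γ (-T))) :
    ∃ T₀ : ℝ, ∀ T, T₀ ≤ T → truncatedChain γ T ∈ relCycles A 0 ∧
      truncatedChain γ T - (Finsupp.single (segmentFromZero a) (1 : ℤ) -
        Finsupp.single (segmentFromZero b) 1) ∈ relBoundaries A 0 := by
  obtain ⟨T₀, hT₀⟩ := eventually_atTop.1 h
  refine ⟨T₀, fun T hT => ?_⟩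
  obtain ⟨h1, h2⟩ := hT₀ T hT
  refine ⟨truncatedChain_mem_relCycles h1.target_mem h2.target_mem, ?_⟩
  have e := curveSimplex_sub_mem A ⟨fun s => γ (T * (2 * s - 1)), by fun_prop⟩
  rw [← truncatedChain_eq] at e
  have e1 : γ (T * (2 * 1 - 1)) = γ T := by congr 1; ring
  have e2 : γ (T * (2 * 0 - 1)) = γ (-T) := by congr 1; ring
  simp only [ContinuousMap.coe_mk, e1, e2] at e
  have := Submodule.sub_mem _ (Submodule.add_mem _ e (segmentFromZero_sub_mem h1))
    (segmentFromZero_sub_mem h2)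
  convert this using 1
  abel

/-- D is independent of T, so any two truncations differ by a relative boundary. -/
theorem representsClass_mk {A : Set ℂ} {γ : C(ℝ, ℂ)} {D : SingChain ℂ 1} {T₀ : ℝ}
    (h : ∀ T, T₀ ≤ T → truncatedChain γ T ∈ relCycles A 0 ∧
      truncatedChain γ T - D ∈ relBoundaries A 0) :
    RepresentsClass γ (Submodule.Quotient.mk ⟨truncatedChain γ T₀, (h T₀ le_rfl).1⟩ :
      RelHomology A 0) := by
  refine ⟨T₀, fun T hT => ⟨(h T hT).1, ?_⟩⟩
  rw [Submodule.Quotient.eq]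
  change truncatedChain γ T₀ - truncatedChain γ T ∈ relBoundaries A 0
  have := Submodule.sub_mem _ (h T₀ le_rfl).2 (h T hT).2
  rwa [sub_sub_sub_cancel_right] at this

/-! ### The jump of the homology classes of the thimbles -/

/-- The part of a sector at infinity that is parametrized by a half strip. -/
def endSet (κ δ X : ℝ) : Set ℂ := (fun Y : ℂ => 2 * cosh ((Y + κ * I) / 3)) '' endStrip δ X

theorem endSet_joinedIn {κ δ X : ℝ} {a b : ℂ} (ha : a ∈ endSet κ δ X) (hb : b ∈ endSet κ δ X) :
    JoinedIn (endSet κ δ X) a b := by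
  have hne : (endStrip δ X).Nonempty := by
    obtain ⟨Y, hY, -⟩ := ha; exact ⟨Y, hY⟩
  exact (((convex_endStrip δ X).isPathConnected hne).image (by fun_prop)).joinedIn a ha b hb

theorem HasEnd.eventually_mem {κ θ δ : ℝ} {f : ℝ → ℂ} (hf : HasEnd κ θ f) (hθ : |θ| < δ) (X : ℝ) :
    ∀ᶠ T in atTop, f T ∈ endSet κ δ X := by
  obtain ⟨Y, h1, h2⟩ := hf
  filter_upwards [h1, eventually_mem_endStrip hθ h2,
    tendsto_log_three_mul_sq.eventually_ge_atTop (X + 1)] with T e1 e2 e3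
  exact ⟨Y T, ⟨by linarith [e2.1], e2.2⟩, e1.symm⟩

theorem exists_endSet_subset {δ ε : ℝ} (hδ : 0 ≤ δ) (hε : 0 ≤ ε) (h : δ + ε < Real.pi / 2)
    (R : ℝ) : ∃ X : ℝ, ∀ κ : ℝ, exp (κ * I) = 1 →
      endSet κ δ X ⊆ commonPositiveEnd airyS ε R := by
  have hc : 0 < Real.cos (δ + ε) := Real.cos_pos_of_mem_Ioo ⟨by linarith [Real.pi_pos], h⟩
  -- The lower bound (2/3)(e^X cos(δ + ε) - 1)/2 ≥ R is equivalent to e^X cos(δ + ε) ≥ 3R + 1.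
  obtain ⟨X, hX, hX0⟩ := ((Real.tendsto_exp_atTop.eventually_ge_atTop
    ((3 * R + 1) / Real.cos (δ + ε))).and (eventually_ge_atTop 0)).exists
  rw [div_le_iff₀ hc] at hX
  refine ⟨X, fun κ hκ => ?_⟩
  rintro - ⟨Y, hY, rfl⟩ φ hφ
  have h1 := re_exp_mul_cosh_ge (φ := φ) (μ := δ + ε) (hX0.trans hY.1)
    (add_le_add hY.2 hφ) (by linarith [Real.pi_pos])
  have h2 : Real.exp X ≤ Real.exp Y.re := Real.exp_le_exp.2 hY.1
  change R ≤ (exp (-(φ : ℂ) * I) * airyS (2 * cosh ((Y + κ * I) / 3))).re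
  rw [airyS_two_cosh hκ, mul_left_comm, show (2 / 3 : ℂ) = ((2 / 3 : ℝ) : ℂ) by norm_num,
    re_ofReal_mul]
  nlinarith [mul_le_mul_of_nonneg_right h2 hc.le]

theorem IsOrientedThimble.exists_truncatedChain {θ δ X κ₁ κ₂ : ℝ} {j : Fin 2} {γ : C(ℝ, ℂ)}
    {A : Set ℂ} (hθ : Real.sin θ ≠ 0) (hδ : |θ| < δ)
    (hγ : IsOrientedThimble airyS θ (airyCrit j) (airyOrientation θ j) γ)
    (h1 : HasEnd κ₁ θ fun T => normalCurve θ j (1 * T))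
    (h2 : HasEnd κ₂ θ fun T => normalCurve θ j (-1 * T))
    (hA1 : endSet κ₁ δ X ⊆ A) (hA2 : endSet κ₂ δ X ⊆ A) {a b : ℂ} (ha : a ∈ endSet κ₁ δ X)
    (hb : b ∈ endSet κ₂ δ X) :
    ∃ T₀ : ℝ, ∀ T, T₀ ≤ T → truncatedChain γ T ∈ relCycles A 0 ∧
      truncatedChain γ T - (Finsupp.single (segmentFromZero a) (1 : ℤ) -
        Finsupp.single (segmentFromZero b) 1) ∈ relBoundaries A 0 := by
  obtain ⟨τ, τ', -, hmono, hsurj, hτ⟩ := hγ.exists_reparametrization hθ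
  have htop : Tendsto τ atTop atTop := (hmono.orderIsoOfSurjective τ hsurj).tendsto_atTop
  have hbot : Tendsto τ atBot atBot := (hmono.orderIsoOfSurjective τ hsurj).tendsto_atBot
  have hneg : Tendsto (fun T => -τ (-T)) atTop atTop :=
    tendsto_neg_atBot_atTop.comp (hbot.comp tendsto_neg_atTop_atBot)
  refine exists_truncatedChain_sub_mem ?_
  filter_upwards [htop.eventually (h1.eventually_mem hδ X),
    hneg.eventually (h2.eventually_mem hδ X)] with T e1 e2
  rw [one_mul, ← hτ] at e1
  rw [neg_one_mul, neg_neg, ← hτ] at e2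
  exact ⟨(endSet_joinedIn ha e1).mono hA1, (endSet_joinedIn hb e2).mono hA2⟩

/-- Choose a point in each sector and write [κ] for the segment from 0 to it. Both thimbles through
-1 are [-2π] - [2π]; the thimble through 1 is [-2π] - [0] at phase ε and [2π] - [0] at phase -ε. The
relation is a sum of these chains. -/
theorem homology_jump {ε : ℝ} (hε : 0 < ε) (hε2 : ε < Real.pi / 4) {γl γr : Fin 2 → C(ℝ, ℂ)}
    (hl : ∀ j, IsOrientedThimble airyS (-ε) (airyCrit j) (airyOrientation (-ε) j) (γl j))
    (hr : ∀ j, IsOrientedThimble airyS ε (airyCrit j) (airyOrientation ε j) (γr j)) (R : ℝ) :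
    ∃ Jl Jr : Fin 2 → RelHomology (commonPositiveEnd airyS ε R) 0,
      (∀ j, RepresentsClass (γl j) (Jl j)) ∧ (∀ j, RepresentsClass (γr j) (Jr j)) ∧
      ∀ j, Jr j = ∑ i : Fin 2, airyJumpMatrix i j • Jl i := by
  have hsr : Real.sin ε ≠ 0 := sin_ne_zero_of_abs_lt (by rwa [abs_of_pos hε])
    (by rw [abs_of_pos hε]; linarith)
  have hsl : Real.sin (-ε) ≠ 0 := by rwa [Real.sin_neg, neg_ne_zero]
  -- Here ε < π/4 is needed: the strip must be wider than ε, and δ + ε must stay below π/2 so that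
  -- its image is positive for all phases up to ε.
  obtain ⟨δ, hδ1, hδ2⟩ := exists_between (show ε < Real.pi / 2 - ε by linarith)
  have er : |ε| < δ := by rwa [abs_of_pos hε]
  have el : |-ε| < δ := by rwa [abs_neg]
  obtain ⟨X, hX⟩ := exists_endSet_subset (δ := δ) (ε := ε) (by linarith) hε.le (by linarith) R
  have hmem (κ : ℝ) : 2 * cosh (((X : ℂ) + κ * I) / 3) ∈ endSet κ δ X :=
    ⟨X, ⟨by simp, by simp; linarith⟩, rfl⟩
  have E := jumpEnds hε (by linarith)
  have s1 := hX _ (exp_two_pi_mul (s := 1) (Or.inl rfl))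
  have s2 := hX _ (exp_two_pi_mul (s := -1) (Or.inr rfl))
  have s0 := hX 0 (by simp)
  obtain ⟨Tl0, l0⟩ := (hl 0).exists_truncatedChain hsl el (E.minus (-ε) (by simp) 1 (by simp))
    (E.minus (-ε) (by simp) (-1) (by simp)) s1 s2 (hmem _) (hmem _)
  obtain ⟨Tl1, l1⟩ := (hl 1).exists_truncatedChain hsl el E.plus_left
    (E.plus_neg (-ε) (by simp)) s2 s0 (hmem _) (hmem _)
  obtain ⟨Tr0, r0⟩ := (hr 0).exists_truncatedChain hsr er (E.minus ε (by simp) 1 (by simp))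
    (E.minus ε (by simp) (-1) (by simp)) s1 s2 (hmem _) (hmem _)
  obtain ⟨Tr1, r1⟩ := (hr 1).exists_truncatedChain hsr er E.plus_right
    (E.plus_neg ε (by simp)) s1 s0 (hmem _) (hmem _)
  refine ⟨![Submodule.Quotient.mk ⟨_, (l0 Tl0 le_rfl).1⟩,
      Submodule.Quotient.mk ⟨_, (l1 Tl1 le_rfl).1⟩],
    ![Submodule.Quotient.mk ⟨_, (r0 Tr0 le_rfl).1⟩,
      Submodule.Quotient.mk ⟨_, (r1 Tr1 le_rfl).1⟩], ?_, ?_, ?_⟩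
  · rw [Fin.forall_fin_two]
    exact ⟨representsClass_mk l0, representsClass_mk l1⟩
  · rw [Fin.forall_fin_two]
    exact ⟨representsClass_mk r0, representsClass_mk r1⟩
  · rw [Fin.forall_fin_two]
    constructor
    · rw [Fin.sum_univ_two]
      simp only [airyJumpMatrix, Matrix.of_apply, Matrix.cons_val', Matrix.cons_val_zero,
        Matrix.cons_val_one, Matrix.cons_val_fin_one, one_smul, zero_smul, add_zero]
      rw [Submodule.Quotient.eq]
      have := Submodule.sub_mem _ (r0 Tr0 le_rfl).2 (l0 Tl0 le_rfl).2
      rwa [sub_sub_sub_cancel_right] at this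
    · rw [Fin.sum_univ_two]
      simp only [airyJumpMatrix, Matrix.of_apply, Matrix.cons_val', Matrix.cons_val_zero,
        Matrix.cons_val_one, Matrix.cons_val_fin_one, one_smul]
      rw [← Submodule.Quotient.mk_add, Submodule.Quotient.eq]
      change truncatedChain (γr 1) Tr1 - (truncatedChain (γl 0) Tl0 + truncatedChain (γl 1) Tl1) ∈
        relBoundaries _ 0
      have := Submodule.sub_mem _ (Submodule.sub_mem _ (r1 Tr1 le_rfl).2 (l0 Tl0 le_rfl).2)
        (l1 Tl1 le_rfl).2
      convert this using 1
      abel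

end

/-! ### Assembly of the theorem -/

theorem mainTheorem5 :
    -- the ordinary Borel transforms of the reduced saddle series
    (∀ ξ : ℂ, ‖ξ‖ < 4 / 3 →
      HasSum (fun m : ℕ => PowerSeries.coeff m airyPhiPlus * ξ ^ m / (m.factorial : ℂ))
          (ordinaryHypergeometric (1 / 6 : ℂ) (5 / 6 : ℂ) (1 : ℂ) (3 * ξ / 4)) ∧
      HasSum (fun m : ℕ => PowerSeries.coeff m airyPhiMinus * ξ ^ m / (m.factorial : ℂ))
          (ordinaryHypergeometric (1 / 6 : ℂ) (5 / 6 : ℂ) (1 : ℂ) (-(3 * ξ / 4)))) ∧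
    -- the first singularity of the Borel transform of `φ_+` is logarithmic, at `4/3`
    (∃ G H : ℂ → ℂ, ∃ r : ℝ, 0 < r ∧ r ≤ 4 / 3 ∧
      DifferentiableOn ℂ G airyCutPlusᶜ ∧
      (∀ ξ : ℂ, ‖ξ‖ < 4 / 3 → G ξ = borelSum 1 airyPhiPlus ξ) ∧
      DifferentiableOn ℂ H (Metric.ball (4 / 3) r) ∧
      ∀ ξ ∈ Metric.ball (4 / 3 : ℂ) r \ airyCutPlus,
        G ξ = H ξ - Complex.I / (2 * Real.pi * Complex.I) *
          (Complex.log (4 / 3 - ξ) + Real.pi * Complex.I) *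
            borelSum 1 airyPhiMinus (ξ - 4 / 3)) ∧
    -- the first singularity of the Borel transform of `φ_-` is logarithmic, at `-4/3`
    (∃ G H : ℂ → ℂ, ∃ r : ℝ, 0 < r ∧ r ≤ 4 / 3 ∧
      DifferentiableOn ℂ G airyCutMinusᶜ ∧
      (∀ ξ : ℂ, ‖ξ‖ < 4 / 3 → G ξ = borelSum 1 airyPhiMinus ξ) ∧
      DifferentiableOn ℂ H (Metric.ball (-(4 / 3)) r) ∧
      ∀ ξ ∈ Metric.ball (-(4 / 3) : ℂ) r \ airyCutMinus,
        G ξ = H ξ - Complex.I / (2 * Real.pi * Complex.I) *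
          Complex.log (ξ + 4 / 3) * borelSum 1 airyPhiPlus (ξ + 4 / 3)) ∧
    -- the alien operators on the reduced series (ordinary Borel transform)
    IsAlienPlus 1 (4 / 3) airyPhiPlus (-Complex.I • airyPhiMinus) ∧
    IsAlienPlus 1 (-(4 / 3)) airyPhiMinus (-Complex.I • airyPhiPlus) ∧
    IsAlienPlus 1 (-(4 / 3)) airyPhiPlus 0 ∧
    IsAlienPlus 1 (4 / 3) airyPhiMinus 0 ∧
    -- the pointed alien operators on the full saddle series
    IsPointedAlienPlus (4 / 3) (airyI 1) (-airyI 0) ∧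
    IsPointedAlienPlus (-(4 / 3)) (airyI 0) (airyI 1) ∧
    IsPointedAlienPlus (-(4 / 3)) (airyI 1) 0 ∧
    IsPointedAlienPlus (4 / 3) (airyI 0) 0 ∧
    -- the Stokes automorphism along the positive ray
    (∀ j : Fin 2,
      IsStokesPlus (borelRay 0) (airyI j) (∑ i : Fin 2, airyStokesMatrix i j • airyI i)) ∧
    -- existence of the oriented thimbles at phases `θ ≠ 0`; the series are their expansions
    (∀ θ : ℝ, 0 < |θ| → |θ| < Real.pi / 2 → ∀ j : Fin 2,
      (∃ γ : C(ℝ, ℂ), IsOrientedThimble airyS θ (airyCrit j) (airyOrientation θ j) γ) ∧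
      ∀ γ : C(ℝ, ℂ), IsOrientedThimble airyS θ (airyCrit j) (airyOrientation θ j) γ →
        (∀ h : ℂ, h ≠ 0 → |h.arg - θ| < Real.pi / 2 →
          MeasureTheory.Integrable (expIntegrand airyS γ h)) ∧
        ∀ η : ℝ, 0 < η → η < Real.pi / 2 →
          HasSaddleExpansion (expIntegral airyS γ) (airyS (airyCrit j)) (airyPsi j)
            {h | h ≠ 0 ∧ |h.arg - θ| ≤ η}) ∧
    -- the jump of the thimble integrals and of the thimbles between the phases `-ε` and `ε`
    (∀ ε : ℝ, 0 < ε → ε < Real.pi / 4 → ∀ γl γr : Fin 2 → C(ℝ, ℂ),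
      (∀ j, IsOrientedThimble airyS (-ε) (airyCrit j) (airyOrientation (-ε) j) (γl j)) →
      (∀ j, IsOrientedThimble airyS ε (airyCrit j) (airyOrientation ε j) (γr j)) →
      (∀ h : ℂ, h ≠ 0 → |h.arg| < Real.pi / 2 - ε →
        (∀ j, expIntegral airyS (γl j) h =
          ∑ i : Fin 2, (airyStokesMatrix i j : ℂ) * expIntegral airyS (γr i) h) ∧
        (∀ j, expIntegral airyS (γr j) h =
          ∑ i : Fin 2, (airyJumpMatrix i j : ℂ) * expIntegral airyS (γl i) h)) ∧
      ∀ R : ℝ, ∃ Jl Jr : Fin 2 → RelHomology (commonPositiveEnd airyS ε R) 0,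
        (∀ j, RepresentsClass (γl j) (Jl j)) ∧
        (∀ j, RepresentsClass (γr j) (Jr j)) ∧
        ∀ j, Jr j = ∑ i : Fin 2, airyJumpMatrix i j • Jl i) ∧
    -- the connecting trajectories from `p_-` to `p_+` at phase `0`, and their number
    (∀ z : ℝ → ℂ,
      ((∀ s, HasDerivAt z (negGradient airyS 0 (z s)) s) ∧
        Filter.Tendsto z Filter.atBot (nhds (airyCrit 0)) ∧
        Filter.Tendsto z Filter.atTop (nhds (airyCrit 1))) ↔
      ∃ s₀ : ℝ, ∀ s, z s = (Real.tanh (s - s₀) : ℂ)) ∧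
    numConnectingTrajectories airyS 0 (airyCrit 0) (airyCrit 1) = 1 ∧
    airyJumpMatrix 0 1 = (numConnectingTrajectories airyS 0 (airyCrit 0) (airyCrit 1) : ℤ) := by
  refine ⟨fun ξ hξ => airyBorel_hasSum ξ hξ, airyPhiPlus_log, airyPhiMinus_log, alien_phiPlus,
    alien_phiMinus, alien_phiPlus_zero, alien_phiMinus_zero, pointedAlien_I_one,
    pointedAlien_I_zero, pointedAlien_I_one_zero, ?_, airy_stokes, ?_, ?_, connecting_iff,
    numConnecting_eq_one, ?_⟩
  · have := pointedAlien_I_zero_of_pos (t := 4 / 3) (by norm_num)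
    push_cast at this
    exact this
  · intro θ h0 h1 j
    refine ⟨exists_isOrientedThimble (sin_ne_zero_of_abs_lt h0 h1) j, fun γ hγ => ?_⟩
    have hθ := sin_ne_zero_of_abs_lt h0 h1
    refine ⟨fun h hh ha => (hγ.integrable_and_integral hθ h).1
      (integrable_normalIntegrand hθ j hh ha), fun η hη0 hη => ?_⟩
    rw [show expIntegral airyS γ = fun h => ∫ t, normalIntegrand θ j h t from
      funext fun h => (hγ.integrable_and_integral hθ h).2]
    exact hasSaddleExpansion_normalCurve hθ j hη0 hη
  · intro ε hε hε2 γl γr hl hr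
    exact ⟨fun h h0 ha => expIntegral_jump hε (by linarith [Real.pi_pos]) hl hr h0 ha,
      homology_jump hε hε2 hl hr⟩
  · rw [numConnecting_eq_one]
    simp [airyJumpMatrix]
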